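/- **Setting.** All registers have Hilbert spaces $\ell^2(n)$ for index sets $n$ of any cardinality; states are density operators; channels are completely positive trace-preserving maps on trace-class operators; $d(\rho,\sigma)=\frac12\|\rho-\sigma\|_1$. Time is discrete, $\tau=0,1,2,\dots$. A *system* (resource) has a memory with a fixed initial state, and at each tick $\tau$ applies a ($\tau$-dependent) channel to its memory and the incoming messages, producing the outgoing messages and the new memory. Systems are composed in parallel; a *converter* attached to an interface at each tick receives the outer message, sends a message to the system inside, receives its answer and emits an outer message, keeping a memory of its own. A *strategy* has a memory with an initial state and at each tick sends messages to, and receives messages from, all interfaces of a system; a *distinguisher* $D$ is a strategy that stops after a finite number of ticks and outputs a bit. For a class $\mathcal D$ of distinguishers, $d^{\mathcal D}(S,T)=\sup_{D\in\mathcal D}|\Pr[D(S)=1]-\Pr[D(T)=1]|$. A protocol $\pi_{AB}$ (a converter at the interfaces of Alice and Bob) *constructs* $S$ from $R$ within $\varepsilon$ if there is a converter $\sigma_E$ (simulator) at Eve's interface with $d^{\mathcal D}(\pi_{AB}R,\,S\sigma_E)\le\varepsilon$. **Devices and resources.** Each device model $M$ in a universe $\mathcal U$ provides a state preparation device for Alice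 (classical setting in, signal out) and a measurement device for Bob (classical setting and signal in, classical outcome out). At each tick each device may be used or left unused; it has a memory, and on command its memory is cleared, i.e. replaced by a fixed state (which may depend on $\tau$). The behaviour of the devices may depend on $\tau$. Each model has a list of parameters $\mu(M)=(\mu_1,\dots,\mu_{N_{\rm param}})$. For dishonest Eve, $\mathcal R_{\rm ini}(M)$ consists of these two devices, an insecure quantum channel (Alice's signals go to Eve, Eve chooses the signals delivered to Bob), and an authenticated two-way classical channel between Alice and Bob, all of whose messages are copied to Eve. Let $t_1<\dots<t_{N_{\max}}$ be times. $\mathcal R_{\rm ideal}$ is the resource that at each time $t_j$ accepts a length $\ell_j\in\mathbb N$ from Eve and outputs a uniformly random key of length $\ell_j$, the same to Alice and to Bob. **Protocol.** First, during a fixed number $c\le t_1$ of ticks, a certification procedure is performed on $\mathcal R_{\rm ini}$ (using the interfaces of Alice and Bob), producing a bit $F$. If $F=1$, then $N_{\max}$ QKD instances are run: instance $1$ during the ticks $c,\dots,t_1$ and instance $j\ge2$ during the ticks $t_{j-1}+1,\dots,t_j$. Each consists of local programs of Alice and Bob, starts with fresh local memories, ends by outputting classical keys (bit strings, possibly of length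 $0$) at time $t_j$, and for $j\ge2$ begins by clearing the memories of the devices. If $F=0$, the devices are not used again and keys of length $0$ are output at all times $t_j$. Nothing else is output to Alice and Bob, and $F$ is not output. **Criteria.** Let $\mathcal A$ be a class of attacks (strategies), let $\mathcal S$ be a set of parameter values, and let $\varepsilon^{\rm cert},\varepsilon_j^{\rm QKD}\ge0$. Let $Q_{j-1}$ consist of the attacker's memory and the device memories at the beginning of instance $j$, and let $E_j$ consist of everything the attacker holds at time $t_j$ apart from the keys $K^A_jK^B_j$. Let $\mathcal E_j^{A,M}:Q_{j-1}\to K^A_jK^B_jE_j$ be the channel describing instance $j$ for model $M$ and attack $A$, and let $\mathcal K_j$ be the channel that reads the length $\ell$ of the keys (that of Alice's key, should the two differ) and replaces them by $\sum_{k\in\{0,1\}^\ell}2^{-\ell}|kk\rangle\langle kk|$. Suppose: 1. for every $M\in\mathcal U$ with $\mu(M)\notin\mathcal S$ and every $A\in\mathcal A$, certification approves with probability $\Pr[F=1]\le\varepsilon^{\rm cert}$; 2. for every $M\in\mathcal U$ with $\mu(M)\in\mathcal S$, every $j$, every $A\in\mathcal A$ and every state $\sigma$ on $Q_{j-1}$,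 $$d\big(\mathcal E_j^{A,M}[\sigma],\ \mathcal K_j\circ\mathcal E_j^{A,M}[\sigma]\big)\le\varepsilon_j^{\rm QKD}.$$ **Proposition.** Let $\mathcal D$ be a class of distinguishers whose strategies all lie in $\mathcal A$. Then for every device model $M\in\mathcal U$ the protocol constructs $\mathcal R_{\rm ideal}$ from $\mathcal R_{\rm ini}(M)$ within $$\varepsilon^{\rm total}=\varepsilon^{\rm cert}+\sum_{j=1}^{N_{\max}}\varepsilon_j^{\rm QKD}.$$ -/

import Mathlib

noncomputable section

open scoped ENNReal ComplexOrder

namespace AC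

/-! ### Quantum systems

A register is given by a type `n`, finite or infinite, indexing an orthonormal basis; its Hilbert
space is `ℓ²(n)`. The basis state `a` also stands for the classical value `a`. Operators are given by
their matrices. The composite of two registers is the product type, the direct sum of two Hilbert
spaces the sum type, and `Unit` is the trivial register. -/

/-- Matrices of positive trace class operators on `ℓ²(n)`: positive semidefinite with finite
trace. -/
def IsPosTC {n : Type} (ρ : Matrix n n ℂ) : Prop := ρ.PosSemidef ∧ Summable fun i => ρ i i

/-- The trace class operators on `ℓ²(n)`: the linear combinations of positive ones. -/
def TC (n : Type) : Submodule ℂ (Matrix n n ℂ) := Submodule.span ℂ {ρ | IsPosTC ρ}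

theorem IsPosTC.mem {n : Type} {ρ : Matrix n n ℂ} (h : IsPosTC ρ) : ρ ∈ TC n := Submodule.subset_span h

theorem TC.summable {n : Type} {ρ : Matrix n n ℂ} (h : ρ ∈ TC n) : Summable fun i => ρ i i := by
  induction h using Submodule.span_induction with
  | mem x hx => exact hx.2
  | zero => simp
  | add x y _ _ hx hy => simpa using hx.add hy
  | smul a x _ hx => simpa using hx.mul_left a

def TC.trace {n : Type} : TC n →ₗ[ℂ] ℂ where
  toFun ρ := ∑' i, ρ.1 i i
  map_add' ρ σ := (TC.summable ρ.2).tsum_add (TC.summable σ.2)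
  map_smul' c ρ := by simpa using tsum_mul_left

theorem posSemidef_of_finite {n : Type} {M : Matrix n n ℂ}
    (h : ∀ (k : ℕ) (e : Fin k → n), (M.submatrix e e).PosSemidef) : M.PosSemidef := by
  refine ⟨?_, fun x => ?_⟩
  · ext i j
    have := (h 2 ![i, j]).1
    exact congrFun (congrFun this 0) 1
  · set e : Fin x.support.card → n := fun a => (x.support.equivFin.symm a : n)
    have h1 := (h _ e).2 (Finsupp.equivFunOnFinite.symm fun a => x (e a))
    rw [Finsupp.sum_fintype _ _ (by simp)] at h1
    simp_rw [Finsupp.sum_fintype _ _ (by simp : ∀ i, _ * 0 = (0 : ℂ))] at h1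
    convert h1 using 1
    unfold Finsupp.sum
    rw [← Finset.sum_coe_sort x.support, ← Equiv.sum_comp x.support.equivFin.symm]
    refine Finset.sum_congr rfl fun a _ => ?_
    beta_reduce
    rw [← Finset.sum_coe_sort x.support, ← Equiv.sum_comp x.support.equivFin.symm]
    rfl

/-- The block `(id ⊗ ⟨r|) ρ (id ⊗ |s⟩)`. -/
def slice {n R : Type} (ρ : Matrix (n × R) (n × R) ℂ) (r s : R) : Matrix n n ℂ :=
  fun i j => ρ (i, r) (j, s)

theorem IsPosTC.submatrix {n m : Type} {ρ : Matrix n n ℂ} (h : IsPosTC ρ) {e : m → n}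
    (he : e.Injective) : IsPosTC (ρ.submatrix e e) :=
  ⟨h.1.submatrix e, h.2.comp_injective he⟩

theorem TC.map_mem {n m : Type} (L : Matrix n n ℂ →ₗ[ℂ] Matrix m m ℂ)
    (hL : ∀ ρ, IsPosTC ρ → L ρ ∈ TC m) {ρ : Matrix n n ℂ} (h : ρ ∈ TC n) : L ρ ∈ TC m := by
  have : TC n ≤ (TC m).comap L := Submodule.span_le.2 fun x hx => hL x hx
  exact this h

theorem TC.slice_mem {n R : Type} {ρ : Matrix (n × R) (n × R) ℂ} (h : ρ ∈ TC (n × R)) (r s : R) :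
    slice ρ r s ∈ TC n := by
  let L : Matrix (n × R) (n × R) ℂ →ₗ[ℂ] Matrix n n ℂ :=
    { toFun := fun ρ => slice ρ r s, map_add' := fun _ _ => rfl, map_smul' := fun _ _ => rfl }
  refine TC.map_mem L (fun ρ hρ => ?_) h
  have psd : ∀ c : ℂ, star c * c = 1 → (slice ρ r r + c • slice ρ r s + (star c) • slice ρ s r
      + slice ρ s s).PosSemidef := by
    intro c hcc
    refine posSemidef_of_finite fun k e => ?_
    let f : Fin k ⊕ Fin k → n × R := Sum.elim (fun a => (e a, r)) (fun a => (e a, s))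
    let V : Matrix (Fin k ⊕ Fin k) (Fin k) ℂ := Matrix.fromRows 1 (c • 1)
    have := (hρ.1.submatrix f).conjTranspose_mul_mul_same V
    convert this using 1
    have e1 : ρ.submatrix f f = Matrix.fromBlocks ((slice ρ r r).submatrix e e)
      ((slice ρ r s).submatrix e e) ((slice ρ s r).submatrix e e)
      ((slice ρ s s).submatrix e e) := by
      ext (i | i) (j | j) <;> rfl
    rw [e1]
    simp only [V, Matrix.conjTranspose_fromRows_eq_fromCols_conjTranspose,
      Matrix.fromCols_mul_fromBlocks, Matrix.fromCols_mul_fromRows]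
    ext i j
    simp [smul_smul] at hcc ⊢
    linear_combination (-slice ρ s s (e i) (e j)) * hcc
  have hs : ∀ r : R, Summable fun i => ρ (i, r) (i, r) := fun r =>
    hρ.2.comp_injective (i := fun i : n => (i, r)) (fun a b h => by simpa using h)
  have key : ∀ c : ℂ, star c * c = 1 → IsPosTC (slice ρ r r + c • slice ρ r s
      + (star c) • slice ρ s r + slice ρ s s) := by
    intro c hcc
    refine ⟨psd c hcc, Summable.of_norm_bounded
      (g := fun i => ‖2 * (ρ (i, r) (i, r) + ρ (i, s) (i, s))‖)
      (((hs r).add (hs s)).mul_left 2).norm fun i => ?_⟩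
    have h1 := (psd c hcc).diag_nonneg (i := i)
    have h2 := (psd (-c) (by simpa using hcc)).diag_nonneg (i := i)
    refine CStarAlgebra.norm_le_norm_of_nonneg_of_le h1 ?_
    rw [← sub_nonneg]
    convert h2 using 1
    simp [slice]
    ring
  have hsum : slice ρ r s = (1 / 4 : ℂ) • (∑ k : Fin 4, star (![1, -1, Complex.I, -Complex.I] k) •
      (slice ρ r r + (![1, -1, Complex.I, -Complex.I] k) • slice ρ r s
      + (star (![1, -1, Complex.I, -Complex.I] k)) • slice ρ s r + slice ρ s s)) := by
    ext i j
    simp [Fin.sum_univ_four]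
    linear_combination ((1 / 2) * slice ρ r s i j - (1 / 2) * slice ρ s r i j) * Complex.I_mul_I
  change slice ρ r s ∈ TC n
  rw [hsum]
  refine Submodule.smul_mem _ _ (Submodule.sum_mem _ fun k _ => Submodule.smul_mem _ _
    (key _ ?_).mem)
  fin_cases k <;> simp

/-- The matrix of `(Φ ⊗ id_R)(ρ)`: `Φ` applied to each block of `ρ`. -/
def amplMat {n m : Type} (R : Type) (Φ : TC n →ₗ[ℂ] TC m) (ρ : TC (n × R)) :
    Matrix (m × R) (m × R) ℂ :=
  fun a b => (Φ ⟨slice ρ.1 a.2 b.2, TC.slice_mem ρ.2 a.2 b.2⟩).1 a.1 b.1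

/-- Quantum channels: completely positive trace preserving maps on trace class operators. Complete
positivity is the positivity of `Φ ⊗ id` on `ℓ²(n) ⊗ ℂᵏ` for all `k`. -/
structure Channel (n m : Type) where
  map : TC n →ₗ[ℂ] TC m
  completelyPositive : ∀ (k : ℕ) (ρ : TC (n × Fin k)), ρ.1.PosSemidef →
    (amplMat (Fin k) map ρ).PosSemidef
  tracePreserving : ∀ ρ : TC n, TC.trace (map ρ) = TC.trace ρ

theorem summable_iff_re {ι : Type} {f : ι → ℂ} (h0 : ∀ i, 0 ≤ f i) :
    Summable f ↔ Summable fun i => (f i).re := by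
  have : f = fun i => (((f i).re : ℝ) : ℂ) :=
    funext fun i => Complex.ext rfl (Complex.nonneg_iff.1 (h0 i)).2.symm
  conv_lhs => rw [this]
  exact Complex.summable_ofReal

theorem summable_prod_iff {n R : Type} {f : n × R → ℂ} (h0 : ∀ p, 0 ≤ f p) :
    Summable f ↔ (∀ r, Summable fun i => f (i, r)) ∧ Summable fun r => ∑' i, (f (i, r)).re := by
  rw [← (Equiv.prodComm R n).summable_iff, summable_iff_re (f := f ∘ Equiv.prodComm R n)
    fun p => h0 _]
  refine (summable_prod_of_nonneg fun p => (Complex.nonneg_iff.1 (h0 _)).1).trans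
    (and_congr (forall_congr' fun r => ?_) Iff.rfl)
  exact (summable_iff_re fun i => h0 (i, r)).symm

theorem tsum_prod_swap {n R : Type} {f : n × R → ℂ} (h : Summable f) :
    ∑' p, f p = ∑' r, ∑' i, f (i, r) :=
  ((Equiv.prodComm R n).tsum_eq f).symm.trans ((Equiv.prodComm R n).summable_iff.2 h).tsum_prod

theorem TC.induction {n : Type} {p : TC n → Prop} (pos : ∀ ρ : TC n, IsPosTC ρ.1 → p ρ)
    (add : ∀ ρ σ, p ρ → p σ → p (ρ + σ)) (smul : ∀ (c : ℂ) ρ, p ρ → p (c • ρ)) (ρ : TC n) :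
    p ρ := by
  obtain ⟨ρ, hρ⟩ := ρ
  induction hρ using Submodule.span_induction with
  | mem x hx => exact pos _ hx
  | zero => exact pos _ ⟨Matrix.PosSemidef.zero, by simp⟩
  | add x y hx hy h1 h2 => exact add _ _ h1 h2
  | smul c x hx h1 => exact smul c _ h1

theorem posSemidef_of_hasSum {ι : Type} {k : ℕ} {N : ι → Matrix (Fin k) (Fin k) ℂ}
    {M : Matrix (Fin k) (Fin k) ℂ} (hN : ∀ i, (N i).PosSemidef)
    (h : ∀ a b, HasSum (fun i => N i a b) (M a b)) : M.PosSemidef := by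
  refine ⟨?_, fun x => ?_⟩
  · ext a b
    refine HasSum.unique (f := fun i => star (N i b a)) (h b a).star ?_
    have e : (fun i => star (N i b a)) = fun i => N i a b :=
      funext fun i => congrFun (congrFun (hN i).1 a) b
    exact e ▸ h a b
  · have : HasSum (fun i => x.sum fun a xa => x.sum fun b xb => star xa * N i a b * xb)
        (x.sum fun a xa => x.sum fun b xb => star xa * M a b * xb) :=
      hasSum_sum fun a _ => hasSum_sum fun b _ => ((h a b).mul_left _).mul_right _
    exact this.nonneg fun i => (hN i).2 x

namespace Channel
variable {n m l R : Type}

theorem map_posSemidef (Φ : Channel n m) {ρ : TC n} (h : ρ.1.PosSemidef) :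
    (Φ.map ρ).1.PosSemidef := by
  have hρ : IsPosTC (ρ.1.submatrix (Prod.fst : n × Fin 1 → n) Prod.fst) :=
    ⟨h.submatrix _, by
      refine (TC.summable ρ.2).comp_injective (i := (Prod.fst : n × Fin 1 → n)) ?_
      rintro ⟨a, i⟩ ⟨b, j⟩ h
      exact Prod.ext h (Subsingleton.elim _ _)⟩
  have := (Φ.completelyPositive 1 ⟨_, hρ.mem⟩ hρ.1).submatrix (fun a : m => (a, (0 : Fin 1)))
  exact this

theorem amplMat_posSemidef (Φ : Channel n m) {ρ : TC (n × R)} (h : ρ.1.PosSemidef) :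
    (amplMat R Φ.map ρ).PosSemidef := by
  refine posSemidef_of_finite fun k e => ?_
  let f : n × Fin k → n × R := fun p => (p.1, (e p.2).2)
  have hρ : IsPosTC (ρ.1.submatrix f f) := by
    refine ⟨h.submatrix _, ?_⟩
    refine (summable_prod_iff fun p => (h.submatrix f).diag_nonneg).2
      ⟨fun a => ?_, Summable.of_finite⟩
    exact (TC.summable ρ.2).comp_injective (i := fun i : n => (i, (e a).2))
      (fun a b h => by simpa using h)
  exact (Φ.completelyPositive k ⟨_, hρ.mem⟩ hρ.1).submatrix fun a => ((e a).1, a)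

theorem trace_slice (Φ : Channel n m) (ρ : TC (n × R)) (r : R) :
    ∑' i, amplMat R Φ.map ρ (i, r) (i, r) = ∑' i, ρ.1 (i, r) (i, r) :=
  Φ.tracePreserving ⟨slice ρ.1 r r, TC.slice_mem ρ.2 r r⟩

theorem amplMat_isPosTC (Φ : Channel n m) {ρ : TC (n × R)} (h : ρ.1.PosSemidef) :
    IsPosTC (amplMat R Φ.map ρ) := by
  have hp := Φ.amplMat_posSemidef h
  refine ⟨hp, ?_⟩
  have hs := (summable_prod_iff fun p => h.diag_nonneg).1 (TC.summable ρ.2)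
  have hsl : ∀ r, Summable fun i => amplMat R Φ.map ρ (i, r) (i, r) := fun r =>
    TC.summable (Φ.map ⟨slice ρ.1 r r, TC.slice_mem ρ.2 r r⟩).2
  refine (summable_prod_iff fun p => hp.diag_nonneg).2 ⟨hsl, ?_⟩
  convert hs.2 using 2 with r
  have := congrArg Complex.re (Φ.trace_slice ρ r)
  rwa [Complex.re_tsum (hsl r), Complex.re_tsum (hs.1 r)] at this

theorem amplMat_mem (Φ : Channel n m) (ρ : TC (n × R)) : amplMat R Φ.map ρ ∈ TC (m × R) := by
  induction ρ using TC.induction with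
  | pos ρ h => exact (Φ.amplMat_isPosTC h.1).mem
  | add x y h1 h2 =>
    convert (TC (m × R)).add_mem h1 h2
    ext a b
    exact congrFun (congrFun (congrArg Subtype.val (map_add Φ.map
      ⟨slice x.1 a.2 b.2, TC.slice_mem x.2 _ _⟩ ⟨slice y.1 a.2 b.2, TC.slice_mem y.2 _ _⟩)) a.1) b.1
  | smul c x h1 =>
    convert (TC (m × R)).smul_mem c h1
    ext a b
    exact congrFun (congrFun (congrArg Subtype.val (map_smul Φ.map c
      ⟨slice x.1 a.2 b.2, TC.slice_mem x.2 _ _⟩)) a.1) b.1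

protected def id (n : Type) : Channel n n where
  map := LinearMap.id
  completelyPositive _ _ h := h
  tracePreserving _ := rfl

/-- `Ψ ∘ Φ`. -/
def comp (Ψ : Channel m l) (Φ : Channel n m) : Channel n l where
  map := Ψ.map ∘ₗ Φ.map
  completelyPositive k ρ h := by
    have h1 := Φ.amplMat_isPosTC h
    exact Ψ.amplMat_posSemidef (ρ := ⟨_, h1.mem⟩) h1.1
  tracePreserving ρ := (Ψ.tracePreserving _).trans (Φ.tracePreserving _)

/-- `Φ ⊗ id_R`. -/
def ampl (R : Type) (Φ : Channel n m) : Channel (n × R) (m × R) where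
  map :=
    { toFun := fun ρ => ⟨amplMat R Φ.map ρ, Φ.amplMat_mem ρ⟩
      map_add' := fun x y => by
        ext a b
        exact congrFun (congrFun (congrArg Subtype.val (map_add Φ.map
          ⟨slice x.1 a.2 b.2, TC.slice_mem x.2 _ _⟩
          ⟨slice y.1 a.2 b.2, TC.slice_mem y.2 _ _⟩)) a.1) b.1
      map_smul' := fun c x => by
        ext a b
        exact congrFun (congrFun (congrArg Subtype.val (map_smul Φ.map c
          ⟨slice x.1 a.2 b.2, TC.slice_mem x.2 _ _⟩)) a.1) b.1 }
  completelyPositive k ρ h := by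
    let e : n × (R × Fin k) ≃ (n × R) × Fin k := (Equiv.prodAssoc _ _ _).symm
    have hρ : IsPosTC (ρ.1.submatrix e e) :=
      IsPosTC.submatrix ⟨h, TC.summable ρ.2⟩ e.injective
    exact (Φ.amplMat_posSemidef (ρ := ⟨_, hρ.mem⟩) hρ.1).submatrix (Equiv.prodAssoc m R (Fin k))
  tracePreserving ρ := by
    change ∑' a, amplMat R Φ.map ρ a a = ∑' a, ρ.1 a a
    rw [tsum_prod_swap (TC.summable (Φ.amplMat_mem ρ)), tsum_prod_swap (TC.summable ρ.2)]
    exact tsum_congr fun r => Φ.trace_slice ρ r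

/-- The unitary channel that relabels the basis states. -/
def ofEquiv (e : n ≃ m) : Channel n m where
  map :=
    { toFun := fun ρ => ⟨ρ.1.submatrix e.symm e.symm, TC.map_mem
        { toFun := fun ρ => ρ.submatrix e.symm e.symm
          map_add' := fun _ _ => rfl
          map_smul' := fun _ _ => rfl }
        (fun _ hρ => (hρ.submatrix e.symm.injective).mem) ρ.2⟩
      map_add' := fun _ _ => rfl
      map_smul' := fun _ _ => rfl }
  completelyPositive k _ h := h.submatrix fun a : m × Fin k => (e.symm a.1, a.2)
  tracePreserving ρ := e.symm.tsum_eq fun i => ρ.1 i i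

/-- Restriction of an operator to the subspace spanned by some of the basis states. -/
def compress (f : n → m) (hf : f.Injective) : TC m →ₗ[ℂ] TC n where
  toFun ρ := ⟨ρ.1.submatrix f f, TC.map_mem
        { toFun := fun ρ => ρ.submatrix f f
          map_add' := fun _ _ => rfl
          map_smul' := fun _ _ => rfl }
        (fun _ hρ => (hρ.submatrix hf).mem) ρ.2⟩
  map_add' _ _ := rfl
  map_smul' _ _ := rfl

/-- Measures in which of the two summands of `ℓ²(n) ⊕ ℓ²(m)` the state lies, and applies the
channel `Φ` or `Ψ` accordingly. -/
def sumElim (Φ : Channel n l) (Ψ : Channel m l) : Channel (n ⊕ m) l where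
  map := Φ.map ∘ₗ compress Sum.inl Sum.inl_injective + Ψ.map ∘ₗ compress Sum.inr Sum.inr_injective
  completelyPositive k ρ h := by
    have hi : Function.Injective fun a : n × Fin k => ((Sum.inl a.1 : n ⊕ m), a.2) := by
      rintro ⟨a, i⟩ ⟨b, j⟩ h; simpa using h
    have hj : Function.Injective fun a : m × Fin k => ((Sum.inr a.1 : n ⊕ m), a.2) := by
      rintro ⟨a, i⟩ ⟨b, j⟩ h; simpa using h
    have h1 := IsPosTC.submatrix ⟨h, TC.summable ρ.2⟩ hi
    have h2 := IsPosTC.submatrix ⟨h, TC.summable ρ.2⟩ hj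
    exact (Φ.completelyPositive k ⟨_, h1.mem⟩ h1.1).add (Ψ.completelyPositive k ⟨_, h2.mem⟩ h2.1)
  tracePreserving ρ := by
    rw [LinearMap.add_apply, map_add, LinearMap.comp_apply, LinearMap.comp_apply,
      Φ.tracePreserving, Ψ.tracePreserving]
    refine (HasSum.sum ?_ ?_).tsum_eq.symm
    · exact (TC.summable (compress Sum.inl Sum.inl_injective ρ).2).hasSum
    · exact (TC.summable (compress Sum.inr Sum.inr_injective ρ).2).hasSum


theorem summable_mul_pmf (κ : n → PMF m) {f : n → ℂ} (hf : Summable f) (a : m) :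
    Summable fun i => f i * ((κ i a).toReal : ℂ) := by
  refine Summable.of_norm_bounded hf.norm fun i => ?_
  rw [norm_mul, Complex.norm_real, Real.norm_of_nonneg ENNReal.toReal_nonneg]
  exact mul_le_of_le_one_right (norm_nonneg _)
    (ENNReal.toReal_le_of_le_ofReal zero_le_one (by simpa using (κ i).coe_le_one a))

open Classical in
/-- The diagonal matrix with entries `∑ i, ρ i i * κ i a`. -/
def classicalMat (κ : n → PMF m) : TC n →ₗ[ℂ] Matrix m m ℂ where
  toFun ρ := Matrix.of fun a b =>
    if a = b then ∑' i, ρ.1 i i * ((κ i a).toReal : ℂ) else 0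
  map_add' ρ σ := by
    ext a b
    by_cases h : a = b
    · simp only [Matrix.of_apply, h, Matrix.add_apply, if_true, Submodule.coe_add, add_mul]
      exact (summable_mul_pmf κ (TC.summable ρ.2) b).tsum_add (summable_mul_pmf κ (TC.summable σ.2) b)
    · simp [h]
  map_smul' c ρ := by
    ext a b
    by_cases h : a = b <;> simp [h, mul_assoc, tsum_mul_left]

theorem classicalMat_self (κ : n → PMF m) (ρ : TC n) (a : m) :
    classicalMat κ ρ a a = ∑' i, ρ.1 i i * ((κ i a).toReal : ℂ) := if_pos rfl

theorem classicalMat_ne (κ : n → PMF m) (ρ : TC n) {a b : m} (h : a ≠ b) :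
    classicalMat κ ρ a b = 0 := if_neg h

theorem pmf_nonneg (p : PMF m) (a : m) : (0 : ℂ) ≤ ((p a).toReal : ℂ) :=
  Complex.zero_le_real.2 ENNReal.toReal_nonneg

theorem hasSum_pmf (p : PMF m) : HasSum (fun a => ((p a).toReal : ℂ)) 1 := by
  have := ENNReal.hasSum_toReal (f := fun a => p a) (by rw [p.tsum_coe]; simp)
  rw [← ENNReal.tsum_toReal_eq p.apply_ne_top, p.tsum_coe] at this
  exact by simpa using (Complex.hasSum_ofReal (f := fun a => (p a).toReal)).2 this

theorem classicalMat_trace_aux (κ : n → PMF m) (ρ : TC n) (h : IsPosTC ρ.1) :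
    HasSum (fun a => classicalMat κ ρ a a) (∑' i, ρ.1 i i) := by
  have h0 : ∀ p : m × n, 0 ≤ ρ.1 p.2 p.2 * ((κ p.2 p.1).toReal : ℂ) := fun p =>
    mul_nonneg h.1.diag_nonneg (pmf_nonneg _ _)
  have h1 : ∀ i, HasSum (fun a => ρ.1 i i * ((κ i a).toReal : ℂ)) (ρ.1 i i) := fun i => by
    simpa using (hasSum_pmf (κ i)).mul_left (ρ.1 i i)
  have hs : Summable fun p : m × n => ρ.1 p.2 p.2 * ((κ p.2 p.1).toReal : ℂ) := by
    rw [summable_prod_iff h0]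
    refine ⟨fun i => (h1 i).summable, ?_⟩
    have h3 : ∀ i, ∑' a, (ρ.1 i i * ((κ i a).toReal : ℂ)).re = (ρ.1 i i).re := fun i => by
      rw [← Complex.re_tsum (h1 i).summable, (h1 i).tsum_eq]
    have h4 := (summable_iff_re fun i => h.1.diag_nonneg).1 h.2
    exact h4.congr fun i => (h3 i).symm
  have h2 : ∑' i, ρ.1 i i = ∑' p : m × n, ρ.1 p.2 p.2 * ((κ p.2 p.1).toReal : ℂ) := by
    rw [tsum_prod_swap hs]
    refine tsum_congr fun i => ?_
    exact (h1 i).tsum_eq.symm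
  rw [h2]
  simp_rw [classicalMat_self]
  exact hs.hasSum.prod_fiberwise fun a => (hs.prod_factor a).hasSum

theorem classicalMat_mem (κ : n → PMF m) (ρ : TC n) : classicalMat κ ρ ∈ TC m := by
  induction ρ using TC.induction with
  | pos ρ h =>
    refine IsPosTC.mem ⟨?_, (classicalMat_trace_aux κ ρ h).summable⟩
    classical
    have : classicalMat κ ρ = Matrix.diagonal fun a => ∑' i, ρ.1 i i * ((κ i a).toReal : ℂ) := by
      ext a b
      by_cases hab : a = b
      · subst hab; rw [classicalMat_self, Matrix.diagonal_apply_eq]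
      · rw [classicalMat_ne κ ρ hab, Matrix.diagonal_apply_ne _ hab]
    rw [this]
    exact Matrix.PosSemidef.diagonal fun a => tsum_nonneg fun i =>
      mul_nonneg h.1.diag_nonneg (pmf_nonneg _ _)
  | add x y h1 h2 => rw [map_add]; exact add_mem h1 h2
  | smul c x h1 => rw [map_smul]; exact Submodule.smul_mem _ c h1

/-- The classical channel with transition probabilities `κ`: measures in the standard basis, and on
outcome `i` prepares the basis state `a` with probability `κ i a`. -/
def classical (κ : n → PMF m) : Channel n m where
  map := (classicalMat κ).codRestrict (TC m) (classicalMat_mem κ)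
  completelyPositive k ρ h := by
    classical
    refine posSemidef_of_finite fun K e => ?_
    refine posSemidef_of_hasSum (N := fun i => ((ρ.1.submatrix (fun a => (i, (e a).2))
      (fun a => (i, (e a).2))).kronecker ((Matrix.diagonal fun a => ((κ i a).toReal : ℂ)).submatrix
      (fun a => (e a).1) fun a => (e a).1)).submatrix (fun a => (a, a)) fun a => (a, a))
      (fun i => ?_) fun a b => ?_
    · refine ((h.submatrix _).kronecker (Matrix.PosSemidef.submatrix
        (Matrix.PosSemidef.diagonal fun a => pmf_nonneg (κ i) a) _)).submatrix _
    · change HasSum (fun i => ρ.1 (i, (e a).2) (i, (e b).2) * (Matrix.diagonal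
        (fun a => ((κ i a).toReal : ℂ)) (e a).1 (e b).1)) (classicalMat κ
        ⟨slice ρ.1 (e a).2 (e b).2, TC.slice_mem ρ.2 _ _⟩ (e a).1 (e b).1)
      by_cases hab : (e a).1 = (e b).1
      · simp_rw [← hab, classicalMat_self, Matrix.diagonal_apply_eq]
        exact (summable_mul_pmf κ (TC.summable (TC.slice_mem ρ.2 _ _)) _).hasSum
      · simp_rw [classicalMat_ne κ _ hab, Matrix.diagonal_apply_ne _ hab, mul_zero]
        exact hasSum_zero
  tracePreserving ρ := by
    induction ρ using TC.induction with
    | pos ρ h => exact (classicalMat_trace_aux κ ρ h).tsum_eq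
    | add x y h1 h2 => rw [map_add, map_add, map_add, h1, h2]
    | smul c x h1 => rw [map_smul, map_smul, map_smul, h1]


/-! ### Derived channels -/

/-- `Ψ ∘ Φ`, written in the order of execution. -/
def andThen (Φ : Channel n m) (Ψ : Channel m l) : Channel n l := Ψ.comp Φ

/-- `n ⊗ m → m ⊗ n`. -/
def swap (n m : Type) : Channel (n × m) (m × n) := ofEquiv (Equiv.prodComm n m)

/-- `id_R ⊗ Φ`. -/
def onSnd (R : Type) (Φ : Channel n m) : Channel (R × n) (R × m) :=
  ((swap R n).andThen (Φ.ampl R)).andThen (swap m R)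

/-- `Φ ⊗ Ψ`. -/
def prod {n' m' : Type} (Φ : Channel n m) (Ψ : Channel n' m') : Channel (n × n') (m × m') :=
  (Φ.ampl n').andThen (Ψ.onSnd m)

/-- The trace. -/
def discard (n : Type) : Channel n Unit := classical fun _ => PMF.pure ()

/-- The measurement in the standard basis; it turns a register into a classical one. -/
def measure (n : Type) : Channel n n := classical PMF.pure

/-- The preparation of a standard basis state, i.e. of a classical value. -/
def value (a : m) : Channel Unit m := classical fun _ => PMF.pure a

/-- Partial trace over the second factor. -/
def discardSnd (n R : Type) : Channel (n × R) n :=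
  ((discard R).onSnd n).andThen (ofEquiv (Equiv.prodPUnit n))

/-- Partial trace over the first factor. -/
def discardFst (R n : Type) : Channel (R × n) n := (swap R n).andThen (discardSnd n R)

/-- Adjoins a register in the state `σ`. -/
def adjoin (n : Type) (σ : Channel Unit m) : Channel n (m × n) :=
  (ofEquiv (Equiv.punitProd n).symm).andThen (σ.ampl n)

/-- Erases a register and prepares it afresh in the state `σ`. -/
def reset (n : Type) (σ : Channel Unit m) : Channel n m := (discard n).andThen σ

/-- Measures a bit and applies `Φ₁` if it is set, `Φ₀` otherwise. -/
def ifBit (Φ₀ Φ₁ : Channel n m) : Channel (Bool × n) m :=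
  (ofEquiv (Equiv.boolProdEquivSum n)).andThen (Φ₀.sumElim Φ₁)

/-- `Option m × n` is `{none} × n` together with `m × n`. -/
def optionProdEquiv (m n : Type) : Option m × n ≃ n ⊕ m × n where
  toFun p := p.1.elim (Sum.inl p.2) fun a => Sum.inr (a, p.2)
  invFun := Sum.elim (fun b => (none, b)) fun p => (some p.1, p.2)
  left_inv := by rintro ⟨_ | _, _⟩ <;> rfl
  right_inv := by rintro (_ | ⟨_, _⟩) <;> rfl

/-- Measures whether the first register is in the state `none` and applies `Φ₀` if it is, `Φ₁`
otherwise. -/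
def ifSome (Φ₀ : Channel n l) (Φ₁ : Channel (m × n) l) : Channel (Option m × n) l :=
  (ofEquiv (optionProdEquiv m n)).andThen (Φ₀.sumElim Φ₁)

/-- The exchange of the two middle factors. -/
def interchange (a b c d : Type) : Channel ((a × b) × (c × d)) ((a × c) × (b × d)) :=
  ofEquiv (Equiv.prodProdProdComm a b c d)

/-- `(a ⊗ b) ⊗ c → a ⊗ (b ⊗ c)`. -/
def assoc (a b c : Type) : Channel ((a × b) × c) (a × (b × c)) := ofEquiv (Equiv.prodAssoc a b c)

/-- `a ⊗ (b ⊗ c) → (a ⊗ b) ⊗ c`. -/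
def unassoc (a b c : Type) : Channel (a × (b × c)) ((a × b) × c) :=
  ofEquiv (Equiv.prodAssoc a b c).symm

/-- `(a ⊗ b) ⊗ c → (a ⊗ c) ⊗ b`. -/
def rightComm (a b c : Type) : Channel ((a × b) × c) ((a × c) × b) :=
  ((assoc a b c).andThen ((swap b c).onSnd a)).andThen (unassoc a c b)

/-- `a ⊗ (b ⊗ c) → b ⊗ (a ⊗ c)`. -/
def leftComm (a b c : Type) : Channel (a × (b × c)) (b × (a × c)) :=
  ((unassoc a b c).andThen ((swap a b).ampl c)).andThen (assoc b a c)

end Channel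

/-! ### States and trace distance -/

/-- The density operators on `ℓ²(n)`. -/
def State (n : Type) : Type := {ρ : TC n // ρ.1.PosSemidef ∧ TC.trace ρ = 1}

/-- `P` and `N` are the positive and the negative part of `T`: `T = P - N` with `P, N ≥ 0` and
`P N = 0`. -/
structure IsPosNegPart {n : Type} (T P N : TC n) : Prop where
  pos : P.1.PosSemidef
  neg : N.1.PosSemidef
  eq : T = P - N
  orthogonal : ∀ i j, HasSum (fun k => P.1 i k * N.1 k j) 0

/-- The trace norm `tr |T| = tr T₊ + tr T₋` of a self-adjoint trace class operator. (The infimum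
is over the unique pair `(T₊, T₋)`.) -/
def traceNorm {n : Type} (T : TC n) : ℝ≥0∞ :=
  ⨅ (P : TC n) (N : TC n) (_ : IsPosNegPart T P N),
    ENNReal.ofReal (TC.trace P + TC.trace N).re

/-- `d(ρ, σ) = ‖ρ - σ‖₁ / 2`. -/
def traceDist {n : Type} (ρ σ : TC n) : ℝ≥0∞ := traceNorm (ρ - σ) / 2

theorem unit_mem : (1 : Matrix Unit Unit ℂ) ∈ TC Unit :=
  IsPosTC.mem ⟨Matrix.PosSemidef.one, Summable.of_finite⟩

/-- The probability that the state `Φ` of a bit yields the value `true`. -/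
def Channel.prob (Φ : Channel Unit Bool) : ℝ := ((Φ.map ⟨1, unit_mem⟩).1 true true).re

/-! ### Resources, converters and distinguishers -/

/-- An interactive quantum system in discrete time: at tick `τ = 0, 1, 2, …` it receives a message
in the register `I`, and then emits one in the register `O`. Where a system has several interfaces,
`I` and `O` are the products of their registers. -/
structure System (I O : Type) where
  Mem : Type
  init : Channel Unit Mem
  step : ℕ → Channel (I × Mem) (O × Mem)

namespace System
variable {I O I' O' : Type}

/-- A system without memory. -/
def ofChannel (Φ : ℕ → Channel I O) : System I O where
  Mem := Unit
  init := Channel.id Unit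
  step τ := (Φ τ).ampl Unit

/-- Parallel composition. -/
def par (S : System I O) (T : System I' O') : System (I × I') (O × O') where
  Mem := S.Mem × T.Mem
  init := (Channel.ofEquiv (Equiv.punitProd Unit).symm).andThen (S.init.prod T.init)
  step τ := ((Channel.interchange I I' S.Mem T.Mem).andThen ((S.step τ).prod (T.step τ))).andThen
    (Channel.interchange O S.Mem O' T.Mem)

/-- Regroups the registers at the interfaces. -/
def relabel (S : System I O) (e : I' ≃ I) (f : O ≃ O') : System I' O' where
  Mem := S.Mem
  init := S.init
  step τ := (((Channel.ofEquiv e).ampl S.Mem).andThen (S.step τ)).andThen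
    ((Channel.ofEquiv f).ampl S.Mem)

end System

/-- A converter with outer registers `I`, `O` and inner registers `I'`, `O'`: at each tick it
receives `I` from outside, passes `I'` to the system inside, receives the answer `O'` of that
system and emits `O` to the outside. -/
structure Converter (I O I' O' : Type) where
  Mem : Type
  init : Channel Unit Mem
  down : ℕ → Channel (I × Mem) (I' × Mem)
  up : ℕ → Channel (O' × Mem) (O × Mem)

/-- A converter attached to the first interface of a system. -/
def Converter.attachFst {I O I' O' J K : Type} (π : Converter I O I' O')
    (R : System (I' × J) (O' × K)) : System (I × J) (O × K) where
  Mem := π.Mem × R.Mem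
  init := (Channel.ofEquiv (Equiv.punitProd Unit).symm).andThen (π.init.prod R.init)
  step τ := Channel.interchange I J π.Mem R.Mem
    |>.andThen ((π.down τ).ampl (J × R.Mem))
    |>.andThen (Channel.interchange I' π.Mem J R.Mem)
    |>.andThen (Channel.leftComm (I' × J) π.Mem R.Mem)
    |>.andThen ((R.step τ).onSnd π.Mem)
    |>.andThen (Channel.leftComm π.Mem (O' × K) R.Mem)
    |>.andThen (Channel.interchange O' K π.Mem R.Mem)
    |>.andThen ((π.up τ).ampl (K × R.Mem))
    |>.andThen (Channel.interchange O π.Mem K R.Mem)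

/-- A converter attached to the second interface of a system. -/
def Converter.attachSnd {I O I' O' J K : Type} (σ : Converter I O I' O')
    (R : System (J × I') (K × O')) : System (J × I) (K × O) :=
  (σ.attachFst (R.relabel (Equiv.prodComm I' J) (Equiv.prodComm K O'))).relabel
    (Equiv.prodComm J I) (Equiv.prodComm O K)

/-- What a party with local memory `M` does at each tick at an interface where it sends `I` and
receives `O`. -/
structure Program (M I O : Type) where
  send : ℕ → Channel M (I × M)
  recv : ℕ → Channel (O × M) M

/-- An adversarial strategy against systems with registers `I`, `O`. -/
structure Strategy (I O : Type) where
  Mem : Type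
  init : Channel Unit Mem
  prog : Program Mem I O

namespace Strategy
variable {I O : Type} (A : Strategy I O) (S : System I O)

/-- The joint evolution during tick `τ`, up to the moment when the system has emitted its output,
which is still in the register `O`. -/
def release (τ : ℕ) : Channel (A.Mem × S.Mem) ((O × A.Mem) × S.Mem) :=
  (A.prog.send τ).ampl S.Mem
    |>.andThen (Channel.rightComm I A.Mem S.Mem)
    |>.andThen ((S.step τ).ampl A.Mem)
    |>.andThen (Channel.rightComm O S.Mem A.Mem)

/-- The joint evolution during tick `τ`. -/
def round (τ : ℕ) : Channel (A.Mem × S.Mem) (A.Mem × S.Mem) :=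
  (A.release S τ).andThen ((A.prog.recv τ).ampl S.Mem)

/-- The joint evolution during the `k` ticks `τ, …, τ + k - 1`. -/
def rounds (τ : ℕ) : ℕ → Channel (A.Mem × S.Mem) (A.Mem × S.Mem)
  | 0 => Channel.id _
  | k + 1 => (rounds τ k).andThen (A.round S (τ + k))

/-- The joint state after the first `k` ticks. -/
def stateAfter (k : ℕ) : Channel Unit (A.Mem × S.Mem) :=
  (Channel.ofEquiv (Equiv.punitProd Unit).symm).andThen (A.init.prod S.init)
    |>.andThen (A.rounds S 0 k)

end Strategy

/-- A distinguisher: it interacts with all interfaces of a system for a number of ticks and then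
outputs a bit. -/
structure Distinguisher (I O : Type) extends Strategy I O where
  ticks : ℕ
  guess : Channel Mem Bool

/-- The probability that the distinguisher outputs `true`. -/
def Distinguisher.prob {I O : Type} (D : Distinguisher I O) (S : System I O) : ℝ :=
  ((D.stateAfter S D.ticks).andThen
    ((Channel.discardSnd D.Mem S.Mem).andThen D.guess)).prob

/-- The distinguishing advantage for a class of distinguishers. -/
def advantage {I O : Type} (𝒟 : Set (Distinguisher I O)) (S T : System I O) : ℝ≥0∞ :=
  ⨆ D ∈ 𝒟, ENNReal.ofReal |D.prob S - D.prob T|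

/-- For systems whose first interface is that of the honest parties and whose second interface is
that of the adversary: the protocol `π`, run by the honest parties, constructs the resource `S` from
the resource `R` within `ε` if for some simulator `σ` at the adversary's interface `π R` and `S σ`
cannot be distinguished with advantage more than `ε`. -/
def Constructs {I O I' O' J K J' K' : Type} (𝒟 : Set (Distinguisher (I × J) (O × K)))
    (π : Converter I O I' O') (R : System (I' × J) (O' × K)) (S : System (I × J') (O × K'))
    (ε : ℝ) : Prop :=
  ∃ σ : Converter J K J' K', advantage 𝒟 (π.attachFst R) (σ.attachSnd S) ≤ ENNReal.ofReal ε

/-! ### Devices -/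

/-- The register of a quantum signal with state space `ℓ²(Q)`, or no signal (the state `none`). -/
abbrev Signal (Q : Type) : Type := Option Q

/-- A state preparation device with settings `X`. At each tick the device may be used with some
setting, producing a signal, or not be used; it has a memory, which can be cleared. -/
structure PrepDevice (X Q : Type) where
  Mem : Type
  init : Channel Unit Mem
  /-- the evolution of the memory while the device is not used -/
  idle : ℕ → Channel Mem Mem
  /-- the state of a cleared memory -/
  cleared : ℕ → Channel Unit Mem
  use : ℕ → Channel (X × Mem) (Signal Q × Mem)

/-- The preparation device as a resource. Its input consists of a bit telling whether to clear the
memory, and of a classical setting or `none` (do not use the device). -/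
def PrepDevice.system {X Q : Type} (P : PrepDevice X Q) :
    System (Bool × Option X) (Signal Q) where
  Mem := P.Mem
  init := P.init
  step τ := (Channel.swap Bool (Option X)).ampl P.Mem
    |>.andThen (Channel.assoc (Option X) Bool P.Mem)
    |>.andThen ((Channel.ifBit (Channel.id P.Mem)
        (Channel.reset P.Mem (P.cleared τ))).onSnd (Option X))
    |>.andThen (Channel.ifSome
        ((P.idle τ).andThen (Channel.adjoin P.Mem (Channel.value none)))
        (((Channel.measure X).ampl P.Mem).andThen (P.use τ)))

/-- A measurement device with settings `Y` and outcomes `Z`. At each tick the device may be used with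
some setting, measuring the incoming signal, or not be used; it has a memory, which can be
cleared. -/
structure MeasDevice (Y Q Z : Type) where
  Mem : Type
  init : Channel Unit Mem
  /-- the evolution of the memory while the device is not used -/
  idle : ℕ → Channel Mem Mem
  /-- the state of a cleared memory -/
  cleared : ℕ → Channel Unit Mem
  use : ℕ → Channel (Y × (Signal Q × Mem)) (Z × Mem)

/-- The measurement device as a resource. Its input consists of a bit telling whether to clear the
memory, of a classical setting or `none` (do not use the device), and of the signal to be measured.
Its output is a classical outcome, or `none` if the device was not used. -/
def MeasDevice.system {Y Q Z : Type} (D : MeasDevice Y Q Z) :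
    System ((Bool × Option Y) × Signal Q) (Option Z) where
  Mem := D.Mem
  init := D.init
  step τ := (((Channel.swap Bool (Option Y)).ampl (Signal Q)).andThen
        (Channel.rightComm (Option Y) Bool (Signal Q))).ampl D.Mem
    |>.andThen (Channel.assoc (Option Y × Signal Q) Bool D.Mem)
    |>.andThen ((Channel.ifBit (Channel.id D.Mem)
        (Channel.reset D.Mem (D.cleared τ))).onSnd (Option Y × Signal Q))
    |>.andThen (Channel.assoc (Option Y) (Signal Q) D.Mem)
    |>.andThen (Channel.ifSome
        ((Channel.discardFst (Signal Q) D.Mem).andThen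
          ((D.idle τ).andThen (Channel.adjoin D.Mem (Channel.value none))))
        (((Channel.measure Y).ampl (Signal Q × D.Mem)).andThen
          ((D.use τ).andThen ((Channel.classical fun z => PMF.pure (some z)).ampl D.Mem))))

/-- A device model: the pair of devices of Alice and Bob. -/
structure DeviceModel (X Y Z Q : Type) where
  prep : PrepDevice X Q
  meas : MeasDevice Y Q Z

/-! ### The starting resources -/

/-- Alice's input: to her device, to the quantum channel, to the classical channel. -/
abbrev AliceIn (X Q C : Type) : Type := (Bool × Option X) × (Signal Q × Option C)
/-- Alice's output: from her device, and Bob's classical message. -/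
abbrev AliceOut (Q C : Type) : Type := Signal Q × Option C
/-- Bob's input: to his device, and to the classical channel. -/
abbrev BobIn (Y Q C : Type) : Type := ((Bool × Option Y) × Signal Q) × Option C
/-- Bob's output: from his device, from the quantum channel, and Alice's classical message. -/
abbrev BobOut (Z Q C : Type) : Type := Option Z × (Signal Q × Option C)
/-- Eve's input: the signal that the quantum channel delivers to Bob. -/
abbrev EveIn (Q : Type) : Type := Signal Q
/-- Eve's output: the signal that Alice sent, and copies of the classical messages of Alice and
Bob. -/
abbrev EveOut (Q C : Type) : Type := Signal Q × (Option C × Option C)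

/-- The insecure quantum channel from Alice to Bob, with inputs from Alice and Eve, and outputs to
Bob and Eve: what Alice sends goes to Eve, and what Eve sends goes to Bob. -/
def insecureChannel (Q : Type) : System (Signal Q × Signal Q) (Signal Q × Signal Q) :=
  System.ofChannel fun _ => Channel.swap _ _

/-- The authenticated classical channel, with inputs from Alice and Bob, and outputs to Alice, Bob
and Eve: each message is delivered to the other party, and a copy of it to Eve. -/
def authChannel (C : Type) :
    System (Option C × Option C) ((Option C × Option C) × (Option C × Option C)) :=
  System.ofChannel fun _ => Channel.classical fun m => PMF.pure ((m.2, m.1), m)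

section Rini
variable {X Y Z Q C : Type}

/-- Distribution of the inputs at the interfaces of Alice and Bob, and of Eve, to the four
resources. -/
def inputEquiv : (AliceIn X Q C × BobIn Y Q C) × EveIn Q ≃
    ((Bool × Option X) × ((Bool × Option Y) × Signal Q)) ×
      ((Signal Q × Signal Q) × (Option C × Option C)) where
  toFun p := ((p.1.1.1, p.1.2.1), ((p.1.1.2.1, p.2), (p.1.1.2.2, p.1.2.2)))
  invFun q := (((q.1.1, (q.2.1.1, q.2.2.1)), (q.1.2, q.2.2.2)), q.2.1.2)
  left_inv _ := rfl
  right_inv _ := rfl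

/-- Distribution of the outputs of the four resources to the interfaces. -/
def outputEquiv : (Signal Q × Option Z) ×
      ((Signal Q × Signal Q) × ((Option C × Option C) × (Option C × Option C))) ≃
    (AliceOut Q C × BobOut Z Q C) × EveOut Q C where
  toFun p := (((p.1.1, p.2.2.1.1), (p.1.2, (p.2.1.1, p.2.2.1.2))), (p.2.1.2, p.2.2.2))
  invFun q := ((q.1.1.1, q.1.2.1), ((q.1.2.2.1, q.2.1), ((q.1.1.2, q.1.2.2.2), q.2.2)))
  left_inv _ := rfl
  right_inv _ := rfl

/-- The starting resources for a device model: its two devices, an insecure quantum channel and an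
authenticated classical channel. -/
def Rini (C : Type) (M : DeviceModel X Y Z Q) :
    System ((AliceIn X Q C × BobIn Y Q C) × EveIn Q)
      ((AliceOut Q C × BobOut Z Q C) × EveOut Q C) :=
  ((M.prep.system.par M.meas.system).par ((insecureChannel Q).par (authChannel C))).relabel
    inputEquiv outputEquiv

end Rini

/-! ### Keys and the ideal resource -/

abbrev Key : Type := List Bool

/-- What Alice and Bob output at a tick: a key, or nothing. -/
abbrev KeyOut : Type := Option Key × Option Key

/-- The state `ω^ℓ` of perfectly correlated uniform keys of length `ℓ`. -/
def perfectKeys (ℓ : ℕ) : PMF KeyOut :=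
  (PMF.uniformOfFintype (Fin ℓ → Bool)).map fun k => (some (List.ofFn k), some (List.ofFn k))

/-- The channel `𝒦`: reads the length of the keys and replaces them by perfect keys of that length.
(If the two keys have different lengths, the length of Alice's key is used.) -/
def replaceKeys : Channel KeyOut KeyOut :=
  Channel.classical fun k => k.1.elim (PMF.pure (none, none)) fun a => perfectKeys a.length

/-- The resource that at each time `t j` accepts a length `ℓ` from Eve, and outputs a perfect
secret key of length `ℓ` to Alice and Bob. -/
def Rideal {N : ℕ} (t : Fin N → ℕ) : System (Unit × ℕ) (KeyOut × Unit) :=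
  open Classical in
  System.ofChannel fun τ => Channel.classical fun p =>
    (if ∃ j, t j = τ then perfectKeys p.2 else PMF.pure (none, none)).map fun k => (k, ())

/-! ### The protocol -/

/-- A QKD protocol instance: local programs of Alice and Bob, with local memories `MA` and `MB`,
and the way in which each of them finally obtains a key. -/
structure QKDInstance (MA MB X Y Z Q C : Type) where
  alice : Program MA (AliceIn X Q C) (AliceOut Q C)
  bob : Program MB (BobIn Y Q C) (BobOut Z Q C)
  keyA : Channel MA Key
  keyB : Channel MB Key

/-- A certification procedure, followed by `N` QKD protocol instances. The certification procedure
runs during the ticks `τ < certTicks` and may use all of the starting resources at the interfaces of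
Alice and Bob; `decide` then produces the decision (`true`: approve). Each QKD instance begins with
fresh local memories in the states `initA`, `initB`. -/
structure Protocol (N : ℕ) (X Y Z Q C : Type) where
  CertMem : Type
  certInit : Channel Unit CertMem
  cert : Program CertMem (AliceIn X Q C × BobIn Y Q C) (AliceOut Q C × BobOut Z Q C)
  certTicks : ℕ
  decide : Channel CertMem Bool
  MemA : Type
  MemB : Type
  initA : Channel Unit MemA
  initB : Channel Unit MemB
  qkd : Fin N → QKDInstance MemA MemB X Y Z Q C

namespace Protocol
variable {N : ℕ} {X Y Z Q C : Type} (π : Protocol N X Y Z Q C) (t : Fin N → ℕ)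

/-- The joint local memory of Alice and Bob during the QKD instances. -/
abbrev Local : Type := π.MemA × π.MemB

/-- What Alice and Bob together send to the starting resources. -/
abbrev HIn (_ : Protocol N X Y Z Q C) : Type := AliceIn X Q C × BobIn Y Q C

/-- What Alice and Bob together receive from the starting resources. -/
abbrev HOut (_ : Protocol N X Y Z Q C) : Type := AliceOut Q C × BobOut Z Q C

/-- Fresh local memories of Alice and Bob. -/
def fresh : Channel Unit π.Local :=
  (Channel.ofEquiv (Equiv.punitProd Unit).symm).andThen (π.initA.prod π.initB)

/-- The first tick of instance `j`: the first one after the certification procedure, or after the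
preceding instance. -/
def start (j : Fin N) : ℕ :=
  if h : j.val = 0 then π.certTicks else t ⟨j.val - 1, by omega⟩ + 1

/-- The instance that is running at tick `τ ≥ certTicks`: the first one with `τ ≤ t j`. -/
def running (t : Fin N → ℕ) (τ : ℕ) : Option (Fin N) :=
  (List.finRange N).find? fun j => τ ≤ t j

/-- Nobody sends anything, and the devices are not used. -/
def idleIn : Channel Unit π.HIn :=
  Channel.value (((false, none), (none, none)), (((false, none), none), none))

/-- Sets the bits that tell both devices to clear their memories. -/
def forceClear : Channel π.HIn π.HIn :=
  (((Channel.reset Bool (Channel.value true)).ampl (Option X)).ampl (Signal Q × Option C)).prod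
    ((((Channel.reset Bool (Channel.value true)).ampl (Option Y)).ampl (Signal Q)).ampl (Option C))

/-- No key is output. -/
def noKey : Channel Unit KeyOut := Channel.value (none, none)

/-- What Alice and Bob send at tick `τ` in the QKD phase. An instance begins with fresh local
memories, and, if it is not the first one, by clearing the memories of the devices. -/
def qkdDown (τ : ℕ) : Channel π.Local (π.HIn × π.Local) :=
  match running t τ with
  | none => Channel.adjoin π.Local π.idleIn
  | some j =>
    (if τ = π.start t j then Channel.reset π.Local π.fresh else Channel.id π.Local)
      |>.andThen (((π.qkd j).alice.send τ).prod ((π.qkd j).bob.send τ))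
      |>.andThen (Channel.interchange _ _ _ _)
      |>.andThen ((if τ = π.start t j ∧ j.val ≠ 0 then π.forceClear
          else Channel.id π.HIn).ampl π.Local)

/-- What Alice and Bob do with the messages received at tick `τ` in the QKD phase. At the time
`t j` instance `j` ends: the (classical) keys are output and the local memories are erased. -/
def qkdUp (τ : ℕ) : Channel (π.HOut × π.Local) (KeyOut × π.Local) :=
  match running t τ with
  | none => (Channel.discardFst π.HOut π.Local).andThen (Channel.adjoin π.Local noKey)
  | some j =>
    (Channel.interchange _ _ _ _)
      |>.andThen (((π.qkd j).alice.recv τ).prod ((π.qkd j).bob.recv τ))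
      |>.andThen (if τ = t j then
          ((π.qkd j).keyA.prod (π.qkd j).keyB)
            |>.andThen (Channel.classical fun k => PMF.pure (some k.1, some k.2))
            |>.andThen (Channel.adjoin KeyOut π.fresh)
            |>.andThen (Channel.swap π.Local KeyOut)
        else Channel.adjoin π.Local noKey)

/-- The QKD instances alone, without certification. -/
def qkdConverter : Converter Unit KeyOut π.HIn π.HOut where
  Mem := π.Local
  init := π.fresh
  down τ := (Channel.discardFst Unit π.Local).andThen (π.qkdDown t τ)
  up τ := π.qkdUp t τ

open Classical in
/-- What Alice and Bob output at tick `τ` after rejection: keys of length zero at the times `t j`. -/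
def rejectOut (τ : ℕ) : Channel Unit KeyOut :=
  if ∃ j, t j = τ then Channel.value (some [], some []) else noKey

/-- Lets a bit `F` control whether `Φ₀` or `Φ₁` is applied, keeping `F`. -/
def controlled {n m l : Type} (Φ₀ Φ₁ : Channel n (m × l)) : Channel (Bool × n) (m × (Bool × l)) :=
  Channel.ifBit (Φ₀.andThen ((Channel.adjoin l (Channel.value false)).onSnd m))
    (Φ₁.andThen ((Channel.adjoin l (Channel.value true)).onSnd m))

/-- Replaces the second register by the decision obtained from the first one. -/
def makeDecision : Channel (π.CertMem × (Bool × π.Local)) (π.CertMem × (Bool × π.Local)) :=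
  (Channel.unassoc π.CertMem Bool π.Local)
    |>.andThen (((Channel.discardSnd π.CertMem Bool).andThen
        (π.decide.andThen (Channel.adjoin Bool π.certInit))).ampl π.Local)
    |>.andThen (Channel.assoc π.CertMem Bool π.Local)

/-- The whole protocol. Its memory consists of the memory of the certification procedure, the
decision `F`, and the local memories for the QKD instances. If the certification procedure rejects,
the devices are never used again. -/
def converter : Converter Unit KeyOut π.HIn π.HOut where
  Mem := π.CertMem × (Bool × π.Local)
  init := (Channel.ofEquiv (Equiv.punitProd Unit).symm).andThen
    (π.certInit.prod (π.fresh.andThen (Channel.adjoin π.Local (Channel.value false))))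
  down τ := (Channel.discardFst Unit _).andThen <|
    if τ < π.certTicks then
      ((π.cert.send τ).ampl (Bool × π.Local)).andThen (Channel.assoc π.HIn π.CertMem _)
    else
      (if τ = π.certTicks then π.makeDecision else Channel.id _)
        |>.andThen ((controlled (Channel.adjoin π.Local π.idleIn) (π.qkdDown t τ)).onSnd π.CertMem)
        |>.andThen (Channel.leftComm π.CertMem π.HIn _)
  up τ :=
    if τ < π.certTicks then
      (Channel.unassoc π.HOut π.CertMem (Bool × π.Local))
        |>.andThen ((π.cert.recv τ).ampl (Bool × π.Local))
        |>.andThen (Channel.adjoin _ noKey)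
    else
      (Channel.leftComm π.HOut π.CertMem (Bool × π.Local))
        |>.andThen ((Channel.leftComm π.HOut Bool π.Local).onSnd π.CertMem)
        |>.andThen ((controlled
            ((Channel.discardFst π.HOut π.Local).andThen (Channel.adjoin π.Local (rejectOut t τ)))
            (π.qkdUp t τ)).onSnd π.CertMem)
        |>.andThen (Channel.leftComm π.CertMem KeyOut _)

end Protocol

/-! ### The two criteria -/

section Criteria
variable {N : ℕ} {X Y Z Q C : Type} (π : Protocol N X Y Z Q C) (t : Fin N → ℕ)
  (M : DeviceModel X Y Z Q) (A : Strategy (Unit × EveIn Q) (KeyOut × EveOut Q C))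

/-- `Pr[F = 1]`: the probability that the certification procedure approves a device of model `M`
under the attack `A`. -/
def approvalProb : ℝ :=
  ((A.stateAfter ((π.converter t).attachFst (Rini C M)) π.certTicks).andThen <|
    (Channel.discardFst _ _).andThen <| (Channel.discardSnd _ _).andThen <|
    (Channel.discardSnd _ _).andThen π.decide).prob

/-- The channel describing instance `j` for the device model `M` and the attack `A`. Its input is
the state of the attacker and of the devices at the beginning of the instance; its output consists of
the keys and of all that is held by the attacker when the keys are released (the memories of the
honest parties are erased, and those of the devices are cleared before any further use). -/
def instanceChannel (j : Fin N) :
    Channel (A.Mem × (Rini C M).Mem) (KeyOut × (EveOut Q C × A.Mem)) :=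
  let S := (π.qkdConverter t).attachFst (Rini C M)
  ((Channel.adjoin (Rini C M).Mem π.fresh).onSnd A.Mem)
    |>.andThen (A.rounds S (π.start t j) (t j - π.start t j))
    |>.andThen (A.release S (t j))
    |>.andThen (Channel.discardSnd _ S.Mem)
    |>.andThen (Channel.assoc KeyOut (EveOut Q C) A.Mem)

/-- Instance `j` is `ε`-secure under the device model `M`, for attacks in the class `𝒜`. -/
def SecureInstance (𝒜 : Set (Strategy (Unit × EveIn Q) (KeyOut × EveOut Q C))) (j : Fin N)
    (ε : ℝ) : Prop :=
  ∀ A ∈ 𝒜, ∀ σ : State (A.Mem × (Rini C M).Mem),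
    traceDist ((instanceChannel π t M A j).map σ.1)
      (((instanceChannel π t M A j).andThen (replaceKeys.ampl (EveOut Q C × A.Mem))).map σ.1) ≤
        ENNReal.ofReal ε

end Criteria

end AC

end

noncomputable section

open scoped ENNReal ComplexOrder

namespace AC

section

variable {n m l k n' m' : Type}

/-! ### Tensor products of trace class operators -/

/-! The simulator runs the whole real system, devices and protocol included, by itself; it passes
the length of Alice's key to the ideal resource and throws the simulated keys away. The ideal world
with this simulator is therefore the real system whose key output is overwritten, at every tick, by
what the ideal resource would emit for that length (`simulator_prob`, with `System.post` and
`idealKeys`). It remains to compare the real system with its own overwritten version.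

No key leaves before certification has ended, so overwriting has no effect until the decision. At
that tick the joint state splits into two unnormalised branches (`realSystem_step_decide`). In the
rejecting branch all keys are empty, and overwriting still has no effect, because there is only one
key of length zero. Hence only the approving branch contributes to the advantage
(`abs_prob_sub_post`), and its trace is Pr[F = 1] (`approvalProb_eq`).

If the parameters of the model lie outside the set of criterion 2, the contribution is at most this
trace, hence at most `εcert`. Otherwise a hybrid argument over the instances applies
(`abs_value_sub_le`): replacing the keys of instance j costs `εQKD j` by criterion 2, whatever state
the earlier replacements have left, provided that the rest of the interaction is a test on what the
attacker holds when the keys are released. This proviso is `Protocol.exists_rounds_discard`: the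
next instance starts by clearing the device memories and with fresh local memories, and after the
last instance the devices are not used. Thus no memory carries information about earlier keys into
later outputs. Each model falls into one of the two cases, so one of the two summands already bounds
its advantage.

Identities between composed channels are verified on product operators. In infinite dimension these
do not span the trace class, but linear combinations of positive trace-bounded maps (`BL`) are
determined by their values on matrix units, since finite matrices approximate every positive
operator (`exists_finite_approx`). This gives `BL.ext_tmul`, on which nearly every later computation
rests. -/

theorem IsPosTC.kron {a : Matrix n n ℂ} {b : Matrix m m ℂ} (ha : IsPosTC a) (hb : IsPosTC b) :
    IsPosTC (Matrix.of fun p q : n × m => a p.1 q.1 * b p.2 q.2) := by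
  refine ⟨posSemidef_of_finite fun k e => ?_, ?_⟩
  -- On finitely many indices the product is the principal submatrix along `i ↦ (i, i)` of a finite
  -- Kronecker product.
  · have h := ((ha.1.submatrix (fun i => (e i).1)).kronecker
      (hb.1.submatrix (fun i => (e i).2))).submatrix fun i : Fin k => (i, i)
    exact h
  · have h := summable_mul_of_summable_norm ha.2.norm hb.2.norm
    exact h

/-- The tensor product `a ⊗ b`. -/
def TC.tmul (a : TC n) (b : TC m) : TC (n × m) :=
  ⟨Matrix.of fun p q => a.1 p.1 q.1 * b.1 p.2 q.2, by
    induction a using TC.induction with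
    | pos a ha =>
      induction b using TC.induction with
      | pos b hb => exact (ha.kron hb).mem
      | add x y h1 h2 =>
        convert (TC (n × m)).add_mem h1 h2
        ext p q
        simp [mul_add]
      | smul c x h1 =>
        convert (TC (n × m)).smul_mem c h1
        ext p q
        simp [mul_left_comm]
    | add x y h1 h2 =>
      convert (TC (n × m)).add_mem h1 h2
      ext p q
      simp [add_mul]
    | smul c x h1 =>
      convert (TC (n × m)).smul_mem c h1
      ext p q
      simp [mul_assoc]⟩

infixl:70 " ⊠ " => TC.tmul

namespace TC

theorem tmul_apply (a : TC n) (b : TC m) (p q : n × m) :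
    (a ⊠ b).1 p q = a.1 p.1 q.1 * b.1 p.2 q.2 := rfl

theorem ext_apply {a b : TC n} (h : ∀ i j, a.1 i j = b.1 i j) : a = b :=
  Subtype.ext (Matrix.ext h)

theorem add_tmul (a b : TC n) (c : TC m) : (a + b) ⊠ c = a ⊠ c + b ⊠ c :=
  ext_apply fun p q => by simp [tmul_apply, add_mul]

theorem tmul_add (a : TC n) (b c : TC m) : a ⊠ (b + c) = a ⊠ b + a ⊠ c :=
  ext_apply fun p q => by simp [tmul_apply, mul_add]

@[simp] theorem smul_tmul (z : ℂ) (a : TC n) (c : TC m) : (z • a) ⊠ c = z • (a ⊠ c) :=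
  ext_apply fun p q => by simp [tmul_apply, mul_assoc]

@[simp] theorem tmul_smul (z : ℂ) (a : TC n) (c : TC m) : a ⊠ (z • c) = z • (a ⊠ c) :=
  ext_apply fun p q => by simp [tmul_apply, mul_left_comm]

theorem posSemidef_tmul {a : TC n} {b : TC m} (ha : a.1.PosSemidef) (hb : b.1.PosSemidef) :
    (a ⊠ b).1.PosSemidef :=
  (IsPosTC.kron ⟨ha, summable a.2⟩ ⟨hb, summable b.2⟩).1

@[simp] theorem trace_tmul (a : TC n) (b : TC m) : trace (a ⊠ b) = trace a * trace b :=
  (tsum_mul_tsum_of_summable_norm (summable a.2).norm (summable b.2).norm).symm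

/-- The identity on the trivial register. -/
def one : TC Unit := ⟨1, unit_mem⟩

@[simp] theorem trace_one : trace one = 1 := by
  change ∑' i : Unit, (1 : Matrix Unit Unit ℂ) i i = 1
  simp

theorem one_posSemidef : one.1.PosSemidef := Matrix.PosSemidef.one

theorem exists_smul_one (u : TC Unit) : ∃ c : ℂ, u = c • one :=
  ⟨u.1 () (), ext_apply fun i j => by simp [one]⟩

theorem trace_nonneg {a : TC n} (ha : a.1.PosSemidef) : 0 ≤ trace a :=
  tsum_nonneg fun _ => ha.diag_nonneg

theorem trace_re_nonneg {a : TC n} (ha : a.1.PosSemidef) : 0 ≤ (trace a).re :=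
  (Complex.nonneg_iff.1 (trace_nonneg ha)).1

theorem trace_eq_re {a : TC n} (ha : a.1.PosSemidef) : trace a = ((trace a).re : ℂ) :=
  Complex.ext rfl (Complex.nonneg_iff.1 (trace_nonneg ha)).2.symm

theorem diag_re_le_trace {a : TC n} (ha : a.1.PosSemidef) (i : n) :
    (a.1 i i).re ≤ (trace a).re := by
  have h := (summable_iff_re fun i => ha.diag_nonneg (i := i)).1 (summable a.2)
  have e : (trace a).re = ∑' i, (a.1 i i).re := Complex.re_tsum (summable a.2)
  rw [e]
  exact h.le_tsum i fun j _ => (Complex.nonneg_iff.1 ha.diag_nonneg).1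

/-- The principal minor on `i`, `j` is nonnegative, so the squared modulus of the entry is at most
the product of two diagonal entries, each bounded by the trace. -/
theorem norm_apply_le_trace {a : TC n} (ha : a.1.PosSemidef) (i j : n) :
    ‖a.1 i j‖ ≤ (trace a).re := by
  have h := (ha.submatrix ![i, j]).det_nonneg
  have hji : a.1 j i = star (a.1 i j) := (congrFun (congrFun ha.1 j) i).symm
  rw [Matrix.det_fin_two] at h
  simp only [Matrix.submatrix_apply, Matrix.cons_val_zero, Matrix.cons_val_one, hji] at h
  have hi := Complex.nonneg_iff.1 (ha.diag_nonneg (i := i))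
  have hj := Complex.nonneg_iff.1 (ha.diag_nonneg (i := j))
  have h1 := (Complex.nonneg_iff.1 h).1
  have e : a.1 i j * star (a.1 i j) = ((‖a.1 i j‖ ^ 2 : ℝ) : ℂ) := by
    simpa using Complex.mul_conj' (a.1 i j)
  rw [e, Complex.sub_re, Complex.mul_re, ← hi.2, ← hj.2, Complex.ofReal_re] at h1
  refine abs_le_of_sq_le_sq' ?_ (trace_re_nonneg ha) |>.2
  nlinarith [diag_re_le_trace ha i, diag_re_le_trace ha j, hi.1, hj.1]

/-! ### Matrix units -/

open Classical in
/-- The matrix unit `|i⟩⟨j|`. -/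
def single (i j : n) : TC n :=
  ⟨Matrix.of fun a b => if a = i ∧ b = j then 1 else 0, by
    -- With `v = |i, false⟩ + |j, true⟩`, the block `(false, true)` of the positive operator
    -- `|v⟩⟨v|` is `|i⟩⟨j|`.
    let v : n × Bool → ℂ := fun p => if p = (i, false) ∨ p = (j, true) then 1 else 0
    have hv : IsPosTC (Matrix.of fun p q => v p * star (v q)) := by
      refine ⟨posSemidef_of_finite fun k e => ?_, ?_⟩
      · exact Matrix.posSemidef_vecMulVec_self_star (fun a => v (e a))
      · refine summable_of_hasFiniteSupport (Set.Finite.subset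
          (Set.toFinite {(i, false), (j, true)}) fun p hp => ?_)
        by_contra hc
        simp only [Set.mem_insert_iff, Set.mem_singleton_iff] at hc
        simp [v, hc] at hp
    convert TC.slice_mem hv.mem false true
    ext a b
    simp [slice, v, ← ite_and, and_comm]⟩

open Classical in
theorem single_apply (i j a b : n) : (single i j).1 a b = if a = i ∧ b = j then 1 else 0 := rfl

theorem single_prod (p q : n × m) : single p q = single p.1 q.1 ⊠ single p.2 q.2 :=
  ext_apply fun a b => by
    classical
    simp only [single_apply, tmul_apply, Prod.ext_iff]
    split_ifs <;> first | (exfalso; tauto) | simp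

open Classical in
/-- The basis state `|a⟩⟨a|`. -/
def basis (a : n) : TC n := single a a

theorem basis_prod (a : n) (b : m) : basis (a, b) = basis a ⊠ basis b := single_prod _ _

/-- Conjugation of a positive operator by a bounded real diagonal matrix. -/
theorem isPosTC_scale {a : TC n} (ha : a.1.PosSemidef) {d : n → ℝ} {B : ℝ}
    (hd : ∀ i, d i ^ 2 ≤ B) : IsPosTC (Matrix.of fun i j => (d i : ℂ) * a.1 i j * d j) := by
  refine ⟨posSemidef_of_finite fun k e => ?_, ?_⟩
  · have := (ha.submatrix e).conjTranspose_mul_mul_same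
      (Matrix.diagonal fun i => (d (e i) : ℂ))
    convert this using 1
    ext i j
    simp [Matrix.diagonal_conjTranspose, Matrix.mul_diagonal, Matrix.diagonal_mul]
  · refine Summable.of_norm_bounded ((summable a.2).norm.mul_left B) fun i => ?_
    have : ‖(d i : ℂ) * a.1 i i * d i‖ = d i ^ 2 * ‖a.1 i i‖ := by
      simp only [norm_mul, Complex.norm_real, Real.norm_eq_abs, ← sq_abs (d i)]
      ring
    rw [Matrix.of_apply, this]
    exact mul_le_mul_of_nonneg_right (hd i) (norm_nonneg _)

end TC

/-! ### Traces and approximation by finite matrices -/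

theorem hasSum_trace (a : TC n) : HasSum (fun i => a.1 i i) (TC.trace a) := (TC.summable a.2).hasSum

theorem hasSum_trace_re (a : TC n) : HasSum (fun i => (a.1 i i).re) (TC.trace a).re :=
  Complex.hasSum_re (hasSum_trace a)

/-- Approximation of a positive trace class operator by matrices with finitely many entries, with
an error that is a difference of positive operators of small trace. -/
theorem exists_finite_approx {a : TC n} (ha : a.1.PosSemidef) {η : ℝ} (hη : 0 < η) :
    ∃ f ∈ Submodule.span ℂ (Set.range fun p : n × n => TC.single p.1 p.2), ∃ x y : TC n,
      x.1.PosSemidef ∧ y.1.PosSemidef ∧ a = f + x - y ∧ (TC.trace x).re ≤ η ∧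
        (TC.trace y).re ≤ η := by
  classical
  set p := (TC.trace a).re with hp
  have hp0 : 0 ≤ p := TC.trace_re_nonneg ha
  have hd0 : ∀ i, 0 ≤ (a.1 i i).re := fun i => (Complex.nonneg_iff.1 ha.diag_nonneg).1
  -- Let `P` be the projection on a finite set `F` of basis vectors and `Q = 1 - P`. Completing the
  -- square gives `a = (1 + s²) PaP + (1 + s⁻²) QaQ - (sP - s⁻¹Q) a (sP - s⁻¹Q)`: a finite matrix
  -- plus a difference of positive operators, with the cross terms absorbed. A small `s` controls
  -- the share of `PaP` in the last term; `F` is chosen afterwards, so large that `s⁻²` times the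
  -- trace of `QaQ` is small as well.
  obtain ⟨s, hs0, hs⟩ : ∃ s : ℝ, 0 < s ∧ s ^ 2 * p ≤ η / 2 := by
    refine ⟨Real.sqrt (η / (2 * (p + 1))), by positivity, ?_⟩
    rw [Real.sq_sqrt (by positivity), div_mul_eq_mul_div, div_le_div_iff₀ (by positivity) two_pos]
    nlinarith
  have hsum := hasSum_trace_re a
  obtain ⟨F, hF⟩ : ∃ F : Finset n, p - η / 2 / (1 + (s⁻¹) ^ 2) < ∑ i ∈ F, (a.1 i i).re := by
    have h1 : p - η / 2 / (1 + (s⁻¹) ^ 2) < p := by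
      have : 0 < η / 2 / (1 + (s⁻¹) ^ 2) := by positivity
      linarith
    exact ((tendsto_order.1 hsum).1 _ h1).exists
  set q := p - ∑ i ∈ F, (a.1 i i).re with hq
  have hq0 : 0 ≤ q := sub_nonneg.2 (sum_le_hasSum F (fun i _ => hd0 i) hsum)
  have hqs : (1 + (s⁻¹) ^ 2) * q ≤ η / 2 := by
    have : q < η / 2 / (1 + (s⁻¹) ^ 2) := by linarith
    rw [lt_div_iff₀ (by positivity)] at this
    linarith
  let dP : n → ℝ := fun i => if i ∈ F then 1 else 0
  let dQ : n → ℝ := fun i => if i ∈ F then 0 else 1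
  let dX : n → ℝ := fun i => if i ∈ F then s else -s⁻¹
  have bQ : ∀ i, dQ i ^ 2 ≤ 1 := fun i => by simp only [dQ]; split_ifs <;> norm_num
  have bX : ∀ i, dX i ^ 2 ≤ s ^ 2 + (s⁻¹) ^ 2 := fun i => by
    simp only [dX]; split_ifs <;> [nlinarith [sq_nonneg s⁻¹]; nlinarith [sq_nonneg s]]
  have hQ := TC.isPosTC_scale ha bQ
  have hX := TC.isPosTC_scale ha bX
  have hfin : HasSum (fun i => dP i * (a.1 i i).re) (∑ i ∈ F, (a.1 i i).re) := by
    have : ∑ i ∈ F, (a.1 i i).re = ∑ i ∈ F, dP i * (a.1 i i).re :=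
      Finset.sum_congr rfl fun i hi => by simp [dP, hi]
    rw [this]
    exact hasSum_sum_of_ne_finset_zero fun i hi => by simp [dP, hi]
  have tQ : (TC.trace ⟨_, hQ.mem⟩).re = q := by
    refine (hasSum_trace_re _).unique ((hsum.sub hfin).congr_fun fun i => ?_)
    by_cases hi : i ∈ F <;> simp [dP, dQ, hi]
  have tX : (TC.trace ⟨_, hX.mem⟩).re = s ^ 2 * (p - q) + (s⁻¹) ^ 2 * q := by
    have e : s ^ 2 * (p - q) = s ^ 2 * ∑ i ∈ F, (a.1 i i).re := by rw [hq]; ring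
    rw [e]
    refine (hasSum_trace_re _).unique (((hfin.mul_left (s ^ 2)).add
      ((hsum.sub hfin).mul_left ((s⁻¹) ^ 2))).congr_fun fun i => ?_)
    by_cases hi : i ∈ F <;> simp [dP, dX, hi] <;> ring
  refine ⟨∑ i ∈ F, ∑ j ∈ F, ((1 + s ^ 2 : ℝ) : ℂ) • a.1 i j • TC.single i j, ?_,
    ((1 + (s⁻¹) ^ 2 : ℝ) : ℂ) • ⟨_, hQ.mem⟩, ⟨_, hX.mem⟩, ?_, hX.1, ?_, ?_, ?_⟩
  · refine Submodule.sum_mem _ fun i _ => Submodule.sum_mem _ fun j _ =>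
      Submodule.smul_mem _ _ (Submodule.smul_mem _ _ (Submodule.subset_span ⟨(i, j), rfl⟩))
  · exact hQ.1.smul (Complex.zero_le_real.2 (by positivity))
  · refine TC.ext_apply fun i j => ?_
    have hsum2 : (∑ i' ∈ F, ∑ j' ∈ F, ((1 + s ^ 2 : ℝ) : ℂ) • a.1 i' j' • TC.single i' j').1 i j
        = if i ∈ F ∧ j ∈ F then ((1 + s ^ 2 : ℝ) : ℂ) * a.1 i j else 0 := by
      simp only [Submodule.coe_sum, Submodule.coe_smul, Matrix.sum_apply, Matrix.smul_apply,
        TC.single_apply, smul_eq_mul, mul_ite, mul_one, mul_zero]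
      simp only [ite_and, Finset.sum_ite_eq, Finset.sum_ite_irrel, Finset.sum_const_zero]
    have hsc : ((s : ℂ)) * ((s : ℂ))⁻¹ = 1 :=
      mul_inv_cancel₀ (by exact_mod_cast hs0.ne')
    rw [Submodule.coe_sub, Submodule.coe_add, Matrix.sub_apply, Matrix.add_apply, hsum2]
    by_cases hi : i ∈ F <;> by_cases hj : j ∈ F <;>
      simp [dQ, dX, hi, hj] <;> first | ring1 | linear_combination (-a.1 i j) * hsc
  · rw [map_smul, smul_eq_mul, Complex.re_ofReal_mul, tQ]
    linarith
  · rw [tX]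
    have : 0 ≤ s ^ 2 * q := by positivity
    nlinarith

/-! ### Bounded linear maps between trace class operators -/

/-- Positive maps that are bounded for the trace. -/
def PosBdd (L : TC n →ₗ[ℂ] TC m) : Prop :=
  ∃ C : ℝ, 0 ≤ C ∧ ∀ x : TC n, x.1.PosSemidef →
    (L x).1.PosSemidef ∧ (TC.trace (L x)).re ≤ C * (TC.trace x).re

/-- The linear combinations of positive bounded maps. -/
def bddMaps (n m : Type) : Submodule ℂ (TC n →ₗ[ℂ] TC m) := Submodule.span ℂ {L | PosBdd L}

/-- `f` is a linear combination of positive bounded linear maps. -/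
class BL (f : TC n → TC m) : Prop where
  out : ∃ L ∈ bddMaps n m, ∀ x, f x = L x

theorem PosBdd.comp {L : TC m →ₗ[ℂ] TC l} {K : TC n →ₗ[ℂ] TC m} (hL : PosBdd L)
    (hK : PosBdd K) : PosBdd (L ∘ₗ K) := by
  obtain ⟨C, hC, h⟩ := hL
  obtain ⟨D, hD, h'⟩ := hK
  refine ⟨C * D, mul_nonneg hC hD, fun x hx => ⟨(h _ (h' x hx).1).1, ?_⟩⟩
  refine (h _ (h' x hx).1).2.trans ?_
  rw [mul_assoc]
  exact mul_le_mul_of_nonneg_left (h' x hx).2 hC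

theorem PosBdd.bl {L : TC n →ₗ[ℂ] TC m} (hL : PosBdd L) : BL (fun x => L x) :=
  ⟨L, Submodule.subset_span hL, fun _ => rfl⟩

theorem bddMaps_comp {L : TC m →ₗ[ℂ] TC l} {K : TC n →ₗ[ℂ] TC m} (hL : L ∈ bddMaps m l)
    (hK : K ∈ bddMaps n m) : L ∘ₗ K ∈ bddMaps n l := by
  induction hL using Submodule.span_induction with
  | mem L hL =>
    induction hK using Submodule.span_induction with
    | mem K hK => exact Submodule.subset_span (hL.comp hK)
    | zero => simp
    | add x y _ _ hx hy => rw [LinearMap.comp_add]; exact add_mem hx hy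
    | smul c x _ hx => rw [LinearMap.comp_smul]; exact Submodule.smul_mem _ _ hx
  | zero => simp
  | add x y _ _ hx hy => rw [LinearMap.add_comp]; exact add_mem hx hy
  | smul c x _ hx => rw [LinearMap.smul_comp]; exact Submodule.smul_mem _ _ hx

/-- Positivity is lost in linear combinations, but a bound on the entries by the trace survives
them; this is the continuity used for extensionality. -/
theorem bddMaps_apply_le {L : TC n →ₗ[ℂ] TC m} (hL : L ∈ bddMaps n m) :
    ∃ C : ℝ, 0 ≤ C ∧ ∀ x : TC n, x.1.PosSemidef → ∀ i j,
      ‖(L x).1 i j‖ ≤ C * (TC.trace x).re := by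
  induction hL using Submodule.span_induction with
  | mem L hL =>
    obtain ⟨C, hC, h⟩ := hL
    exact ⟨C, hC, fun x hx i j => (TC.norm_apply_le_trace (h x hx).1 i j).trans (h x hx).2⟩
  | zero => exact ⟨0, le_rfl, fun x hx i j => by simp⟩
  | add K L _ _ hK hL =>
    obtain ⟨C, hC, h⟩ := hK
    obtain ⟨D, hD, h'⟩ := hL
    refine ⟨C + D, add_nonneg hC hD, fun x hx i j => ?_⟩
    rw [add_mul]
    exact (norm_add_le _ _).trans (add_le_add (h x hx i j) (h' x hx i j))
  | smul c L _ hL =>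
    obtain ⟨C, hC, h⟩ := hL
    refine ⟨‖c‖ * C, by positivity, fun x hx i j => ?_⟩
    rw [mul_assoc]
    exact (norm_smul_le c _).trans (mul_le_mul_of_nonneg_left (h x hx i j) (norm_nonneg _))

/-- The map vanishes on finite matrices, and on the two small positive remainders of
`exists_finite_approx` its entries are arbitrarily small. -/
theorem eq_zero_of_single {L : TC n →ₗ[ℂ] TC m} (hL : L ∈ bddMaps n m)
    (h : ∀ i j, L (TC.single i j) = 0) : L = 0 := by
  obtain ⟨C, hC, hb⟩ := bddMaps_apply_le hL
  have h0 : ∀ f ∈ Submodule.span ℂ (Set.range fun p : n × n => TC.single p.1 p.2), L f = 0 := by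
    intro f hf
    have : Submodule.span ℂ (Set.range fun p : n × n => TC.single p.1 p.2) ≤ LinearMap.ker L :=
      Submodule.span_le.2 (by rintro _ ⟨p, rfl⟩; exact h p.1 p.2)
    exact this hf
  refine LinearMap.ext fun x => ?_
  induction x using TC.induction with
  | pos x hx =>
    refine TC.ext_apply fun i j => norm_le_zero_iff.1 (le_of_forall_pos_le_add fun ε hε => ?_)
    -- The tolerance has `C + 1` in the denominator because `C` may be zero.
    obtain ⟨f, hf, y, z, hy, hz, e, ty, tz⟩ :=
      exists_finite_approx hx.1 (η := ε / (2 * (C + 1))) (by positivity)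
    have e2 : L x = L y - L z := by rw [e, map_sub, map_add, h0 f hf, zero_add]
    rw [e2, zero_add]
    have hη : C * (ε / (2 * (C + 1))) ≤ ε / 2 := by
      rw [← mul_div_assoc, div_le_div_iff₀ (by positivity) two_pos]
      nlinarith
    calc ‖(L y).1 i j - (L z).1 i j‖ ≤ ‖(L y).1 i j‖ + ‖(L z).1 i j‖ := norm_sub_le _ _
      _ ≤ C * (TC.trace y).re + C * (TC.trace z).re := add_le_add (hb y hy i j) (hb z hz i j)
      _ ≤ C * (ε / (2 * (C + 1))) + C * (ε / (2 * (C + 1))) :=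
        add_le_add (mul_le_mul_of_nonneg_left ty hC) (mul_le_mul_of_nonneg_left tz hC)
      _ ≤ ε := by linarith
  | add x y hx hy => rw [map_add, map_add, hx, hy]
  | smul c x hx => rw [map_smul, map_smul, hx]

/-! ### Extensionality principles and closure properties of bounded maps -/

namespace BL

theorem comp {g : TC m → TC l} {f : TC n → TC m} (hg : BL g) (hf : BL f) :
    BL (fun x => g (f x)) := by
  obtain ⟨L, hL, h⟩ := hg
  obtain ⟨K, hK, h'⟩ := hf
  exact ⟨L ∘ₗ K, bddMaps_comp hL hK, fun x => by rw [h, h']; rfl⟩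

theorem ext_single {f g : TC n → TC m} [hf : BL f] [hg : BL g]
    (h : ∀ i j, f (TC.single i j) = g (TC.single i j)) : ∀ x, f x = g x := by
  obtain ⟨L, hL, hfL⟩ := hf
  obtain ⟨K, hK, hgK⟩ := hg
  have hmem : L + (-1 : ℂ) • K ∈ bddMaps n m := add_mem hL (Submodule.smul_mem _ _ hK)
  have h0 : L + (-1 : ℂ) • K = 0 := eq_zero_of_single hmem fun i j => by
    rw [LinearMap.add_apply, LinearMap.smul_apply, ← hfL, ← hgK, h, neg_one_smul, add_neg_cancel]
  intro x
  have := LinearMap.congr_fun h0 x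
  rw [LinearMap.add_apply, LinearMap.smul_apply, ← hfL, ← hgK, neg_one_smul] at this
  exact add_neg_eq_zero.1 this

/-- A matrix unit of a product register is a product of matrix units. The side conditions are left
to instance search, which the instances below serve. -/
theorem ext_tmul {f g : TC (n × m) → TC l} [hf : BL f] [hg : BL g]
    (h : ∀ a b, f (a ⊠ b) = g (a ⊠ b)) : ∀ x, f x = g x :=
  ext_single fun i j => by rw [TC.single_prod, h]

theorem ext_one {f g : TC Unit → TC l} [hf : BL f] [hg : BL g]
    (h : f TC.one = g TC.one) : ∀ x, f x = g x := by
  obtain ⟨L, hL, hfL⟩ := hf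
  obtain ⟨K, hK, hgK⟩ := hg
  intro x
  obtain ⟨c, rfl⟩ := TC.exists_smul_one x
  rw [hfL, hgK, map_smul, map_smul, ← hfL, ← hgK, h]

instance id : BL (fun x : TC n => x) :=
  PosBdd.bl (L := LinearMap.id) ⟨1, zero_le_one, fun x hx => ⟨hx, by simp⟩⟩

instance channel (Φ : Channel n m) : BL Φ.map :=
  PosBdd.bl ⟨1, zero_le_one, fun x hx =>
    ⟨Φ.map_posSemidef hx, by rw [Φ.tracePreserving, one_mul]⟩⟩

instance map (Φ : Channel n m) (f : TC l → TC n) [hf : BL f] : BL (fun x => Φ.map (f x)) :=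
  (channel Φ).comp hf

instance add (f g : TC n → TC m) [hf : BL f] [hg : BL g] : BL (fun x => f x + g x) := by
  obtain ⟨L, hL, hfL⟩ := hf
  obtain ⟨K, hK, hgK⟩ := hg
  exact ⟨L + K, add_mem hL hK, fun x => by rw [hfL, hgK]; rfl⟩

instance smul (c : ℂ) (f : TC n → TC m) [hf : BL f] : BL (fun x => c • f x) := by
  obtain ⟨L, hL, hfL⟩ := hf
  exact ⟨c • L, Submodule.smul_mem _ _ hL, fun x => by rw [hfL]; rfl⟩

/-- A map that depends linearly on a second argument need only be bounded for positive values of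
this argument. -/
theorem of_pos {f : TC n → TC m → TC l} (c : TC m)
    (hpos : ∀ c, IsPosTC c.1 → BL (fun x => f x c))
    (hadd : ∀ x c d, f x (c + d) = f x c + f x d) (hsmul : ∀ x (z : ℂ) c, f x (z • c) = z • f x c) :
    BL (fun x => f x c) := by
  induction c using TC.induction with
  | pos c hc => exact hpos c hc
  | add c d hc hd => simp only [hadd]; infer_instance
  | smul z c hc => simp only [hsmul]; infer_instance

theorem tmul_const (c : TC m) : BL (fun x : TC n => x ⊠ c) :=
  of_pos (f := fun x c => x ⊠ c) c (fun c hc =>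
    PosBdd.bl (L :=
        { toFun := fun x => x ⊠ c
          map_add' := fun x y => TC.add_tmul x y c
          map_smul' := fun z x => TC.smul_tmul z x c })
      ⟨(TC.trace c).re, TC.trace_re_nonneg hc.1, fun x hx => ⟨TC.posSemidef_tmul hx hc.1, by
        change (TC.trace (x ⊠ c)).re ≤ _
        rw [TC.trace_tmul, TC.trace_eq_re hx, TC.trace_eq_re hc.1, mul_comm]
        simp⟩⟩) (fun x => TC.tmul_add x) fun x z c => TC.tmul_smul z x c

instance tmul_left (f : TC n → TC m) (c : TC l) [hf : BL f] : BL (fun x => f x ⊠ c) :=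
  (tmul_const c).comp hf

instance const_tmul (c : TC m) : BL (TC.tmul c : TC n → TC (m × n)) :=
  of_pos (f := fun x c => c ⊠ x) c (fun c hc =>
    PosBdd.bl (L :=
        { toFun := fun x => c ⊠ x
          map_add' := fun x y => TC.tmul_add c x y
          map_smul' := fun z x => TC.tmul_smul z c x })
      ⟨(TC.trace c).re, TC.trace_re_nonneg hc.1, fun x hx => ⟨TC.posSemidef_tmul hc.1 hx, by
        change (TC.trace (c ⊠ x)).re ≤ _
        rw [TC.trace_tmul, TC.trace_eq_re hx, TC.trace_eq_re hc.1]
        simp⟩⟩) (fun x c d => TC.add_tmul c d x) fun x z c => TC.smul_tmul z c x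

instance tmul_right (f : TC n → TC m) (c : TC l) [hf : BL f] : BL (fun x => c ⊠ f x) :=
  (const_tmul c).comp hf

theorem trace_smul_const (c : TC m) : BL (fun x : TC n => TC.trace x • c) :=
  of_pos (f := fun x c => TC.trace x • c) c (fun c hc =>
    PosBdd.bl (L := TC.trace.smulRight c) ⟨(TC.trace c).re, TC.trace_re_nonneg hc.1, fun x hx =>
      ⟨hc.1.smul (TC.trace_nonneg hx), by
        change (TC.trace (TC.trace x • c)).re ≤ _
        rw [map_smul, TC.trace_eq_re hx, TC.trace_eq_re hc.1, mul_comm]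
        simp⟩⟩) (fun x c d => smul_add _ _ _) fun x z c => smul_comm _ _ _

instance trace_smul (f : TC n → TC m) (c : TC l) [hf : BL f] :
    BL (fun x => TC.trace (f x) • c) :=
  (trace_smul_const c).comp hf

theorem diag_smul_const (i : n) (c : TC m) : BL (fun x : TC n => x.1 i i • c) :=
  of_pos (f := fun x c => x.1 i i • c) c (fun c hc =>
    PosBdd.bl (L :=
        { toFun := fun x => x.1 i i • c
          map_add' := fun x y => add_smul _ _ _
          map_smul' := fun z x => mul_smul _ _ _ })
      ⟨(TC.trace c).re, TC.trace_re_nonneg hc.1, fun x hx =>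
      ⟨hc.1.smul hx.diag_nonneg, by
        change (TC.trace (x.1 i i • c)).re ≤ _
        have hi := TC.diag_re_le_trace hx i
        have h0 := TC.trace_re_nonneg hc.1
        rw [map_smul, TC.trace_eq_re hc.1, smul_eq_mul, mul_comm, Complex.re_ofReal_mul,
          Complex.ofReal_re]
        exact mul_le_mul_of_nonneg_left hi h0⟩⟩)
      (fun x c d => smul_add _ _ _) fun x z c => smul_comm _ _ _

instance diag_smul (f : TC n → TC m) (i : m) (c : TC l) [hf : BL f] :
    BL (fun x => (f x).1 i i • c) :=
  (diag_smul_const i c).comp hf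

theorem compress_re_le {e : n → m} (he : e.Injective) {x : TC m} (hx : x.1.PosSemidef) :
    (TC.trace (Channel.compress e he x)).re ≤ (TC.trace x).re := by
  have h1 := hasSum_trace_re (Channel.compress e he x)
  have h2 := hasSum_trace_re x
  refine h1.tsum_eq ▸ h2.tsum_eq ▸ ?_
  exact (tsum_comp_le_tsum_of_inj h2.summable
    (fun i => (Complex.nonneg_iff.1 hx.diag_nonneg).1) he)

theorem posBdd_compress {e : n → m} (he : e.Injective) : PosBdd (Channel.compress e he) :=
  ⟨1, zero_le_one, fun x hx => ⟨hx.submatrix e, by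
    rw [one_mul]; exact compress_re_le he hx⟩⟩

instance bl_compress {e : n → m} (he : e.Injective) : BL (Channel.compress e he) :=
  (posBdd_compress he).bl

instance compress {e : n → m} (he : e.Injective) (f : TC l → TC m) [hf : BL f] :
    BL (fun x => Channel.compress e he (f x)) :=
  (posBdd_compress he).bl.comp hf

end BL

/-! ### Channels on tensor products -/

namespace Channel

@[simp] theorem andThen_map (Φ : Channel n m) (Ψ : Channel m l) (x : TC n) :
    (Φ.andThen Ψ).map x = Ψ.map (Φ.map x) := rfl

@[simp] theorem id_map (x : TC n) : (Channel.id n).map x = x := rfl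

@[simp] theorem trace_map (Φ : Channel n m) (x : TC n) : TC.trace (Φ.map x) = TC.trace x :=
  Φ.tracePreserving x

theorem ofEquiv_apply (e : n ≃ m) (x : TC n) (i j : m) :
    ((ofEquiv e).map x).1 i j = x.1 (e.symm i) (e.symm j) := rfl

@[simp] theorem ampl_tmul (Φ : Channel n m) (a : TC n) (b : TC l) :
    (Φ.ampl l).map (a ⊠ b) = Φ.map a ⊠ b := by
  refine TC.ext_apply fun p q => ?_
  have e : (⟨slice (a ⊠ b).1 p.2 q.2, TC.slice_mem (a ⊠ b).2 p.2 q.2⟩ : TC n)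
      = b.1 p.2 q.2 • a := TC.ext_apply fun i j => by
    simp [slice, TC.tmul_apply, mul_comm]
  change (Φ.map ⟨slice (a ⊠ b).1 p.2 q.2, _⟩).1 p.1 q.1 = _
  rw [e, map_smul]
  simp [TC.tmul_apply, mul_comm]

@[simp] theorem swap_tmul (a : TC n) (b : TC m) : (swap n m).map (a ⊠ b) = b ⊠ a :=
  TC.ext_apply fun _ _ => mul_comm _ _

@[simp] theorem ofEquiv_prodComm_tmul (a : TC n) (b : TC m) :
    (ofEquiv (Equiv.prodComm n m)).map (a ⊠ b) = b ⊠ a := swap_tmul a b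

@[simp] theorem onSnd_tmul (Φ : Channel n m) (a : TC l) (b : TC n) :
    (Φ.onSnd l).map (a ⊠ b) = a ⊠ Φ.map b := by simp [onSnd]

@[simp] theorem prod_tmul (Φ : Channel n m) (Ψ : Channel n' m') (a : TC n) (b : TC n') :
    (Φ.prod Ψ).map (a ⊠ b) = Φ.map a ⊠ Ψ.map b := by simp [Channel.prod]

@[simp] theorem assoc_tmul (a : TC n) (b : TC m) (c : TC l) :
    (assoc n m l).map ((a ⊠ b) ⊠ c) = a ⊠ (b ⊠ c) :=
  TC.ext_apply fun _ _ => mul_assoc _ _ _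

@[simp] theorem unassoc_tmul (a : TC n) (b : TC m) (c : TC l) :
    (unassoc n m l).map (a ⊠ (b ⊠ c)) = (a ⊠ b) ⊠ c :=
  TC.ext_apply fun _ _ => (mul_assoc _ _ _).symm

@[simp] theorem rightComm_tmul (a : TC n) (b : TC m) (c : TC l) :
    (rightComm n m l).map ((a ⊠ b) ⊠ c) = (a ⊠ c) ⊠ b := by simp [rightComm]

@[simp] theorem leftComm_tmul (a : TC n) (b : TC m) (c : TC l) :
    (leftComm n m l).map (a ⊠ (b ⊠ c)) = b ⊠ (a ⊠ c) := by simp [leftComm]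

@[simp] theorem interchange_tmul (a : TC n) (b : TC m) (c : TC n') (d : TC m') :
    (interchange n m n' m').map ((a ⊠ b) ⊠ (c ⊠ d)) = (a ⊠ c) ⊠ (b ⊠ d) :=
  TC.ext_apply fun _ _ => mul_mul_mul_comm _ _ _ _

@[simp] theorem ofEquiv_punitProd_symm (a : TC n) :
    (ofEquiv (Equiv.punitProd n).symm).map a = TC.one ⊠ a :=
  TC.ext_apply fun p q => by
    have : TC.one.1 p.1 q.1 = 1 := by simp [TC.one]
    rw [TC.tmul_apply, this, one_mul]
    rfl

theorem trace_unit (u : TC Unit) : TC.trace u = u.1 () () := by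
  change ∑' i : Unit, u.1 i i = _
  simp

@[simp] theorem ofEquiv_prodPUnit (a : TC n) (u : TC Unit) :
    (ofEquiv (Equiv.prodPUnit n)).map (a ⊠ u) = TC.trace u • a :=
  TC.ext_apply fun p q => by
    rw [trace_unit]
    exact mul_comm _ _

theorem classical_apply_self (κ : n → PMF m) (x : TC n) (a : m) :
    ((classical κ).map x).1 a a = ∑' i, x.1 i i * ((κ i a).toReal : ℂ) := classicalMat_self κ x a

theorem classical_apply_ne (κ : n → PMF m) (x : TC n) {a b : m} (h : a ≠ b) :
    ((classical κ).map x).1 a b = 0 := classicalMat_ne κ x h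

@[simp] theorem discard_map (a : TC n) : (discard n).map a = TC.trace a • TC.one :=
  TC.ext_apply fun p q => by
    cases p; cases q
    rw [discard, classical_apply_self]
    simp [TC.one, TC.trace]
    rfl

@[simp] theorem discardSnd_tmul (a : TC n) (b : TC m) :
    (discardSnd n m).map (a ⊠ b) = TC.trace b • a := by simp [discardSnd]

@[simp] theorem discardFst_tmul (a : TC n) (b : TC m) :
    (discardFst n m).map (a ⊠ b) = TC.trace a • b := by simp [discardFst]

@[simp] theorem adjoin_map (σ : Channel Unit m) (a : TC n) :
    (adjoin n σ).map a = σ.map TC.one ⊠ a := by simp [adjoin]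

@[simp] theorem reset_map (σ : Channel Unit m) (a : TC n) :
    (reset n σ).map a = TC.trace a • σ.map TC.one := by simp [reset]

@[simp] theorem ifBit_tmul (Φ₀ Φ₁ : Channel n m) (β : TC Bool) (a : TC n) :
    (ifBit Φ₀ Φ₁).map (β ⊠ a) = β.1 false false • Φ₀.map a + β.1 true true • Φ₁.map a := by
  rw [← map_smul, ← map_smul]
  rfl

@[simp] theorem ifSome_tmul (Φ₀ : Channel n l) (Φ₁ : Channel (m × n) l) (o : TC (Option m))
    (a : TC n) : (ifSome Φ₀ Φ₁).map (o ⊠ a) = o.1 none none • Φ₀.map a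
      + Φ₁.map (compress some (Option.some_injective m) o ⊠ a) := by
  rw [← map_smul]
  rfl

end Channel

/-! ### Classical states -/

/-- The classical state with distribution `p`. -/
def dist (p : PMF m) : TC m := (Channel.classical fun _ : Unit => p).map TC.one

theorem dist_apply_self (p : PMF m) (a : m) : (dist p).1 a a = ((p a).toReal : ℂ) := by
  rw [dist, Channel.classical_apply_self]
  simp [TC.one]

theorem dist_apply_ne (p : PMF m) {a b : m} (h : a ≠ b) : (dist p).1 a b = 0 :=
  Channel.classical_apply_ne _ _ h

theorem TC.basis_apply_self (a : m) : (TC.basis a).1 a a = 1 := by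
  classical simp [TC.basis, TC.single_apply]

theorem TC.basis_apply_ne {a b : m} (c : m) (h : b ≠ a) : (TC.basis a).1 b c = 0 := by
  classical simp [TC.basis, TC.single_apply, h]

@[simp] theorem dist_pure (a : m) : dist (PMF.pure a) = TC.basis a :=
  TC.ext_apply fun i j => by
    classical
    by_cases h : i = j
    · subst h
      rw [dist_apply_self, PMF.pure_apply, TC.basis, TC.single_apply]
      split_ifs with h1 <;> simp_all
    · rw [dist_apply_ne _ h, TC.basis, TC.single_apply, if_neg]
      rintro ⟨rfl, rfl⟩
      exact h rfl

namespace Channel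

@[simp] theorem value_map_one (a : m) : (value a).map TC.one = TC.basis a := dist_pure a

@[simp] theorem classical_basis (κ : n → PMF m) (a : n) :
    (classical κ).map (TC.basis a) = dist (κ a) :=
  TC.ext_apply fun i j => by
    by_cases h : i = j
    · subst h
      rw [classical_apply_self, dist_apply_self, tsum_eq_single a, TC.basis_apply_self, one_mul]
      intro b hb
      rw [TC.basis_apply_ne _ hb, zero_mul]
    · rw [dist_apply_ne _ h, classical_apply_ne _ _ h]

theorem classical_single_ne (κ : n → PMF m) {a b : n} (hab : a ≠ b) :
    (classical κ).map (TC.single a b) = 0 :=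
  TC.ext_apply fun i j => by
    classical
    by_cases h : i = j
    · subst h
      rw [classical_apply_self]
      refine (tsum_congr fun k => ?_).trans tsum_zero
      rw [TC.single_apply, if_neg, zero_mul]
      rintro ⟨rfl, h2⟩
      exact hab h2
    · rw [classical_apply_ne _ _ h]; rfl

end Channel

@[simp] theorem TC.trace_basis (a : m) : TC.trace (TC.basis a) = 1 := by
  rw [← Channel.value_map_one, Channel.trace_map, TC.trace_one]

/-- To show that two maps agree after a measurement it suffices to consider basis states. -/
theorem BL.ext_classical {f g : TC m → TC l} [BL f] [BL g] (κ : n → m)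
    (h : ∀ a, f (TC.basis (κ a)) = g (TC.basis (κ a))) (x : TC n) :
    f ((Channel.classical fun a => PMF.pure (κ a)).map x)
      = g ((Channel.classical fun a => PMF.pure (κ a)).map x) := by
  have := BL.comp ‹BL f› (BL.channel (Channel.classical fun a => PMF.pure (κ a)))
  have := BL.comp ‹BL g› (BL.channel (Channel.classical fun a => PMF.pure (κ a)))
  revert x
  refine BL.ext_single (f := fun x => f ((Channel.classical fun a => PMF.pure (κ a)).map x))
    (g := fun x => g ((Channel.classical fun a => PMF.pure (κ a)).map x)) fun i j => ?_
  by_cases hij : i = j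
  · subst hij
    have e : TC.single i i = TC.basis i := rfl
    rw [e, Channel.classical_basis, dist_pure, h]
  · have hf0 : f 0 = 0 := by obtain ⟨L, -, hL⟩ := ‹BL f›; rw [hL, map_zero]
    have hg0 : g 0 = 0 := by obtain ⟨L, -, hL⟩ := ‹BL g›; rw [hL, map_zero]
    rw [Channel.classical_single_ne _ hij, hf0, hg0]

end

/-! ### Interaction of a strategy with a system -/

namespace Strategy
variable {I O O' M M' M₀ M₁ : Type} (A : Strategy I O)

/-- `release` for an arbitrary channel in place of the evolution of the system. -/
def releaseWith (τ : ℕ) (Φ : Channel (I × M) (O' × M')) :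
    Channel (A.Mem × M) ((O' × A.Mem) × M') :=
  (A.prog.send τ).ampl M
    |>.andThen (Channel.rightComm I A.Mem M)
    |>.andThen (Φ.ampl A.Mem)
    |>.andThen (Channel.rightComm O' M' A.Mem)

theorem release_eq (S : System I O) (τ : ℕ) : A.release S τ = A.releaseWith τ (S.step τ) := rfl

/-- The strategy touches only its own memory and the messages, so an embedding of system memories
that is respected by one step is respected by the joint evolution. -/
theorem releaseWith_map_onSnd (τ : ℕ) {Φ : Channel (I × M₀) (O' × M')}
    {Φ' : Channel (I × M) (O' × M₁)} {e : Channel M₀ M} {e' : Channel M' M₁}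
    (h : ∀ i m, Φ'.map (i ⊠ e.map m) = (e'.onSnd O').map (Φ.map (i ⊠ m))) :
    ∀ x, (A.releaseWith τ Φ').map ((e.onSnd A.Mem).map x)
      = (e'.onSnd (O' × A.Mem)).map ((A.releaseWith τ Φ).map x) := by
  refine BL.ext_tmul fun a m => ?_
  simp only [releaseWith, Channel.andThen_map, Channel.onSnd_tmul, Channel.ampl_tmul]
  -- The message and the memory that remains may be entangled. The result is therefore generalised
  -- to an arbitrary operator and expanded into products once more; this pattern recurs after every
  -- channel with a composite output.
  generalize (A.prog.send τ).map a = y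
  revert y
  refine BL.ext_tmul fun i a => ?_
  simp only [Channel.rightComm_tmul, Channel.ampl_tmul, h]
  generalize Φ.map (i ⊠ m) = y
  revert y
  exact BL.ext_tmul fun o m => by simp

theorem releaseWith_absorb (τ : ℕ) {Φ : Channel (I × M₀) (O' × M')}
    {Φ' : Channel (I × M) (O' × M')} {e : Channel M₀ M}
    (h : ∀ i m, Φ'.map (i ⊠ e.map m) = Φ.map (i ⊠ m)) :
    ∀ x, (A.releaseWith τ Φ').map ((e.onSnd A.Mem).map x) = (A.releaseWith τ Φ).map x := by
  refine BL.ext_tmul fun a m => ?_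
  simp only [releaseWith, Channel.andThen_map, Channel.onSnd_tmul, Channel.ampl_tmul]
  generalize (A.prog.send τ).map a = y
  revert y
  exact BL.ext_tmul fun i a => by simp [h]

theorem releaseWith_congr (τ : ℕ) {Φ Φ' : Channel (I × M) (O' × M')}
    (h : ∀ i m, Φ'.map (i ⊠ m) = Φ.map (i ⊠ m)) :
    ∀ x, (A.releaseWith τ Φ').map x = (A.releaseWith τ Φ).map x := by
  refine BL.ext_tmul fun a m => ?_
  simp only [releaseWith, Channel.andThen_map, Channel.ampl_tmul]
  generalize (A.prog.send τ).map a = y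
  revert y
  exact BL.ext_tmul fun i a => by simp [h]

theorem releaseWith_andThen (τ : ℕ) (Φ : Channel (I × M) (O × M')) (Γ : Channel O O') :
    ∀ x, (A.releaseWith τ (Φ.andThen (Γ.ampl M'))).map x
      = ((Γ.ampl A.Mem).ampl M').map ((A.releaseWith τ Φ).map x) := by
  refine BL.ext_tmul fun a m => ?_
  simp only [releaseWith, Channel.andThen_map, Channel.ampl_tmul]
  generalize (A.prog.send τ).map a = y
  revert y
  refine BL.ext_tmul fun i a => ?_
  simp only [Channel.rightComm_tmul, Channel.ampl_tmul, Channel.andThen_map]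
  generalize Φ.map (i ⊠ m) = y
  revert y
  exact BL.ext_tmul fun o m => by simp

/-- If the output of a system does not depend on its memory, then neither does what the strategy
holds at the end of the tick. -/
theorem releaseWith_discard (τ : ℕ) {Φ : Channel (I × M) (O' × M')} {Ω : Channel I O'}
    (h : ∀ i m, (Channel.discardSnd O' M').map (Φ.map (i ⊠ m)) = TC.trace m • Ω.map i) :
    ∀ x, (Channel.discardSnd (O' × A.Mem) M').map ((A.releaseWith τ Φ).map x)
      = ((A.prog.send τ).andThen (Ω.ampl A.Mem)).map ((Channel.discardSnd A.Mem M).map x) := by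
  refine BL.ext_tmul fun a m => ?_
  simp only [releaseWith, Channel.andThen_map, Channel.ampl_tmul, Channel.discardSnd_tmul, map_smul]
  generalize (A.prog.send τ).map a = y
  revert y
  refine BL.ext_tmul fun i a => ?_
  simp only [Channel.rightComm_tmul, Channel.ampl_tmul, ← TC.smul_tmul, ← h]
  generalize Φ.map (i ⊠ m) = y
  revert y
  exact BL.ext_tmul fun o m => by simp

/-- Decomposition of a tick into two branches. -/
theorem releaseWith_add (τ : ℕ) {Φ : Channel (I × M) (O' × M')} {Φ₀ : Channel (I × M₀) (O' × M₁)}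
    {N₀ N₁ : Type} {Φ₁ : Channel (I × N₀) (O' × N₁)} {e₀ : Channel M₁ M'} {e₁ : Channel N₁ M'}
    {χ₀ : TC M → TC M₀} {χ₁ : TC M → TC N₀} {X₀ : TC (A.Mem × M) → TC (A.Mem × M₀)}
    {X₁ : TC (A.Mem × M) → TC (A.Mem × N₀)} [BL X₀] [BL X₁]
    (h₀ : ∀ a m, X₀ (a ⊠ m) = a ⊠ χ₀ m) (h₁ : ∀ a m, X₁ (a ⊠ m) = a ⊠ χ₁ m)
    (h : ∀ i m, Φ.map (i ⊠ m) = (e₀.onSnd O').map (Φ₀.map (i ⊠ χ₀ m))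
      + (e₁.onSnd O').map (Φ₁.map (i ⊠ χ₁ m))) :
    ∀ x, (A.releaseWith τ Φ).map x
      = (e₀.onSnd (O' × A.Mem)).map ((A.releaseWith τ Φ₀).map (X₀ x))
        + (e₁.onSnd (O' × A.Mem)).map ((A.releaseWith τ Φ₁).map (X₁ x)) := by
  refine BL.ext_tmul fun a m => ?_
  simp only [releaseWith, Channel.andThen_map, Channel.ampl_tmul, h₀, h₁]
  generalize (A.prog.send τ).map a = y
  revert y
  refine BL.ext_tmul fun i a => ?_
  simp only [Channel.rightComm_tmul, Channel.ampl_tmul, h, TC.add_tmul, map_add]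
  congr 1
  · generalize Φ₀.map _ = y
    revert y
    exact BL.ext_tmul fun o m => by simp
  · generalize Φ₁.map _ = y
    revert y
    exact BL.ext_tmul fun o m => by simp

theorem ampl_onSnd {n m n' m' : Type} (Φ : Channel n m) (Ψ : Channel n' m') :
    ∀ x, (Φ.ampl m').map ((Ψ.onSnd n).map x) = (Ψ.onSnd m).map ((Φ.ampl n').map x) :=
  BL.ext_tmul fun a b => by simp

theorem discardSnd_ampl {n m l : Type} (Φ : Channel n m) :
    ∀ x, (Channel.discardSnd m l).map ((Φ.ampl l).map x)
      = Φ.map ((Channel.discardSnd n l).map x) :=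
  BL.ext_tmul fun a b => by simp

theorem discardSnd_onSnd {n m l : Type} (Φ : Channel n m) :
    ∀ x, (Channel.discardSnd l m).map ((Φ.onSnd l).map x) = (Channel.discardSnd l n).map x :=
  BL.ext_tmul fun a b => by simp

variable {S S' : System I O}

theorem round_map (S : System I O) (τ : ℕ) (x : TC (A.Mem × S.Mem)) :
    (A.round S τ).map x = ((A.prog.recv τ).ampl S.Mem).map ((A.release S τ).map x) := rfl

theorem rounds_succ_map (S : System I O) (τ k : ℕ) (x : TC (A.Mem × S.Mem)) :
    (A.rounds S τ (k + 1)).map x = (A.round S (τ + k)).map ((A.rounds S τ k).map x) := rfl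

theorem rounds_add (S : System I O) (τ k k' : ℕ) (x : TC (A.Mem × S.Mem)) :
    (A.rounds S τ (k + k')).map x = (A.rounds S (τ + k) k').map ((A.rounds S τ k).map x) := by
  induction k' with
  | zero => rfl
  | succ k' ih => rw [← add_assoc, rounds_succ_map, rounds_succ_map, ih, add_assoc]

theorem rounds_succ_left (S : System I O) (τ k : ℕ) (x : TC (A.Mem × S.Mem)) :
    (A.rounds S τ (k + 1)).map x = (A.rounds S (τ + 1) k).map ((A.round S τ).map x) := by
  rw [add_comm, rounds_add]; rfl

/-- `S` with memory embedded by `e` behaves as `S'`. -/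
theorem rounds_sim {e : Channel S.Mem S'.Mem} (τ : ℕ) (k : ℕ)
    (h : ∀ τ', τ ≤ τ' → τ' < τ + k → ∀ i m, (S'.step τ').map (i ⊠ e.map m)
      = (e.onSnd O).map ((S.step τ').map (i ⊠ m))) (x : TC (A.Mem × S.Mem)) :
    (A.rounds S' τ k).map ((e.onSnd A.Mem).map x)
      = (e.onSnd A.Mem).map ((A.rounds S τ k).map x) := by
  induction k with
  | zero => rfl
  | succ k ih =>
    rw [rounds_succ_map, ih fun τ' h1 h2 => h τ' h1 (by omega), round_map, release_eq,
      A.releaseWith_map_onSnd _ (h (τ + k) (by omega) (by omega)), ampl_onSnd]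
    rfl

theorem round_absorb {e : Channel S.Mem S.Mem} (τ : ℕ)
    (h : ∀ i m, (S.step τ).map (i ⊠ e.map m) = (S.step τ).map (i ⊠ m)) (x : TC (A.Mem × S.Mem)) :
    (A.round S τ).map ((e.onSnd A.Mem).map x) = (A.round S τ).map x := by
  rw [round_map, release_eq, A.releaseWith_absorb τ h]; rfl

/-- It suffices that the first of the ticks ignores `e`, so at least one tick is required. -/
theorem rounds_absorb {e : Channel S.Mem S.Mem} (τ k : ℕ)
    (h : ∀ i m, (S.step τ).map (i ⊠ e.map m) = (S.step τ).map (i ⊠ m)) (x : TC (A.Mem × S.Mem)) :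
    (A.rounds S τ (k + 1)).map ((e.onSnd A.Mem).map x) = (A.rounds S τ (k + 1)).map x := by
  rw [rounds_succ_left, rounds_succ_left, A.round_absorb τ h]

/-- The systems are given by their fields, so that both evolutions act on the same type of memory
and can be compared without transport. -/
theorem rounds_congr {M : Type} {i i' : Channel Unit M} {s s' : ℕ → Channel (I × M) (O × M)}
    (τ k : ℕ) (h : ∀ τ', τ ≤ τ' → τ' < τ + k → ∀ i m, (s' τ').map (i ⊠ m) = (s τ').map (i ⊠ m))
    (x : TC (A.Mem × M)) :
    (A.rounds ⟨M, i', s'⟩ τ k).map x = (A.rounds ⟨M, i, s⟩ τ k).map x := by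
  induction k with
  | zero => rfl
  | succ k ih =>
    have := A.releaseWith_congr (τ + k) (h (τ + k) (by omega) (by omega))
      ((A.rounds ⟨M, i, s⟩ τ k).map x)
    rw [rounds_succ_map, ih fun τ' h1 h2 => h τ' h1 (by omega), round_map, release_eq, this]
    rfl

/-- While the output of the system does not depend on its memory, what the strategy holds can be
computed without the memory. -/
theorem exists_rounds_discard (τ k : ℕ)
    (h : ∀ τ', τ ≤ τ' → τ' < τ + k → ∃ Ω : Channel I O, ∀ i m,
      (Channel.discardSnd O S.Mem).map ((S.step τ').map (i ⊠ m)) = TC.trace m • Ω.map i) :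
    ∃ Λ : Channel A.Mem A.Mem, ∀ x, (Channel.discardSnd A.Mem S.Mem).map ((A.rounds S τ k).map x)
      = Λ.map ((Channel.discardSnd A.Mem S.Mem).map x) := by
  induction k with
  | zero => exact ⟨Channel.id _, fun x => rfl⟩
  | succ k ih =>
    obtain ⟨Λ, hΛ⟩ := ih fun τ' h1 h2 => h τ' h1 (by omega)
    obtain ⟨Ω, hΩ⟩ := h (τ + k) (by omega) (by omega)
    refine ⟨Λ.andThen (((A.prog.send (τ + k)).andThen (Ω.ampl A.Mem)).andThen
      (A.prog.recv (τ + k))), fun x => ?_⟩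
    rw [rounds_succ_map, round_map, discardSnd_ampl, release_eq, A.releaseWith_discard _ hΩ, hΛ]
    rfl

theorem stateAfter_map_one (S : System I O) (k : ℕ) : (A.stateAfter S k).map TC.one
    = (A.rounds S 0 k).map (A.init.map TC.one ⊠ S.init.map TC.one) := by
  simp [stateAfter]

end Strategy

/-- Two systems related by an embedding of the memories are indistinguishable. -/
theorem Distinguisher.prob_eq_of_sim {I O : Type} (D : Distinguisher I O) {S S' : System I O}
    (e : Channel S.Mem S'.Mem) (hinit : S'.init.map TC.one = e.map (S.init.map TC.one))
    (h : ∀ τ i m, (S'.step τ).map (i ⊠ e.map m) = (e.onSnd O).map ((S.step τ).map (i ⊠ m))) :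
    D.prob S' = D.prob S := by
  have h1 : (Channel.discardSnd D.Mem S'.Mem).map ((D.stateAfter S' D.ticks).map TC.one)
      = (Channel.discardSnd D.Mem S.Mem).map ((D.stateAfter S D.ticks).map TC.one) := by
    rw [Strategy.stateAfter_map_one, Strategy.stateAfter_map_one, hinit, ← Channel.onSnd_tmul,
      D.rounds_sim 0 _ (fun τ' _ _ => h τ'), Strategy.discardSnd_onSnd]
  exact congrArg (fun x => ((D.guess.map x).1 true true).re) h1

/-! ### Attached converters -/

section Attach
variable {I O I' O' J K M M' M₀ r : Type}

/-- The channel of a converter attached to the first interface of a system, during one tick. -/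
def attachStep (down : Channel (I × M) (I' × M)) (Φ : Channel ((I' × J) × r) ((O' × K) × r))
    (up : Channel (O' × M) (O × M)) : Channel ((I × J) × (M × r)) ((O × K) × (M × r)) :=
  Channel.interchange I J M r
    |>.andThen (down.ampl (J × r))
    |>.andThen (Channel.interchange I' M J r)
    |>.andThen (Channel.leftComm (I' × J) M r)
    |>.andThen (Φ.onSnd M)
    |>.andThen (Channel.leftComm M (O' × K) r)
    |>.andThen (Channel.interchange O' K M r)
    |>.andThen (up.ampl (K × r))
    |>.andThen (Channel.interchange O M K r)

/-- The inner system never sees the memory of the converter, so an embedding of that memory that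
both halves of the converter respect passes through the whole tick. -/
theorem attachStep_sim {down : Channel (I × M) (I' × M)}
    {Φ : Channel ((I' × J) × r) ((O' × K) × r)}
    {up : Channel (O' × M) (O × M)} {down' : Channel (I × M') (I' × M')}
    {up' : Channel (O' × M') (O × M')} {e : Channel M M'}
    (hd : ∀ i m, down'.map (i ⊠ e.map m) = (e.onSnd I').map (down.map (i ⊠ m)))
    (hu : ∀ o m, up'.map (o ⊠ e.map m) = (e.onSnd O).map (up.map (o ⊠ m))) (x : TC (I × J)) :
    ∀ y : TC (M × r), (attachStep down' Φ up').map (x ⊠ (e.ampl r).map y)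
      = ((e.ampl r).onSnd (O × K)).map ((attachStep down Φ up).map (x ⊠ y)) := by
  refine BL.ext_tmul fun m s => ?_
  revert x
  refine BL.ext_tmul fun i j => ?_
  simp only [attachStep, Channel.andThen_map, Channel.ampl_tmul, Channel.interchange_tmul, hd]
  generalize down.map (i ⊠ m) = x
  revert x
  refine BL.ext_tmul fun i m => ?_
  simp only [Channel.onSnd_tmul, Channel.interchange_tmul, Channel.leftComm_tmul]
  generalize Φ.map _ = x
  revert x
  refine BL.ext_tmul fun x s => ?_
  revert x
  refine BL.ext_tmul fun o k => ?_
  simp only [Channel.interchange_tmul, Channel.leftComm_tmul, Channel.ampl_tmul, hu]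
  generalize up.map _ = x
  revert x
  exact BL.ext_tmul fun o m => by simp

/-- The splitting happens in `down`. Once a branch is embedded in the memory, `up` only has to
respect each embedding, and linearity carries the sum through the tick. -/
theorem attachStep_add {down : Channel (I × M) (I' × M)}
    {Φ : Channel ((I' × J) × r) ((O' × K) × r)}
    {up : Channel (O' × M) (O × M)} {down₀ down₁ : Channel (I × M₀) (I' × M₀)}
    {up₀ up₁ : Channel (O' × M₀) (O × M₀)} {e₀ e₁ : Channel M₀ M} {m : TC M} {m₀ m₁ : TC M₀}
    (hd : ∀ i, down.map (i ⊠ m) = (e₀.onSnd I').map (down₀.map (i ⊠ m₀))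
      + (e₁.onSnd I').map (down₁.map (i ⊠ m₁)))
    (hu₀ : ∀ o m, up.map (o ⊠ e₀.map m) = (e₀.onSnd O).map (up₀.map (o ⊠ m)))
    (hu₁ : ∀ o m, up.map (o ⊠ e₁.map m) = (e₁.onSnd O).map (up₁.map (o ⊠ m))) (s : TC r) :
    ∀ x : TC (I × J), (attachStep down Φ up).map (x ⊠ (m ⊠ s))
      = ((e₀.ampl r).onSnd (O × K)).map ((attachStep down₀ Φ up₀).map (x ⊠ (m₀ ⊠ s)))
        + ((e₁.ampl r).onSnd (O × K)).map ((attachStep down₁ Φ up₁).map (x ⊠ (m₁ ⊠ s))) := by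
  refine BL.ext_tmul fun i j => ?_
  -- The part of the tick after `down`, for a single branch.
  have key : ∀ (e : Channel M₀ M) (up' : Channel (O' × M₀) (O × M₀)),
      (∀ o m, up.map (o ⊠ e.map m) = (e.onSnd O).map (up'.map (o ⊠ m))) →
      ∀ x : TC (I' × M₀), ((Channel.interchange I' M J r).andThen <|
          (Channel.leftComm (I' × J) M r).andThen <| (Φ.onSnd M).andThen <|
          (Channel.leftComm M (O' × K) r).andThen <| (Channel.interchange O' K M r).andThen <|
          (up.ampl (K × r)).andThen (Channel.interchange O M K r)).map
            ((e.onSnd I').map x ⊠ (j ⊠ s))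
        = ((e.ampl r).onSnd (O × K)).map (((Channel.interchange I' M₀ J r).andThen <|
          (Channel.leftComm (I' × J) M₀ r).andThen <| (Φ.onSnd M₀).andThen <|
          (Channel.leftComm M₀ (O' × K) r).andThen <| (Channel.interchange O' K M₀ r).andThen <|
          (up'.ampl (K × r)).andThen (Channel.interchange O M₀ K r)).map (x ⊠ (j ⊠ s))) := by
    intro e up' hu
    refine BL.ext_tmul fun i m => ?_
    simp only [Channel.andThen_map, Channel.onSnd_tmul, Channel.interchange_tmul,
      Channel.leftComm_tmul]
    generalize Φ.map _ = x
    revert x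
    refine BL.ext_tmul fun x s => ?_
    revert x
    refine BL.ext_tmul fun o k => ?_
    simp only [Channel.interchange_tmul, Channel.leftComm_tmul, Channel.ampl_tmul, hu]
    generalize up'.map _ = x
    revert x
    exact BL.ext_tmul fun o m => by simp
  have k₀ := key e₀ up₀ hu₀ (down₀.map (i ⊠ m₀))
  have k₁ := key e₁ up₁ hu₁ (down₁.map (i ⊠ m₁))
  simp only [Channel.andThen_map] at k₀ k₁
  simp only [attachStep, Channel.andThen_map, Channel.ampl_tmul, Channel.interchange_tmul, hd,
    TC.add_tmul, map_add]
  rw [k₀, k₁]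

/-- What the inner system forgets when used through the converter. -/
theorem attachStep_absorb {down : Channel (I × M) (I' × M)}
    {Φ : Channel ((I' × J) × r) ((O' × K) × r)}
    {up : Channel (O' × M) (O × M)} {e : Channel M M}
    (hd : ∀ i m, down.map (i ⊠ e.map m) = down.map (i ⊠ m)) (x : TC (I × J)) :
    ∀ y : TC (M × r), (attachStep down Φ up).map (x ⊠ (e.ampl r).map y)
      = (attachStep down Φ up).map (x ⊠ y) := by
  refine BL.ext_tmul fun m s => ?_
  revert x
  exact BL.ext_tmul fun i j => by simp [attachStep, hd]

/-- Every message that the converter sends inwards has passed through `c`, and on such messages the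
inner system ignores the change `e` of its memory. -/
theorem attachStep_absorb_inner {down : Channel (I × M) (I' × M)}
    {Φ : Channel ((I' × J) × r) ((O' × K) × r)}
    {up : Channel (O' × M) (O × M)} {e : Channel r r} {c : Channel I' I'}
    {d : Channel (I × M) (I' × M)}
    (hd : ∀ i m, down.map (i ⊠ m) = (c.ampl M).map (d.map (i ⊠ m)))
    (hΦ : ∀ h j s, Φ.map ((c.map h ⊠ j) ⊠ e.map s) = Φ.map ((c.map h ⊠ j) ⊠ s)) (x : TC (I × J)) :
    ∀ y : TC (M × r), (attachStep down Φ up).map (x ⊠ (e.onSnd M).map y)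
      = (attachStep down Φ up).map (x ⊠ y) := by
  refine BL.ext_tmul fun m s => ?_
  revert x
  refine BL.ext_tmul fun i j => ?_
  simp only [attachStep, Channel.andThen_map, Channel.ampl_tmul, Channel.interchange_tmul,
    Channel.onSnd_tmul, hd]
  generalize d.map _ = x
  revert x
  exact BL.ext_tmul fun i m => by simp [hΦ]

end Attach

/-! ### Processing the keys that a system outputs -/

/-- `S` with `G τ` applied to the first output at tick `τ`. -/
def System.post {I O K : Type} (S : System I (O × K)) (G : ℕ → Channel O O) : System I (O × K) where
  Mem := S.Mem
  init := S.init
  step τ := (S.step τ).andThen (((G τ).ampl K).ampl S.Mem)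

/-- The length of the key of Alice. -/
def keyLength : Channel KeyOut ℕ := Channel.classical fun k => PMF.pure (k.1.elim 0 List.length)

open Classical in
/-- What the ideal resource does at tick `τ`. -/
def idealStep {N : ℕ} (t : Fin N → ℕ) (τ : ℕ) : Channel (Unit × ℕ) (KeyOut × Unit) :=
  Channel.classical fun p =>
    (if ∃ j, t j = τ then perfectKeys p.2 else PMF.pure (none, none)).map fun k => (k, ())

/-- Replaces keys by those that the ideal resource outputs at tick `τ`. -/
def idealKeys {N : ℕ} (t : Fin N → ℕ) (τ : ℕ) : Channel KeyOut KeyOut :=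
  keyLength.andThen <| (Channel.adjoin ℕ (Channel.id Unit)).andThen <|
    (idealStep t τ).andThen (Channel.discardSnd KeyOut Unit)

/-- The simulator runs `S`, passes the length of the keys of `S` to the ideal resource, and keeps
the message for the adversary until the ideal resource has answered. -/
def simulator {J K : Type} (S : System (Unit × J) (KeyOut × K)) (k₀ : K) :
    Converter J K ℕ Unit where
  Mem := K × S.Mem
  init := S.init.andThen (Channel.adjoin S.Mem (Channel.value k₀))
  down τ := ((Channel.discardFst K S.Mem).onSnd J)
    |>.andThen ((Channel.adjoin J (Channel.id Unit)).ampl S.Mem)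
    |>.andThen (S.step τ)
    |>.andThen (Channel.assoc KeyOut K S.Mem)
    |>.andThen (keyLength.ampl (K × S.Mem))
  up _ := (Channel.discardFst Unit (K × S.Mem)).andThen
    ((Channel.adjoin S.Mem (Channel.value k₀)).onSnd K)

/-- A trivial register carries only a scalar, which the partial trace moves into the other factor.
-/
theorem tmul_one_discardSnd {n : Type} :
    ∀ x : TC (n × Unit), x = (Channel.discardSnd n Unit).map x ⊠ TC.one := by
  refine BL.ext_tmul fun a u => ?_
  revert u
  exact BL.ext_one (by simp)

/-- The memory of `S` as a part of the memory of the simulator together with the ideal resource. -/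
def simulatorMem {K : Type} (M : Type) (k₀ : K) : Channel M ((K × M) × Unit) :=
  (Channel.adjoin M (Channel.value k₀)).andThen <|
    (Channel.adjoin (K × M) (Channel.id Unit)).andThen (Channel.swap Unit (K × M))

@[simp] theorem simulatorMem_map {K M : Type} (k₀ : K) (m : TC M) :
    (simulatorMem M k₀).map m = (TC.basis k₀ ⊠ m) ⊠ TC.one := by simp [simulatorMem]

/-- The buffer for the adversary's message holds `k₀` again at the end of each tick, so the memory
keeps the form `simulatorMem`. During the tick the message waits there while the key length makes
its way through the ideal resource. -/
theorem simulator_step_aux {N : ℕ} (t : Fin N → ℕ) (τ : ℕ) {J K M : Type}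
    (Φ : Channel ((Unit × J) × M) ((KeyOut × K) × M)) (k₀ : K) (x : TC (Unit × J)) (m : TC M) :
    ((Channel.ofEquiv (Equiv.prodComm K KeyOut)).ampl ((K × M) × Unit)).map
      ((attachStep (((Channel.discardFst K M).onSnd J)
          |>.andThen ((Channel.adjoin J (Channel.id Unit)).ampl M)
          |>.andThen Φ
          |>.andThen (Channel.assoc KeyOut K M)
          |>.andThen (keyLength.ampl (K × M)))
        ((((Channel.ofEquiv (Equiv.prodComm ℕ Unit)).ampl Unit).andThen
          ((idealStep t τ).ampl Unit)).andThen
            ((Channel.ofEquiv (Equiv.prodComm Unit KeyOut).symm).ampl Unit))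
        ((Channel.discardFst Unit (K × M)).andThen
          ((Channel.adjoin M (Channel.value k₀)).onSnd K))).map
        (((Channel.ofEquiv (Equiv.prodComm Unit J)).ampl ((K × M) × Unit)).map
          (x ⊠ (simulatorMem M k₀).map m)))
      = ((simulatorMem M k₀).onSnd (KeyOut × K)).map
          ((((idealKeys t τ).ampl K).ampl M).map (Φ.map (x ⊠ m))) := by
  revert x
  refine BL.ext_tmul fun u j => ?_
  revert u
  refine BL.ext_one ?_
  simp only [attachStep, Channel.andThen_map, Channel.ampl_tmul, Channel.interchange_tmul,
    Channel.ofEquiv_prodComm_tmul, Channel.onSnd_tmul, Channel.discardFst_tmul, TC.trace_basis,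
    one_smul, Channel.adjoin_map, Channel.id_map, simulatorMem_map]
  generalize Φ.map _ = y
  revert y
  refine BL.ext_tmul fun y m => ?_
  revert y
  refine BL.ext_tmul fun κ k => ?_
  simp only [Channel.assoc_tmul, Channel.ampl_tmul, Channel.interchange_tmul,
    Channel.leftComm_tmul, Channel.onSnd_tmul, Channel.andThen_map,
    Channel.ofEquiv_prodComm_tmul]
  -- The output of the ideal resource to the adversary is trivial, so its answer factorises.
  have e : (idealStep t τ).map (TC.one ⊠ keyLength.map κ) = (idealKeys t τ).map κ ⊠ TC.one := by
    rw [tmul_one_discardSnd ((idealStep t τ).map _)]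
    simp [idealKeys]
  rw [e]
  simp

/-- `simulatorMem` intertwines the two systems at every tick. The value `k₀` only fills an empty
buffer. -/
theorem simulator_prob {N : ℕ} (t : Fin N → ℕ) {J K : Type} (S : System (Unit × J) (KeyOut × K))
    (k₀ : K) (D : Distinguisher (Unit × J) (KeyOut × K)) :
    D.prob ((simulator S k₀).attachSnd (Rideal t)) = D.prob (S.post (idealKeys t)) := by
  refine D.prob_eq_of_sim (S := S.post (idealKeys t)) (simulatorMem S.Mem k₀) ?_ ?_
  · change ((Channel.ofEquiv (Equiv.punitProd Unit).symm).andThen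
      ((S.init.andThen (Channel.adjoin S.Mem (Channel.value k₀))).prod
        (Channel.id Unit))).map TC.one = (simulatorMem S.Mem k₀).map (S.init.map TC.one)
    simp
  · exact fun τ i m => simulator_step_aux t τ (S.step τ) k₀ i m

/-! ### Classical registers -/

namespace TC
variable {n m : Type}

@[simp] theorem zero_tmul (b : TC m) : (0 : TC n) ⊠ b = 0 :=
  ext_apply fun p q => by simp [tmul_apply]

theorem one_eq_basis : one = basis () := by
  rw [← Channel.value_map_one ()]
  exact ext_apply fun p q => by
    rw [Channel.value_map_one]; simp [one, basis_apply_self]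

@[simp] theorem basis_true_true : (basis true).1 true true = 1 := basis_apply_self _
@[simp] theorem basis_false_false : (basis false).1 false false = 1 := basis_apply_self _
@[simp] theorem basis_true_false : (basis true).1 false false = 0 := basis_apply_ne _ (by simp)
@[simp] theorem basis_false_true : (basis false).1 true true = 0 := basis_apply_ne _ (by simp)
@[simp] theorem basis_none_none : (basis (none : Option n)).1 none none = 1 := basis_apply_self _

@[simp] theorem compress_some_basis_none :
    Channel.compress some (Option.some_injective n) (basis none) = 0 :=
  ext_apply fun i j => basis_apply_ne (a := (none : Option n)) (some j) (Option.some_ne_none i)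

end TC

theorem dist_map_unit {n : Type} (p : PMF n) : dist (p.map fun k => (k, ())) = dist p ⊠ TC.one :=
  TC.ext_apply fun a b => by
    obtain ⟨a, ⟨⟩⟩ := a
    obtain ⟨b, ⟨⟩⟩ := b
    by_cases h : a = b
    · subst h
      classical
      rw [dist_apply_self, TC.tmul_apply, dist_apply_self, PMF.map_apply, tsum_eq_single a]
      · simp [TC.one]
      · intro c hc
        simp [Ne.symm hc]
    · rw [TC.tmul_apply, dist_apply_ne _ h, dist_apply_ne _ (by simpa using h), zero_mul]

/-! ### Replacement of keys -/

section Keys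
variable {N : ℕ} (t : Fin N → ℕ) (τ : ℕ)

open Classical in
theorem idealKeys_basis (k : KeyOut) : (idealKeys t τ).map (TC.basis k)
    = dist (if ∃ j, t j = τ then perfectKeys (k.1.elim 0 List.length)
        else PMF.pure (none, none)) := by
  simp only [idealKeys, keyLength, idealStep, Channel.andThen_map, Channel.classical_basis,
    dist_pure, Channel.adjoin_map, Channel.id_map]
  rw [TC.one_eq_basis, ← TC.basis_prod, Channel.classical_basis, dist_map_unit,
    Channel.discardSnd_tmul, TC.trace_one, one_smul]

theorem idealKeys_basis_of_ne (h : ∀ j, t j ≠ τ) (k : KeyOut) :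
    (idealKeys t τ).map (TC.basis k) = TC.basis (none, none) := by
  rw [idealKeys_basis, if_neg (by simpa using h), dist_pure]

theorem idealKeys_basis_of_eq (j : Fin N) (k : KeyOut) :
    (idealKeys t (t j)).map (TC.basis k) = dist (perfectKeys (k.1.elim 0 List.length)) := by
  rw [idealKeys_basis, if_pos ⟨j, rfl⟩]

/-- There is a single bit string of length zero; therefore the output after rejection is already
ideal. -/
theorem perfectKeys_zero : perfectKeys 0 = PMF.pure (some [], some []) := by
  have : (fun k : Fin 0 → Bool => ((some (List.ofFn k), some (List.ofFn k)) : KeyOut))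
      = Function.const _ (some [], some []) := by
    funext k; simp
  rw [perfectKeys, this, PMF.map_const]

/-- The two replacements differ only when Alice outputs no key at all, which cannot happen on pairs
of actual keys; these are classical, so basis states suffice. -/
theorem idealKeys_classical (j : Fin N) (x : TC (Key × Key)) :
    (idealKeys t (t j)).map ((Channel.classical fun k : Key × Key =>
        PMF.pure ((some k.1, some k.2) : KeyOut)).map x)
      = replaceKeys.map ((Channel.classical fun k : Key × Key =>
        PMF.pure ((some k.1, some k.2) : KeyOut)).map x) :=
  BL.ext_classical (f := (idealKeys t (t j)).map) (g := replaceKeys.map)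
    (fun k : Key × Key => ((some k.1, some k.2) : KeyOut)) (fun k => by
      rw [idealKeys_basis_of_eq, replaceKeys, Channel.classical_basis]
      rfl) x

end Keys

/-! ### Post-processing through an attached converter -/

section Post
variable {I O I' O' J K M r : Type}

/-- The first output is produced by `up` at the very end of the tick, so processing it amounts to
changing `up`. -/
theorem attachStep_post {down : Channel (I × M) (I' × M)}
    {Φ : Channel ((I' × J) × r) ((O' × K) × r)}
    {up up' : Channel (O' × M) (O × M)} {G : Channel O O}
    (h : ∀ o m, (G.ampl M).map (up.map (o ⊠ m)) = up'.map (o ⊠ m)) :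
    ∀ x, ((G.ampl K).ampl (M × r)).map ((attachStep down Φ up).map x)
      = (attachStep down Φ up').map x := by
  refine BL.ext_tmul fun x y => ?_
  revert x
  refine BL.ext_tmul fun i j => ?_
  revert y
  refine BL.ext_tmul fun m s => ?_
  simp only [attachStep, Channel.andThen_map, Channel.ampl_tmul, Channel.interchange_tmul]
  generalize down.map (i ⊠ m) = x
  revert x
  refine BL.ext_tmul fun i m => ?_
  simp only [Channel.onSnd_tmul, Channel.interchange_tmul, Channel.leftComm_tmul]
  generalize Φ.map _ = x
  revert x
  refine BL.ext_tmul fun x s => ?_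
  revert x
  refine BL.ext_tmul fun o k => ?_
  simp only [Channel.interchange_tmul, Channel.leftComm_tmul, Channel.ampl_tmul, ← h]
  generalize up.map _ = x
  revert x
  exact BL.ext_tmul fun o m => by simp

end Post

/-! ### The starting resources -/

section RiniStep
variable {X Y Z Q C P M : Type}

/-- What the starting resources do during a tick, given what the devices do. -/
def RiniStep (C : Type) (Φ : Channel ((Bool × Option X) × P) (Signal Q × P))
    (Ψ : Channel (((Bool × Option Y) × Signal Q) × M) (Option Z × M)) :
    Channel (((AliceIn X Q C × BobIn Y Q C) × EveIn Q) × ((P × M) × (Unit × Unit)))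
      (((AliceOut Q C × BobOut Z Q C) × EveOut Q C) × ((P × M) × (Unit × Unit))) :=
  (((Channel.ofEquiv inputEquiv).ampl _).andThen
    (((Channel.interchange _ _ _ _).andThen
      ((((Channel.interchange _ _ P M).andThen (Φ.prod Ψ)).andThen
          (Channel.interchange _ _ _ _)).prod
        (((Channel.interchange (Signal Q × Signal Q) (Option C × Option C) Unit Unit).andThen
          (((Channel.swap (Signal Q) (Signal Q)).ampl Unit).prod
            ((Channel.classical fun m : Option C × Option C => PMF.pure ((m.2, m.1), m)).ampl
              Unit))).andThen
          (Channel.interchange _ _ _ _)))).andThen (Channel.interchange _ _ _ _))).andThen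
    ((Channel.ofEquiv outputEquiv).ampl _)

theorem inputEquiv_tmul (a : TC (Bool × Option X)) (b : TC (Signal Q)) (c : TC (Option C))
    (a' : TC (Bool × Option Y)) (b' : TC (Signal Q)) (c' : TC (Option C)) (e : TC (EveIn Q)) :
    (Channel.ofEquiv inputEquiv).map (((a ⊠ (b ⊠ c)) ⊠ ((a' ⊠ b') ⊠ c')) ⊠ e)
      = (a ⊠ (a' ⊠ b')) ⊠ ((b ⊠ e) ⊠ (c ⊠ c')) :=
  TC.ext_apply fun p q => by
    simp only [Channel.ofEquiv_apply, inputEquiv, TC.tmul_apply, Equiv.coe_fn_symm_mk]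
    ring

theorem outputEquiv_tmul (a : TC (Signal Q)) (z : TC (Option Z)) (b b' : TC (Signal Q))
    (c₁ c₂ c₃ c₄ : TC (Option C)) :
    (Channel.ofEquiv outputEquiv).map ((a ⊠ z) ⊠ ((b ⊠ b') ⊠ ((c₁ ⊠ c₂) ⊠ (c₃ ⊠ c₄))))
      = ((a ⊠ c₁) ⊠ (z ⊠ (b ⊠ c₂))) ⊠ (b' ⊠ (c₃ ⊠ c₄)) :=
  TC.ext_apply fun p q => by
    simp only [Channel.ofEquiv_apply, outputEquiv, TC.tmul_apply, Equiv.coe_fn_symm_mk]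
    ring

/-- Setting the bits that tell both devices to clear their memories. -/
def clearBits (X Y Q C : Type) :
    Channel (AliceIn X Q C × BobIn Y Q C) (AliceIn X Q C × BobIn Y Q C) :=
  (((Channel.reset Bool (Channel.value true)).ampl (Option X)).ampl (Signal Q × Option C)).prod
    ((((Channel.reset Bool (Channel.value true)).ampl (Option Y)).ampl (Signal Q)).ampl (Option C))

/-- With both bits set, each device depends on its old memory only through the trace, and the two
channels have trivial memories; hence the whole memory may be replaced by a fixed state beforehand.
-/
theorem RiniStep_clear {Φ : Channel ((Bool × Option X) × P) (Signal Q × P)}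
    {Ψ : Channel (((Bool × Option Y) × Signal Q) × M) (Option Z × M)} {p₀ : Channel Unit P}
    {m₀ : Channel Unit M}
    (hΦ : ∀ x p, Φ.map ((TC.basis true ⊠ x) ⊠ p)
      = TC.trace p • Φ.map ((TC.basis true ⊠ x) ⊠ p₀.map TC.one))
    (hΨ : ∀ x s m, Ψ.map (((TC.basis true ⊠ x) ⊠ s) ⊠ m)
      = TC.trace m • Ψ.map (((TC.basis true ⊠ x) ⊠ s) ⊠ m₀.map TC.one))
    {σ : Channel Unit ((P × M) × (Unit × Unit))}
    (hσ : σ.map TC.one = (p₀.map TC.one ⊠ m₀.map TC.one) ⊠ (TC.one ⊠ TC.one))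
    (h : TC (AliceIn X Q C × BobIn Y Q C)) (e : TC (EveIn Q)) :
    ∀ s, (RiniStep C Φ Ψ).map (((clearBits X Y Q C).map h ⊠ e) ⊠ (Channel.reset _ σ).map s)
      = (RiniStep C Φ Ψ).map (((clearBits X Y Q C).map h ⊠ e) ⊠ s) := by
  refine BL.ext_tmul fun s u => ?_
  revert s
  refine BL.ext_tmul fun p m => ?_
  revert u
  refine BL.ext_tmul fun u v => ?_
  revert u
  refine BL.ext_one ?_
  revert v
  refine BL.ext_one ?_
  revert h
  refine BL.ext_tmul fun a b => ?_
  revert a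
  refine BL.ext_tmul fun a c => ?_
  revert a
  refine BL.ext_tmul fun f x => ?_
  revert c
  refine BL.ext_tmul fun s c => ?_
  revert b
  refine BL.ext_tmul fun b c' => ?_
  revert b
  refine BL.ext_tmul fun b s' => ?_
  revert b
  refine BL.ext_tmul fun f' y => ?_
  simp only [RiniStep, clearBits, Channel.andThen_map, Channel.prod_tmul, Channel.ampl_tmul,
    Channel.reset_map, Channel.value_map_one, TC.smul_tmul, TC.tmul_smul, map_smul, hσ,
    inputEquiv_tmul, Channel.interchange_tmul, TC.trace_tmul, TC.trace_one, mul_one]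
  rw [hΦ x p, hΨ y s' m]
  simp only [TC.smul_tmul, TC.tmul_smul, map_smul, smul_smul]
  congr 1
  ring

theorem basis_idle : TC.basis ((((false, none), (none, none)), (((false, none), none), none)) :
      AliceIn X Q C × BobIn Y Q C)
    = ((TC.basis false ⊠ TC.basis none) ⊠ (TC.basis none ⊠ TC.basis none))
      ⊠ (((TC.basis false ⊠ TC.basis none) ⊠ TC.basis none) ⊠ TC.basis none) := by
  simp only [TC.basis_prod]

/-- If the devices are not used then Eve learns nothing. -/
theorem RiniStep_idle {Φ : Channel ((Bool × Option X) × P) (Signal Q × P)}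
    {Ψ : Channel (((Bool × Option Y) × Signal Q) × M) (Option Z × M)} {φ : Channel P P}
    {ψ : Channel M M}
    (hΦ : ∀ p, Φ.map ((TC.basis false ⊠ TC.basis none) ⊠ p) = TC.basis none ⊠ φ.map p)
    (hΨ : ∀ s m, Ψ.map (((TC.basis false ⊠ TC.basis none) ⊠ s) ⊠ m)
      = TC.trace s • (TC.basis none ⊠ ψ.map m)) (e : TC (EveIn Q)) :
    ∀ s, (Channel.discardSnd (EveOut Q C) ((P × M) × (Unit × Unit))).map
      ((Channel.discardFst (AliceOut Q C × BobOut Z Q C) _).map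
        ((Channel.assoc _ _ _).map ((RiniStep C Φ Ψ).map ((TC.basis
          (((false, none), (none, none)), (((false, none), none), none)) ⊠ e) ⊠ s))))
      = (TC.trace e * TC.trace s) • TC.basis (none, (none, none)) := by
  intro s
  -- The right-hand side becomes the trace of `s` times a fixed operator, a form that instance
  -- search recognises as bounded in `s`.
  rw [mul_comm, mul_smul]
  revert s
  refine BL.ext_tmul fun s u => ?_
  revert s
  refine BL.ext_tmul fun p m => ?_
  revert u
  refine BL.ext_tmul fun u v => ?_
  revert u
  refine BL.ext_one ?_
  revert v
  refine BL.ext_one ?_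
  have hc : (Channel.classical fun m : Option C × Option C => PMF.pure ((m.2, m.1), m)).map
      (TC.basis none ⊠ TC.basis none)
      = (TC.basis none ⊠ TC.basis none) ⊠ (TC.basis none ⊠ TC.basis none) := by
    rw [← TC.basis_prod, Channel.classical_basis, dist_pure, TC.basis_prod, TC.basis_prod]
  simp only [RiniStep, basis_idle, Channel.andThen_map, Channel.ampl_tmul,
    inputEquiv_tmul, Channel.interchange_tmul, Channel.prod_tmul, hΦ, hΨ, hc, Channel.swap_tmul,
    TC.smul_tmul, TC.tmul_smul, map_smul, outputEquiv_tmul]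
  simp only [Channel.assoc_tmul, Channel.discardFst_tmul, Channel.discardSnd_tmul, map_smul,
    TC.trace_tmul, TC.trace_basis, TC.trace_one, Channel.trace_map, TC.basis_prod, mul_one,
    smul_smul]
  congr 1
  ring

/-- The old memory is erased before anything else happens, and only its trace survives. The initial
state serves as a reference; any other state would do. -/
theorem PrepDevice.step_clear (D : PrepDevice X Q) (τ : ℕ) (x : TC (Option X)) (p : TC D.Mem) :
    (D.system.step τ).map ((TC.basis true ⊠ x) ⊠ p)
      = TC.trace p • (D.system.step τ).map ((TC.basis true ⊠ x) ⊠ D.init.map TC.one) := by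
  have key : ∀ p : TC D.Mem, (D.system.step τ).map ((TC.basis true ⊠ x) ⊠ p)
      = TC.trace p • (Channel.ifSome
        ((D.idle τ).andThen (Channel.adjoin D.Mem (Channel.value none)))
        (((Channel.measure X).ampl D.Mem).andThen (D.use τ))).map
          (x ⊠ (D.cleared τ).map TC.one) := by
    intro p
    rw [← map_smul, ← TC.tmul_smul]
    unfold PrepDevice.system
    simp only [Channel.andThen_map, Channel.ampl_tmul, Channel.swap_tmul, Channel.assoc_tmul,
      Channel.onSnd_tmul, Channel.ifBit_tmul, TC.basis_true_true, TC.basis_true_false, zero_smul,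
      zero_add, one_smul, Channel.reset_map]
  rw [key p, key (D.init.map TC.one), Channel.trace_map, TC.trace_one, one_smul]
  rfl

theorem PrepDevice.step_idle (D : PrepDevice X Q) (τ : ℕ) (p : TC D.Mem) :
    (D.system.step τ).map ((TC.basis false ⊠ TC.basis none) ⊠ p)
      = TC.basis none ⊠ (D.idle τ).map p := by
  unfold PrepDevice.system
  simp

theorem MeasDevice.step_clear (D : MeasDevice Y Q Z) (τ : ℕ) (y : TC (Option Y))
    (s : TC (Signal Q)) (p : TC D.Mem) :
    (D.system.step τ).map (((TC.basis true ⊠ y) ⊠ s) ⊠ p)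
      = TC.trace p • (D.system.step τ).map (((TC.basis true ⊠ y) ⊠ s) ⊠ D.init.map TC.one) := by
  have key : ∀ p : TC D.Mem, (D.system.step τ).map (((TC.basis true ⊠ y) ⊠ s) ⊠ p)
      = TC.trace p • (Channel.ifSome
        ((Channel.discardFst (Signal Q) D.Mem).andThen
          ((D.idle τ).andThen (Channel.adjoin D.Mem (Channel.value none))))
        (((Channel.measure Y).ampl (Signal Q × D.Mem)).andThen
          ((D.use τ).andThen ((Channel.classical fun z => PMF.pure (some z)).ampl D.Mem)))).map
          (y ⊠ (s ⊠ (D.cleared τ).map TC.one)) := by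
    intro p
    rw [← map_smul, ← TC.tmul_smul, ← TC.tmul_smul]
    unfold MeasDevice.system
    simp only [Channel.andThen_map, Channel.ampl_tmul, Channel.swap_tmul, Channel.assoc_tmul,
      Channel.rightComm_tmul,
      Channel.onSnd_tmul, Channel.ifBit_tmul, TC.basis_true_true, TC.basis_true_false, zero_smul,
      zero_add, one_smul, Channel.reset_map]
  rw [key p, key (D.init.map TC.one), Channel.trace_map, TC.trace_one, one_smul]
  rfl

theorem MeasDevice.step_idle (D : MeasDevice Y Q Z) (τ : ℕ) (s : TC (Signal Q)) (p : TC D.Mem) :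
    (D.system.step τ).map (((TC.basis false ⊠ TC.basis none) ⊠ s) ⊠ p)
      = TC.trace s • (TC.basis none ⊠ (D.idle τ).map p) := by
  unfold MeasDevice.system
  simp

theorem Rini_init (D : DeviceModel X Y Z Q) : (Rini C D).init.map TC.one
    = (D.prep.init.map TC.one ⊠ D.meas.init.map TC.one) ⊠ (TC.one ⊠ TC.one) := by
  change ((Channel.ofEquiv (Equiv.punitProd Unit).symm).andThen
    (((Channel.ofEquiv (Equiv.punitProd Unit).symm).andThen (D.prep.init.prod D.meas.init)).prod
      ((Channel.ofEquiv (Equiv.punitProd Unit).symm).andThen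
        ((Channel.id Unit).prod (Channel.id Unit))))).map TC.one = _
  simp

end RiniStep

/-! ### The two branches of the protocol -/

/-- Measures the bit that `c` produces: the part of the result for the outcome `b`. -/
def branch {n m : Type} (c : Channel n (Bool × m)) (b : Bool) (x : TC n) : TC m :=
  Channel.compress (Prod.mk b) (Prod.mk_right_injective b) (c.map x)

section branch
variable {n m : Type} (c : Channel n (Bool × m)) (b : Bool)

instance BL.branch : BL (branch c b) := BL.compress _ _

instance BL.branch_comp {k : Type} (f : TC k → TC n) [BL f] : BL (fun x => AC.branch c b (f x)) :=
  BL.compress _ fun x => c.map (f x)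

theorem compress_mk_tmul (β : TC Bool) (y : TC m) :
    Channel.compress (Prod.mk b) (Prod.mk_right_injective b) (β ⊠ y) = β.1 b b • y := rfl

theorem branch_posSemidef {x : TC n} (hx : x.1.PosSemidef) : (branch c b x).1.PosSemidef :=
  (c.map_posSemidef hx).submatrix _

theorem trace_compress_mk (x : TC (Bool × m)) :
    TC.trace (Channel.compress (Prod.mk b) (Prod.mk_right_injective b) x)
      = ((Channel.discardSnd Bool m).map x).1 b b := by
  -- Both scalars are multiplied by the unit of the trivial register, so that the identity is one
  -- between bounded maps and `BL.ext_tmul` applies.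
  have key : ∀ x : TC (Bool × m),
      TC.trace (Channel.compress (Prod.mk b) (Prod.mk_right_injective b) x) • TC.one
        = ((Channel.discardSnd Bool m).map x).1 b b • TC.one := by
    refine BL.ext_tmul fun β y => ?_
    rw [compress_mk_tmul, Channel.discardSnd_tmul, map_smul, smul_eq_mul]
    congr 1
    exact mul_comm _ _
  simpa using congrArg TC.trace (key x)

theorem trace_branch (x : TC n) :
    TC.trace (branch c b x) = ((Channel.discardSnd Bool m).map (c.map x)).1 b b :=
  trace_compress_mk b _

end branch

namespace Protocol
variable {N : ℕ} {X Y Z Q C : Type} (π : Protocol N X Y Z Q C) (t : Fin N → ℕ)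

/-- The memory of the protocol. -/
abbrev ProtMem : Type := π.CertMem × (Bool × π.Local)

/-- What Alice and Bob send after the decision `b`. -/
def branchDown (b : Bool) (τ : ℕ) : Channel (Unit × π.Local) (π.HIn × π.Local) :=
  (Channel.discardFst Unit π.Local).andThen
    (cond b (π.qkdDown t τ) (Channel.adjoin π.Local π.idleIn))

/-- What Alice and Bob do with the received messages after the decision `b`. -/
def branchUp (b : Bool) (τ : ℕ) : Channel (π.HOut × π.Local) (KeyOut × π.Local) :=
  cond b (π.qkdUp t τ)
    ((Channel.discardFst π.HOut π.Local).andThen (Channel.adjoin π.Local (rejectOut t τ)))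

/-- The protocol after the decision `b`. -/
def branchConverter (b : Bool) : Converter Unit KeyOut π.HIn π.HOut where
  Mem := π.Local
  init := π.fresh
  down := π.branchDown t b
  up := π.branchUp t b

/-- `(π.converter t).down`. -/
def converterDown (τ : ℕ) : Channel (Unit × π.ProtMem) (π.HIn × π.ProtMem) :=
  (π.converter t).down τ

/-- `(π.converter t).up`. -/
def converterUp (τ : ℕ) : Channel (π.HOut × π.ProtMem) (KeyOut × π.ProtMem) :=
  (π.converter t).up τ

/-- Adds the decision `b` and a fresh memory of the certification procedure. -/
def embed (b : Bool) : Channel π.Local (π.CertMem × (Bool × π.Local)) :=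
  (Channel.adjoin π.Local (Channel.value b)).andThen (Channel.adjoin (Bool × π.Local) π.certInit)

@[simp] theorem embed_map (b : Bool) (l : TC π.Local) :
    (π.embed b).map l = π.certInit.map TC.one ⊠ (TC.basis b ⊠ l) := by simp [embed]

/-- Makes the decision, which it puts in the first register. -/
def decideFst : Channel (π.CertMem × (Bool × π.Local)) (Bool × π.Local) :=
  (Channel.unassoc π.CertMem Bool π.Local).andThen
    (((Channel.discardSnd π.CertMem Bool).andThen π.decide).ampl π.Local)

section controlled
variable {n m l : Type} (Φ₀ Φ₁ : Channel n (m × l))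

theorem controlled_tmul (β : TC Bool) (x : TC n) : (controlled Φ₀ Φ₁).map (β ⊠ x)
    = β.1 false false • (((Channel.adjoin l (Channel.value false)).onSnd m).map (Φ₀.map x))
      + β.1 true true • (((Channel.adjoin l (Channel.value true)).onSnd m).map (Φ₁.map x)) := by
  simp only [controlled, Channel.ifBit_tmul, Channel.andThen_map]

theorem leftComm_embed {k : Type} (b : Bool) : ∀ x : TC (k × π.Local),
    (Channel.leftComm π.CertMem k (Bool × π.Local)).map (π.certInit.map TC.one ⊠
      ((Channel.adjoin π.Local (Channel.value b)).onSnd k).map x) = ((π.embed b).onSnd k).map x :=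
  BL.ext_tmul fun a l => by simp

end controlled

/-- The stored bit is a basis state, so the controlled operation selects one branch. The tick
`certTicks` is excluded, since the decision is made there on the way down. -/
theorem converterDown_embed {τ : ℕ} (hτ : π.certTicks < τ) (b : Bool) (u : TC Unit)
    (l : TC π.Local) : (π.converterDown t τ).map (u ⊠ (π.embed b).map l)
      = ((π.embed b).onSnd π.HIn).map ((π.branchDown t b τ).map (u ⊠ l)) := by
  have h : π.converterDown t τ = (Channel.discardFst Unit _).andThen
      (((Channel.id _).andThen ((controlled (Channel.adjoin π.Local π.idleIn)
        (π.qkdDown t τ)).onSnd π.CertMem)).andThen (Channel.leftComm π.CertMem π.HIn _)) := by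
    simp only [converterDown, converter, if_neg hτ.not_gt, if_neg hτ.ne']
  rw [h, branchDown]
  simp only [Channel.andThen_map, embed_map, Channel.discardFst_tmul, Channel.id_map, map_smul,
    Channel.onSnd_tmul, controlled_tmul]
  cases b
  · simp only [TC.basis_false_false, TC.basis_false_true, zero_smul, one_smul, add_zero,
      leftComm_embed, cond_false]
  · simp only [TC.basis_true_false, TC.basis_true_true, zero_smul, one_smul, zero_add,
      leftComm_embed, cond_true]

/-- Here the tick `certTicks` is included: when the answers arrive the decision has been made. -/
theorem converterUp_embed {τ : ℕ} (hτ : π.certTicks ≤ τ) (b : Bool) (o : TC π.HOut)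
    (l : TC π.Local) : (π.converterUp t τ).map (o ⊠ (π.embed b).map l)
      = ((π.embed b).onSnd KeyOut).map ((π.branchUp t b τ).map (o ⊠ l)) := by
  have h : π.converterUp t τ = (((Channel.leftComm π.HOut π.CertMem (Bool × π.Local)).andThen
      ((Channel.leftComm π.HOut Bool π.Local).onSnd π.CertMem)).andThen
      ((controlled ((Channel.discardFst π.HOut π.Local).andThen
        (Channel.adjoin π.Local (rejectOut t τ))) (π.qkdUp t τ)).onSnd π.CertMem)).andThen
      (Channel.leftComm π.CertMem KeyOut _) := by
    simp only [converterUp, converter, if_neg hτ.not_gt]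
  rw [h, branchUp]
  simp only [Channel.andThen_map, embed_map, Channel.leftComm_tmul, Channel.onSnd_tmul,
    controlled_tmul]
  cases b
  · simp only [TC.basis_false_false, TC.basis_false_true, zero_smul, one_smul, add_zero,
      leftComm_embed, cond_false, Channel.andThen_map]
  · simp only [TC.basis_true_false, TC.basis_true_true, zero_smul, one_smul, zero_add,
      leftComm_embed, cond_true]

/-- The decision overwrites the stored bit and refreshes the certification memory, and the
controlled operation measures the bit. There are no cross terms, and each outcome leaves an embedded
branch. -/
theorem converterDown_decide (u : TC Unit) :
    ∀ m : TC π.ProtMem, (π.converterDown t π.certTicks).map (u ⊠ m)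
      = ((π.embed false).onSnd π.HIn).map
          ((π.branchDown t false π.certTicks).map (u ⊠ branch π.decideFst false m))
        + ((π.embed true).onSnd π.HIn).map
          ((π.branchDown t true π.certTicks).map (u ⊠ branch π.decideFst true m)) := by
  have h : π.converterDown t π.certTicks = (Channel.discardFst Unit _).andThen
      ((π.makeDecision.andThen ((controlled (Channel.adjoin π.Local π.idleIn)
        (π.qkdDown t π.certTicks)).onSnd π.CertMem)).andThen
        (Channel.leftComm π.CertMem π.HIn _)) := by
    simp only [converterDown, converter, lt_self_iff_false, if_false, if_true]
  rw [h]
  refine BL.ext_tmul fun x y => ?_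
  revert y
  refine BL.ext_tmul fun β l => ?_
  simp only [branchDown, branch, decideFst, makeDecision, Channel.andThen_map,
    Channel.discardFst_tmul, cond_false, cond_true,
    Channel.unassoc_tmul, Channel.ampl_tmul, Channel.discardSnd_tmul, map_smul, TC.smul_tmul,
    compress_mk_tmul, TC.tmul_smul, Channel.adjoin_map, Channel.assoc_tmul, Channel.onSnd_tmul,
    controlled_tmul, TC.tmul_add, map_add, smul_add, leftComm_embed, Channel.leftComm_tmul,
    embed_map, Channel.value_map_one]
  module

/-! ### Keys that are already perfect -/

theorem noKey_post {n m : Type} {τ : ℕ} (hτ : ∀ j, t j ≠ τ) (Φ : Channel n m) (x : TC n) :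
    ((idealKeys t τ).ampl m).map ((Φ.andThen (Channel.adjoin m noKey)).map x)
      = (Φ.andThen (Channel.adjoin m noKey)).map x := by
  simp [noKey, idealKeys_basis_of_ne t τ hτ]

theorem converterUp_post {τ : ℕ} (hτ : τ < π.certTicks) (ht : ∀ j, π.certTicks ≤ t j)
    (x : TC (π.HOut × π.ProtMem)) :
    ((idealKeys t τ).ampl _).map ((π.converterUp t τ).map x) = (π.converterUp t τ).map x := by
  simp only [converterUp, converter, if_pos hτ]
  exact noKey_post t (fun j h => absurd (ht j) (by omega)) _ _

theorem rejectUp_post (τ : ℕ) (x : TC (π.HOut × π.Local)) :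
    ((idealKeys t τ).ampl π.Local).map ((π.branchUp t false τ).map x)
      = (π.branchUp t false τ).map x := by
  simp only [branchUp, cond_false, rejectOut]
  split_ifs with h
  · obtain ⟨j, rfl⟩ := h
    simp [idealKeys_basis_of_eq, perfectKeys_zero]
  · exact noKey_post t (by simpa using h) _ _

theorem qkdUp_post_of_ne {τ : ℕ} (hτ : ∀ j, t j ≠ τ) (x : TC (π.HOut × π.Local)) :
    ((idealKeys t τ).ampl π.Local).map ((π.qkdUp t τ).map x) = (π.qkdUp t τ).map x := by
  unfold qkdUp
  cases running t τ with
  | none => exact noKey_post t hτ _ _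
  | some j =>
    simp only [if_neg (hτ j).symm]
    exact noKey_post t hτ _ _

theorem qkdUp_post_of_eq {j : Fin N} (hj : running t (t j) = some j) (x : TC (π.HOut × π.Local)) :
    ((idealKeys t (t j)).ampl π.Local).map ((π.qkdUp t (t j)).map x)
      = (replaceKeys.ampl π.Local).map ((π.qkdUp t (t j)).map x) := by
  simp only [qkdUp, hj, if_true, Channel.andThen_map, Channel.adjoin_map, Channel.swap_tmul,
    Channel.ampl_tmul, idealKeys_classical]

/-! ### The running instance -/

theorem running_eq_some {j : Fin N} {τ : ℕ} (h1 : τ ≤ t j)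
    (h2 : ∀ i < j, t i < τ) : running t τ = some j := by
  rw [running, List.find?_eq_some_iff_getElem]
  refine ⟨by simpa using h1, j, by simp, by simp, fun i hi => ?_⟩
  simpa using h2 ⟨i, by omega⟩ hi

theorem running_eq_none {τ : ℕ} (h : ∀ i, t i < τ) : running t τ = none := by
  rw [running, List.find?_eq_none]
  intro i _
  simpa using h i

theorem start_le (ht : StrictMono t) (hπ : ∀ j, π.certTicks ≤ t j) (j : Fin N) :
    π.start t j ≤ t j := by
  unfold start
  split_ifs with h
  · exact hπ j
  · exact ht (Fin.lt_def.2 (by simp; omega))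

theorem lt_start (ht : StrictMono t) {i j : Fin N} (h : i < j) : t i < π.start t j := by
  have hj : j.val ≠ 0 := by have := Fin.lt_def.1 h; omega
  rw [start, dif_neg hj, Nat.lt_succ_iff]
  exact ht.monotone (Fin.le_def.2 (by have := Fin.lt_def.1 h; simp; omega))

theorem running_of_start_le (ht : StrictMono t) {j : Fin N} {τ : ℕ} (h1 : π.start t j ≤ τ)
    (h2 : τ ≤ t j) : running t τ = some j :=
  running_eq_some t h2 fun _ hi => (π.lt_start t ht hi).trans_le h1

/-- An instance begins by resetting the local memories; a second reset just before makes no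
difference. -/
theorem qkdDown_absorb {j : Fin N} (hj : running t (π.start t j) = some j) (u : TC Unit)
    (l : TC π.Local) : (π.branchDown t true (π.start t j)).map
        (u ⊠ (Channel.reset π.Local π.fresh).map l)
      = (π.branchDown t true (π.start t j)).map (u ⊠ l) := by
  simp only [branchDown, cond_true, qkdDown, hj, if_true, Channel.andThen_map,
    Channel.discardFst_tmul, map_smul, Channel.reset_map, Channel.trace_map, TC.trace_one, one_smul]

/-- This isolates the forced clear bits as the last operation before the messages are sent, as
`attachStep_absorb_inner` requires. -/
theorem qkdDown_clear {j : Fin N} (hj : running t (π.start t j) = some j) (hj0 : j.val ≠ 0) :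
    ∃ d : Channel (Unit × π.Local) (π.HIn × π.Local), ∀ u (l : TC π.Local),
      (π.branchDown t true (π.start t j)).map (u ⊠ l)
        = ((clearBits X Y Q C).ampl π.Local).map (d.map (u ⊠ l)) := by
  refine ⟨(Channel.discardFst Unit π.Local).andThen ((Channel.reset π.Local π.fresh)
    |>.andThen (((π.qkd j).alice.send (π.start t j)).prod ((π.qkd j).bob.send (π.start t j)))
    |>.andThen (Channel.interchange _ _ _ _)), fun u l => ?_⟩
  have : π.forceClear = clearBits X Y Q C := rfl
  simp only [branchDown, cond_true, qkdDown, hj, hj0, if_true, true_and, ne_eq, not_false_eq_true,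
    this, Channel.andThen_map]

end Protocol

/-! ### Probabilities and trace distance -/

namespace Channel
variable {n : Type}

/-- The probability of the outcome `true`. -/
def probTrue (Φ : Channel n Bool) (x : TC n) : ℝ := ((Φ.map x).1 true true).re

theorem probTrue_add (Φ : Channel n Bool) (x y : TC n) :
    Φ.probTrue (x + y) = Φ.probTrue x + Φ.probTrue y := by simp [probTrue]

theorem probTrue_sub (Φ : Channel n Bool) (x y : TC n) :
    Φ.probTrue (x - y) = Φ.probTrue x - Φ.probTrue y := by simp [probTrue]

theorem probTrue_nonneg (Φ : Channel n Bool) {x : TC n} (hx : x.1.PosSemidef) :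
    0 ≤ Φ.probTrue x :=
  (Complex.nonneg_iff.1 (Φ.map_posSemidef hx).diag_nonneg).1

theorem probTrue_le (Φ : Channel n Bool) {x : TC n} (hx : x.1.PosSemidef) :
    Φ.probTrue x ≤ (TC.trace x).re := by
  rw [← Φ.trace_map x]
  exact TC.diag_re_le_trace (Φ.map_posSemidef hx) true

theorem abs_probTrue_sub_le_trace (Φ Ψ : Channel n Bool) {x : TC n} (hx : x.1.PosSemidef) :
    |Φ.probTrue x - Ψ.probTrue x| ≤ (TC.trace x).re :=
  abs_sub_le_of_nonneg_of_le (Φ.probTrue_nonneg hx) (Φ.probTrue_le hx) (Ψ.probTrue_nonneg hx)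
    (Ψ.probTrue_le hx)

/-- The positive and negative parts of the difference have equal traces, each half the trace norm,
and both probabilities lie between zero and that common value. -/
theorem abs_probTrue_sub_le (Φ : Channel n Bool) {x y : TC n} (hxy : TC.trace x = TC.trace y)
    {ε : ℝ} (hε : 0 ≤ ε) (h : traceDist x y ≤ ENNReal.ofReal ε) :
    |Φ.probTrue x - Φ.probTrue y| ≤ ε := by
  -- The trace norm is an infimum over decompositions; the slack `δ` yields an actual decomposition
  -- to work with.
  refine le_of_forall_pos_le_add fun δ hδ => ?_
  have h1 : traceNorm (x - y) < ENNReal.ofReal (2 * (ε + δ)) := by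
    rw [traceDist, ENNReal.div_le_iff (by simp) (by simp)] at h
    refine h.trans_lt ?_
    rw [← ENNReal.ofReal_ofNat, ← ENNReal.ofReal_mul hε,
      ENNReal.ofReal_lt_ofReal_iff (by positivity)]
    linarith
  simp only [traceNorm, iInf_lt_iff] at h1
  obtain ⟨P, R, hPR, h2⟩ := h1
  have h3 := (ENNReal.ofReal_lt_ofReal_iff (by positivity)).1 h2
  have h4 : TC.trace P = TC.trace R := by
    have := congrArg TC.trace hPR.eq
    rw [map_sub, map_sub, hxy, sub_self] at this
    exact (sub_eq_zero.1 this.symm)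
  rw [← probTrue_sub, hPR.eq, probTrue_sub]
  refine (abs_sub_le_of_nonneg_of_le (Φ.probTrue_nonneg hPR.pos) (Φ.probTrue_le hPR.pos)
    (Φ.probTrue_nonneg hPR.neg) (h4 ▸ Φ.probTrue_le hPR.neg)).trans ?_
  rw [← h4, Complex.add_re] at h3
  linarith

theorem probTrue_smul (Φ : Channel n Bool) (r : ℝ) (x : TC n) :
    Φ.probTrue ((r : ℂ) • x) = r * Φ.probTrue x := by
  simp [probTrue]

/-- Two channels that are close on all states are close on all positive operators. -/
theorem abs_probTrue_sub_le_of_state {m : Type} (Φ Ψ : Channel n m) (Γ : Channel m Bool) {ε : ℝ}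
    (hε : 0 ≤ ε) (h : ∀ σ : State n, traceDist (Φ.map σ.1) (Ψ.map σ.1) ≤ ENNReal.ofReal ε)
    {x : TC n} (hx : x.1.PosSemidef) :
    |Γ.probTrue (Φ.map x) - Γ.probTrue (Ψ.map x)| ≤ ε * (TC.trace x).re := by
  -- An operator of trace zero cannot be normalised to a state, but there both probabilities vanish.
  obtain h0 | h0 := (TC.trace_re_nonneg hx).eq_or_lt
  · have := abs_probTrue_sub_le_trace (Φ.andThen Γ) (Ψ.andThen Γ) hx
    rw [← h0] at this ⊢
    simpa [probTrue] using this
  · set p := (TC.trace x).re with hp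
    have hs : x = (p : ℂ) • (((p⁻¹ : ℝ) : ℂ) • x) := by
      rw [smul_smul, ← Complex.ofReal_mul, mul_inv_cancel₀ h0.ne', Complex.ofReal_one, one_smul]
    let σ : State n := ⟨((p⁻¹ : ℝ) : ℂ) • x, hx.smul (Complex.zero_le_real.2 (by positivity)), by
      rw [map_smul, TC.trace_eq_re hx, smul_eq_mul, ← Complex.ofReal_mul, ← hp,
        inv_mul_cancel₀ h0.ne', Complex.ofReal_one]⟩
    have := abs_probTrue_sub_le Γ (by simp) hε (h σ)
    have e : ∀ Θ : Channel n m, Γ.probTrue (Θ.map x) = p * Γ.probTrue (Θ.map σ.1) := fun Θ => by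
      rw [← probTrue_smul, ← map_smul, ← hs]
    rw [e, e, ← mul_sub, abs_mul, abs_of_pos h0, mul_comm]
    exact mul_le_mul_of_nonneg_right this h0.le

end Channel

/-! ### Acceptance probabilities, splitting and post-processing -/

namespace Distinguisher
variable {I O K : Type} (D : Distinguisher I O)

/-- The probability that `D` outputs `true` when its memory is in the given state. -/
def value {M : Type} (x : TC (D.Mem × M)) : ℝ :=
  ((Channel.discardSnd D.Mem M).andThen D.guess).probTrue x

theorem value_onSnd {M M' : Type} (e : Channel M M') (x : TC (D.Mem × M)) :
    D.value ((e.onSnd D.Mem).map x) = D.value x := by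
  simp only [value, Channel.probTrue, Channel.andThen_map, Strategy.discardSnd_onSnd]

theorem prob_eq_value (S : System I O) : D.prob S
    = D.value ((D.rounds S 0 D.ticks).map (D.init.map TC.one ⊠ S.init.map TC.one)) := by
  rw [← Strategy.stateAfter_map_one]
  rfl

/-- A system that, at tick `τ`, splits into two branches. -/
theorem value_rounds_add {S W₀ W₁ : System I O} {e₀ : Channel W₀.Mem S.Mem}
    {e₁ : Channel W₁.Mem S.Mem} {χ₀ : TC S.Mem → TC W₀.Mem} {χ₁ : TC S.Mem → TC W₁.Mem}
    {X₀ : TC (D.Mem × S.Mem) → TC (D.Mem × W₀.Mem)} {X₁ : TC (D.Mem × S.Mem) → TC (D.Mem × W₁.Mem)}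
    [hX₀ : BL X₀] [hX₁ : BL X₁] (τ k : ℕ)
    (h₀ : ∀ a m, X₀ (a ⊠ m) = a ⊠ χ₀ m) (h₁ : ∀ a m, X₁ (a ⊠ m) = a ⊠ χ₁ m)
    (h : ∀ i m, (S.step τ).map (i ⊠ m) = (e₀.onSnd O).map ((W₀.step τ).map (i ⊠ χ₀ m))
      + (e₁.onSnd O).map ((W₁.step τ).map (i ⊠ χ₁ m)))
    (hs₀ : ∀ τ', τ < τ' → ∀ i m, (S.step τ').map (i ⊠ e₀.map m)
      = (e₀.onSnd O).map ((W₀.step τ').map (i ⊠ m)))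
    (hs₁ : ∀ τ', τ < τ' → ∀ i m, (S.step τ').map (i ⊠ e₁.map m)
      = (e₁.onSnd O).map ((W₁.step τ').map (i ⊠ m))) (x : TC (D.Mem × S.Mem)) :
    D.value ((D.rounds S τ (k + 1)).map x) = D.value ((D.rounds W₀ τ (k + 1)).map (X₀ x))
      + D.value ((D.rounds W₁ τ (k + 1)).map (X₁ x)) := by
  have hr : (D.round S τ).map x = (e₀.onSnd D.Mem).map ((D.round W₀ τ).map (X₀ x))
      + (e₁.onSnd D.Mem).map ((D.round W₁ τ).map (X₁ x)) := by
    rw [Strategy.round_map, Strategy.release_eq, D.releaseWith_add τ h₀ h₁ h, map_add,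
      Strategy.ampl_onSnd, Strategy.ampl_onSnd]
    rfl
  rw [Strategy.rounds_succ_left, hr, map_add,
    D.rounds_sim (τ + 1) k fun τ' h1 _ => hs₀ τ' (by omega),
    D.rounds_sim (τ + 1) k fun τ' h1 _ => hs₁ τ' (by omega), value, Channel.probTrue_add]
  change D.value _ + D.value _ = _
  rw [value_onSnd, value_onSnd, Strategy.rounds_succ_left, Strategy.rounds_succ_left]

end Distinguisher

theorem System.post_sim {I O K : Type} {S W : System I (O × K)} (G : ℕ → Channel O O)
    {e : Channel W.Mem S.Mem} {τ : ℕ} {x : TC (I × S.Mem)} {y : TC (I × W.Mem)}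
    (h : (S.step τ).map x = (e.onSnd (O × K)).map ((W.step τ).map y)) :
    ((S.post G).step τ).map x = (e.onSnd (O × K)).map (((W.post G).step τ).map y) := by
  change (((G τ).ampl K).ampl S.Mem).map ((S.step τ).map x)
    = (e.onSnd (O × K)).map ((((G τ).ampl K).ampl W.Mem).map ((W.step τ).map y))
  rw [h, Strategy.ampl_onSnd]

theorem System.post_add {I O K : Type} {S W₀ W₁ : System I (O × K)} (G : ℕ → Channel O O)
    {e₀ : Channel W₀.Mem S.Mem} {e₁ : Channel W₁.Mem S.Mem} {τ : ℕ} {x : TC (I × S.Mem)}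
    {y₀ : TC (I × W₀.Mem)} {y₁ : TC (I × W₁.Mem)}
    (h : (S.step τ).map x = (e₀.onSnd (O × K)).map ((W₀.step τ).map y₀)
      + (e₁.onSnd (O × K)).map ((W₁.step τ).map y₁)) :
    ((S.post G).step τ).map x = (e₀.onSnd (O × K)).map (((W₀.post G).step τ).map y₀)
      + (e₁.onSnd (O × K)).map (((W₁.post G).step τ).map y₁) := by
  change (((G τ).ampl K).ampl S.Mem).map ((S.step τ).map x)
    = (e₀.onSnd (O × K)).map ((((G τ).ampl K).ampl W₀.Mem).map ((W₀.step τ).map y₀))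
      + (e₁.onSnd (O × K)).map ((((G τ).ampl K).ampl W₁.Mem).map ((W₁.step τ).map y₁))
  rw [h, map_add, Strategy.ampl_onSnd, Strategy.ampl_onSnd]

theorem Strategy.rounds_post {I O K : Type} (A : Strategy I (O × K)) (S : System I (O × K))
    (G : ℕ → Channel O O) (τ k : ℕ) (h : ∀ τ', τ ≤ τ' → τ' < τ + k → ∀ i m,
      (((G τ').ampl K).ampl S.Mem).map ((S.step τ').map (i ⊠ m)) = (S.step τ').map (i ⊠ m))
    (x : TC (A.Mem × S.Mem)) : (A.rounds (S.post G) τ k).map x = (A.rounds S τ k).map x :=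
  A.rounds_congr (i := S.init) (i' := S.init) (s := S.step) (s' := (S.post G).step) τ k h x

/-- Post-processing acts on the output alone and so commutes with the embeddings of the branches.
The memory types are spelled out because those of the processed systems agree with them only after
unfolding. -/
theorem Distinguisher.value_rounds_post_add {I O K : Type} (D : Distinguisher I (O × K))
    (G : ℕ → Channel O O) {S W₀ W₁ : System I (O × K)} {e₀ : Channel W₀.Mem S.Mem}
    {e₁ : Channel W₁.Mem S.Mem} {χ₀ : TC S.Mem → TC W₀.Mem} {χ₁ : TC S.Mem → TC W₁.Mem}
    {X₀ : TC (D.Mem × S.Mem) → TC (D.Mem × W₀.Mem)} {X₁ : TC (D.Mem × S.Mem) → TC (D.Mem × W₁.Mem)}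
    [hX₀ : BL X₀] [hX₁ : BL X₁] (τ k : ℕ)
    (h₀ : ∀ a m, X₀ (a ⊠ m) = a ⊠ χ₀ m) (h₁ : ∀ a m, X₁ (a ⊠ m) = a ⊠ χ₁ m)
    (h : ∀ i m, (S.step τ).map (i ⊠ m) = (e₀.onSnd (O × K)).map ((W₀.step τ).map (i ⊠ χ₀ m))
      + (e₁.onSnd (O × K)).map ((W₁.step τ).map (i ⊠ χ₁ m)))
    (hs₀ : ∀ τ', τ < τ' → ∀ i m, (S.step τ').map (i ⊠ e₀.map m)
      = (e₀.onSnd (O × K)).map ((W₀.step τ').map (i ⊠ m)))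
    (hs₁ : ∀ τ', τ < τ' → ∀ i m, (S.step τ').map (i ⊠ e₁.map m)
      = (e₁.onSnd (O × K)).map ((W₁.step τ').map (i ⊠ m))) (x : TC (D.Mem × S.Mem)) :
    D.value (M := S.Mem) ((D.rounds (S.post G) τ (k + 1)).map x)
      = D.value (M := W₀.Mem) ((D.rounds (W₀.post G) τ (k + 1)).map (X₀ x))
      + D.value (M := W₁.Mem) ((D.rounds (W₁.post G) τ (k + 1)).map (X₁ x)) :=
  D.value_rounds_add (S := S.post G) (W₀ := W₀.post G) (W₁ := W₁.post G) (e₀ := e₀) (e₁ := e₁)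
    (χ₀ := χ₀) (χ₁ := χ₁) (hX₀ := hX₀) (hX₁ := hX₁) τ k h₀ h₁
    (fun i m => System.post_add (S := S) (W₀ := W₀) (W₁ := W₁) G (h i m))
    (fun τ' h i m => System.post_sim (S := S) (W := W₀) G (hs₀ τ' h i m))
    (fun τ' h i m => System.post_sim (S := S) (W := W₁) G (hs₁ τ' h i m)) x

/-! ### The protocol attached to the starting resources -/

namespace Protocol
variable {N : ℕ} {X Y Z Q C : Type} (π : Protocol N X Y Z Q C) (t : Fin N → ℕ)
  (M : DeviceModel X Y Z Q)

/-- The real system. -/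
abbrev realSystem : System (Unit × EveIn Q) (KeyOut × EveOut Q C) :=
  (π.converter t).attachFst (Rini C M)

/-- The real system after the decision `b`. -/
abbrev branchSystem (b : Bool) : System (Unit × EveIn Q) (KeyOut × EveOut Q C) :=
  (π.branchConverter t b).attachFst (Rini C M)

/-- Embedding of the memory of a branch. -/
abbrev embedMem (b : Bool) : Channel (π.branchSystem t M b).Mem (π.realSystem t M).Mem :=
  (π.embed b).ampl (Rini C M).Mem

theorem realSystem_step_embed {τ : ℕ} (hτ : π.certTicks < τ) (b : Bool)
    (x : TC (Unit × EveIn Q)) (y : TC (π.branchSystem t M b).Mem) :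
    ((π.realSystem t M).step τ).map (x ⊠ (π.embedMem t M b).map y)
      = ((π.embedMem t M b).onSnd (KeyOut × EveOut Q C)).map
        (((π.branchSystem t M b).step τ).map (x ⊠ y)) :=
  attachStep_sim (down := π.branchDown t b τ) (down' := π.converterDown t τ)
    (Φ := (Rini C M).step τ) (π.converterDown_embed t hτ b) (π.converterUp_embed t hτ.le b) x y

/-- Makes the decision, which it puts in the first register, keeping the attacker's memory. -/
def decideAll {a r : Type} : Channel (a × (π.ProtMem × r)) (Bool × (a × (π.Local × r))) :=
  (((π.decideFst.ampl r).andThen (Channel.assoc Bool π.Local r)).onSnd a).andThen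
    (Channel.leftComm a Bool (π.Local × r))

theorem branch_tmul_right {a n m r : Type} (c : Channel n (Bool × m)) (b : Bool) (x : TC a)
    (y : TC n) (s : TC r) :
    branch (((((c.ampl r).andThen (Channel.assoc Bool m r)).onSnd a).andThen
      (Channel.leftComm a Bool (m × r)))) b (x ⊠ (y ⊠ s)) = x ⊠ (branch c b y ⊠ s) := by
  simp only [branch, Channel.andThen_map, Channel.onSnd_tmul, Channel.ampl_tmul]
  generalize c.map y = z
  revert z
  refine BL.ext_tmul fun β z => ?_
  simp [compress_mk_tmul]

/-- The part of the state of the memory in which the decision is `b`. -/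
def branchMem (b : Bool) (y : TC (π.realSystem t M).Mem) : TC (π.branchSystem t M b).Mem :=
  branch ((π.decideFst.ampl (Rini C M).Mem).andThen
    (Channel.assoc Bool π.Local (Rini C M).Mem)) b y

/-- The part of the joint state in which the decision is `b`. -/
def branchAll {a : Type} (b : Bool) (x : TC (a × (π.realSystem t M).Mem)) :
    TC (a × (π.branchSystem t M b).Mem) := branch π.decideAll b x

theorem bl_branchAll {a : Type} (b : Bool) : BL (π.branchAll t M b (a := a)) := BL.branch _ _

theorem branchAll_posSemidef {a : Type} (b : Bool) {x : TC (a × (π.realSystem t M).Mem)}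
    (hx : x.1.PosSemidef) : (π.branchAll t M b x).1.PosSemidef :=
  branch_posSemidef π.decideAll b hx

theorem branchAll_tmul {a : Type} (b : Bool) (x : TC a) : ∀ y : TC (π.realSystem t M).Mem,
    π.branchAll t M b (x ⊠ y) = x ⊠ π.branchMem t M b y := by
  change ∀ y : TC (π.ProtMem × (Rini C M).Mem), branch π.decideAll b (x ⊠ y)
    = x ⊠ branch ((π.decideFst.ampl (Rini C M).Mem).andThen
      (Channel.assoc Bool π.Local (Rini C M).Mem)) b y
  refine BL.ext_tmul fun y s => ?_
  rw [decideAll, branch_tmul_right]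
  congr 1
  simp only [branch, Channel.andThen_map, Channel.ampl_tmul]
  generalize π.decideFst.map y = z
  revert z
  exact BL.ext_tmul fun β z => by simp [compress_mk_tmul]

theorem realSystem_step_decide (x : TC (Unit × EveIn Q)) :
    ∀ y : TC (π.realSystem t M).Mem, ((π.realSystem t M).step π.certTicks).map (x ⊠ y)
      = ((π.embedMem t M false).onSnd (KeyOut × EveOut Q C)).map
        (((π.branchSystem t M false).step π.certTicks).map (x ⊠ π.branchMem t M false y))
      + ((π.embedMem t M true).onSnd (KeyOut × EveOut Q C)).map
        (((π.branchSystem t M true).step π.certTicks).map (x ⊠ π.branchMem t M true y)) := by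
  change ∀ y : TC (π.ProtMem × (Rini C M).Mem), (attachStep (π.converterDown t π.certTicks)
      ((Rini C M).step π.certTicks) (π.converterUp t π.certTicks)).map (x ⊠ y)
    = (((π.embed false).ampl (Rini C M).Mem).onSnd (KeyOut × EveOut Q C)).map
        ((attachStep (π.branchDown t false π.certTicks) ((Rini C M).step π.certTicks)
          (π.branchUp t false π.certTicks)).map (x ⊠
          branch ((π.decideFst.ampl (Rini C M).Mem).andThen
            (Channel.assoc Bool π.Local (Rini C M).Mem)) false y))
      + (((π.embed true).ampl (Rini C M).Mem).onSnd (KeyOut × EveOut Q C)).map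
        ((attachStep (π.branchDown t true π.certTicks) ((Rini C M).step π.certTicks)
          (π.branchUp t true π.certTicks)).map (x ⊠
          branch ((π.decideFst.ampl (Rini C M).Mem).andThen
            (Channel.assoc Bool π.Local (Rini C M).Mem)) true y))
  refine BL.ext_tmul fun y s => ?_
  have hb : ∀ b, branch ((π.decideFst.ampl (Rini C M).Mem).andThen
      (Channel.assoc Bool π.Local (Rini C M).Mem)) b (y ⊠ s) = branch π.decideFst b y ⊠ s := by
    intro b
    simp only [branch, Channel.andThen_map, Channel.ampl_tmul]
    generalize π.decideFst.map y = z
    revert z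
    exact BL.ext_tmul fun β z => by simp [compress_mk_tmul]
  rw [hb, hb]
  exact attachStep_add (fun i => π.converterDown_decide t i y)
    (π.converterUp_embed t le_rfl false) (π.converterUp_embed t le_rfl true) s x

/-- Discarding everything but the decision bit turns the weight of the approving branch into the
probability of approval. -/
theorem approvalProb_eq (A : Strategy (Unit × EveIn Q) (KeyOut × EveOut Q C)) :
    approvalProb π t M A = (TC.trace (π.branchAll t M true
      ((A.stateAfter (π.realSystem t M) π.certTicks).map TC.one))).re := by
  refine Eq.trans ?_ (congrArg Complex.re (trace_branch π.decideAll true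
    ((A.stateAfter (π.realSystem t M) π.certTicks).map TC.one))).symm
  have key : ∀ x : TC (A.Mem × (π.ProtMem × (Rini C M).Mem)),
      (Channel.discardSnd Bool (A.Mem × (π.Local × (Rini C M).Mem))).map (π.decideAll.map x)
        = π.decide.map ((Channel.discardSnd π.CertMem (Bool × π.Local)).map
          ((Channel.discardSnd π.ProtMem (Rini C M).Mem).map
            ((Channel.discardFst A.Mem (π.ProtMem × (Rini C M).Mem)).map x))) := by
    refine BL.ext_tmul fun a y => ?_
    revert y
    refine BL.ext_tmul fun y s => ?_
    revert y
    refine BL.ext_tmul fun x y => ?_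
    revert y
    refine BL.ext_tmul fun β l => ?_
    simp [decideAll, decideFst, smul_smul]
    congr 1
    ring
  exact congrArg (fun z : TC Bool => (z.1 true true).re)
    (key ((A.stateAfter (π.realSystem t M) π.certTicks).map TC.one)).symm

theorem branchSystem_false_post (τ : ℕ) (i : TC (Unit × EveIn Q))
    (m : TC (π.branchSystem t M false).Mem) :
    (((idealKeys t τ).ampl (EveOut Q C)).ampl (π.branchSystem t M false).Mem).map
      (((π.branchSystem t M false).step τ).map (i ⊠ m))
      = ((π.branchSystem t M false).step τ).map (i ⊠ m) :=
  attachStep_post (down := π.branchDown t false τ) (Φ := (Rini C M).step τ)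
    (up := π.branchUp t false τ) (up' := π.branchUp t false τ)
    (fun o m => π.rejectUp_post t τ (o ⊠ m)) (i ⊠ m)

theorem branchSystem_true_post {τ : ℕ} (hτ : ∀ j, t j ≠ τ) (i : TC (Unit × EveIn Q))
    (m : TC (π.branchSystem t M true).Mem) :
    (((idealKeys t τ).ampl (EveOut Q C)).ampl (π.branchSystem t M true).Mem).map
      (((π.branchSystem t M true).step τ).map (i ⊠ m))
      = ((π.branchSystem t M true).step τ).map (i ⊠ m) :=
  attachStep_post (down := π.branchDown t true τ) (Φ := (Rini C M).step τ)
    (up := π.branchUp t true τ) (up' := π.branchUp t true τ)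
    (fun o m => π.qkdUp_post_of_ne t hτ (o ⊠ m)) (i ⊠ m)

/-- Both sides equal the tick in which `up` is followed by `replaceKeys`, the two replacements
having the same effect on the keys of an instance. -/
theorem branchSystem_true_post_replaceKeys {j : Fin N} (hj : running t (t j) = some j)
    (i : TC (Unit × EveIn Q)) (m : TC (π.branchSystem t M true).Mem) :
    (((idealKeys t (t j)).ampl (EveOut Q C)).ampl (π.branchSystem t M true).Mem).map
      (((π.branchSystem t M true).step (t j)).map (i ⊠ m))
      = ((replaceKeys.ampl (EveOut Q C)).ampl (π.branchSystem t M true).Mem).map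
        (((π.branchSystem t M true).step (t j)).map (i ⊠ m)) := by
  have h1 := attachStep_post (K := EveOut Q C) (r := (Rini C M).Mem) (G := idealKeys t (t j))
    (down := π.branchDown t true (t j)) (Φ := (Rini C M).step (t j))
    (up := π.branchUp t true (t j))
    (up' := (π.branchUp t true (t j)).andThen (replaceKeys.ampl π.Local))
    (fun o m => π.qkdUp_post_of_eq t hj (o ⊠ m)) (i ⊠ m)
  have h2 := attachStep_post (K := EveOut Q C) (r := (Rini C M).Mem) (G := replaceKeys)
    (down := π.branchDown t true (t j)) (Φ := (Rini C M).step (t j))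
    (up := π.branchUp t true (t j))
    (up' := (π.branchUp t true (t j)).andThen (replaceKeys.ampl π.Local))
    (fun o m => rfl) (i ⊠ m)
  exact h1.trans h2.symm

theorem realSystem_post {τ : ℕ} (hτ : τ < π.certTicks) (ht : ∀ j, π.certTicks ≤ t j)
    (i : TC (Unit × EveIn Q)) (m : TC (π.realSystem t M).Mem) :
    (((idealKeys t τ).ampl (EveOut Q C)).ampl (π.realSystem t M).Mem).map
      (((π.realSystem t M).step τ).map (i ⊠ m))
      = ((π.realSystem t M).step τ).map (i ⊠ m) :=
  attachStep_post (down := π.converterDown t τ) (Φ := (Rini C M).step τ)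
    (up := π.converterUp t τ) (up' := π.converterUp t τ)
    (fun o m => π.converterUp_post t hτ ht (o ⊠ m)) (i ⊠ m)

/-- Only the branch in which the decision is to approve contributes to the advantage. -/
theorem abs_prob_sub_post (hπ : ∀ j, π.certTicks ≤ t j)
    (D : Distinguisher (Unit × EveIn Q) (KeyOut × EveOut Q C)) {B : ℝ} (hB : 0 ≤ B)
    (h : ∀ k, |D.value ((D.rounds (π.branchSystem t M true) π.certTicks k).map
        (π.branchAll t M true ((D.stateAfter (π.realSystem t M) π.certTicks).map TC.one)))
      - D.value ((D.rounds ((π.branchSystem t M true).post (idealKeys t)) π.certTicks k).map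
        (π.branchAll t M true ((D.stateAfter (π.realSystem t M) π.certTicks).map TC.one)))|
      ≤ B) :
    |D.prob (π.realSystem t M) - D.prob ((π.realSystem t M).post (idealKeys t))| ≤ B := by
  have hearly : ∀ k ≤ π.certTicks, ∀ x : TC (D.Mem × (π.realSystem t M).Mem),
      (D.rounds ((π.realSystem t M).post (idealKeys t)) 0 k).map x
        = (D.rounds (π.realSystem t M) 0 k).map x := fun k hk x =>
    D.rounds_post _ _ 0 k (fun τ' _ h2 => π.realSystem_post t M (by omega) hπ) x
  rw [D.prob_eq_value, D.prob_eq_value]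
  -- A distinguisher that stops before the tick of the decision sees identical systems.
  obtain hT | hT := le_or_gt D.ticks π.certTicks
  · have := hearly D.ticks hT (D.init.map TC.one ⊠ (π.realSystem t M).init.map TC.one)
    have e : D.value ((D.rounds ((π.realSystem t M).post (idealKeys t)) 0 D.ticks).map
        (D.init.map TC.one ⊠ ((π.realSystem t M).post (idealKeys t)).init.map TC.one))
        = D.value ((D.rounds (π.realSystem t M) 0 D.ticks).map
          (D.init.map TC.one ⊠ (π.realSystem t M).init.map TC.one)) := congrArg D.value this
    rw [e, sub_self, abs_zero]
    exact hB
  · obtain ⟨k, hk⟩ := Nat.exists_eq_add_of_lt hT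
    rw [add_assoc] at hk
    set x₀ := (D.stateAfter (π.realSystem t M) π.certTicks).map TC.one with hx₀
    have h1 : (D.rounds (π.realSystem t M) 0 D.ticks).map
        (D.init.map TC.one ⊠ (π.realSystem t M).init.map TC.one)
        = (D.rounds (π.realSystem t M) π.certTicks (k + 1)).map x₀ := by
      rw [hk, Strategy.rounds_add, zero_add, hx₀, Strategy.stateAfter_map_one]
    have h2 : (D.rounds ((π.realSystem t M).post (idealKeys t)) 0 D.ticks).map
        (D.init.map TC.one ⊠ ((π.realSystem t M).post (idealKeys t)).init.map TC.one)
        = (D.rounds ((π.realSystem t M).post (idealKeys t)) π.certTicks (k + 1)).map x₀ := by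
      rw [hk, Strategy.rounds_add, zero_add, hx₀, Strategy.stateAfter_map_one]
      exact congrArg _ (hearly _ le_rfl _)
    rw [h1, h2]
    have h3 := D.value_rounds_add (S := π.realSystem t M) (W₀ := π.branchSystem t M false)
      (W₁ := π.branchSystem t M true) (hX₀ := π.bl_branchAll t M false)
      (hX₁ := π.bl_branchAll t M true) π.certTicks k (π.branchAll_tmul t M false)
      (π.branchAll_tmul t M true) (π.realSystem_step_decide t M)
      (fun τ' h => π.realSystem_step_embed t M h false)
      (fun τ' h => π.realSystem_step_embed t M h true) x₀
    have h4 := D.value_rounds_post_add (idealKeys t) (S := π.realSystem t M)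
      (W₀ := π.branchSystem t M false)
      (W₁ := π.branchSystem t M true) (hX₀ := π.bl_branchAll t M false)
      (hX₁ := π.bl_branchAll t M true) π.certTicks k (π.branchAll_tmul t M false)
      (π.branchAll_tmul t M true) (π.realSystem_step_decide t M)
      (fun τ' h => π.realSystem_step_embed t M h false)
      (fun τ' h => π.realSystem_step_embed t M h true) x₀
    -- The rejecting branch is unaffected by the replacement, so its contribution cancels in the
    -- difference.
    have h5 := D.rounds_post (π.branchSystem t M false) (idealKeys t) π.certTicks (k + 1)
      (fun τ' _ _ => π.branchSystem_false_post t M τ') (π.branchAll t M false x₀)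
    have e := congrArg (D.value (M := (π.branchSystem t M false).Mem)) h5
    refine le_trans (le_of_eq ?_) (h (k + 1))
    rw [h3]
    refine (congrArg (fun z => |_ - z|) h4).trans ?_
    refine (congrArg (fun z => |_ - (z + _)|) e).trans ?_
    rw [add_sub_add_left_eq_sub]
    rfl

end Protocol

theorem Rini_step_clear {X Y Z Q C : Type} (M : DeviceModel X Y Z Q) (τ : ℕ)
    (h : TC (AliceIn X Q C × BobIn Y Q C)) (e : TC (EveIn Q)) (s : TC (Rini C M).Mem) :
    ((Rini C M).step τ).map (((clearBits X Y Q C).map h ⊠ e) ⊠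
        (Channel.reset (Rini C M).Mem (Rini C M).init).map s)
      = ((Rini C M).step τ).map (((clearBits X Y Q C).map h ⊠ e) ⊠ s) :=
  RiniStep_clear (Φ := M.prep.system.step τ) (Ψ := M.meas.system.step τ) (p₀ := M.prep.init)
    (m₀ := M.meas.init) (M.prep.step_clear τ) (M.meas.step_clear τ) (Rini_init M) h e s

/-! ### Independence between instances and the hybrid argument -/

namespace Protocol
variable {N : ℕ} {X Y Z Q C : Type} (π : Protocol N X Y Z Q C) (t : Fin N → ℕ)
  (M : DeviceModel X Y Z Q)

/-- Fresh local memories. -/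
abbrev resetLocal : Channel (π.branchSystem t M true).Mem (π.branchSystem t M true).Mem :=
  (Channel.reset π.Local π.fresh).ampl (Rini C M).Mem

/-- Fresh states of the resources. -/
abbrev resetDevices : Channel (π.branchSystem t M true).Mem (π.branchSystem t M true).Mem :=
  (Channel.reset (Rini C M).Mem (Rini C M).init).onSnd π.Local

theorem step_resetLocal {j : Fin N} (hj : running t (π.start t j) = some j)
    (i : TC (Unit × EveIn Q)) (m : TC (π.branchSystem t M true).Mem) :
    ((π.branchSystem t M true).step (π.start t j)).map (i ⊠ (π.resetLocal t M).map m)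
      = ((π.branchSystem t M true).step (π.start t j)).map (i ⊠ m) :=
  attachStep_absorb (Φ := (Rini C M).step (π.start t j)) (up := π.branchUp t true (π.start t j))
    (fun i m => π.qkdDown_absorb t hj i m) i m

theorem step_resetDevices {j : Fin N} (hj : running t (π.start t j) = some j) (hj0 : j.val ≠ 0)
    (i : TC (Unit × EveIn Q)) (m : TC (π.branchSystem t M true).Mem) :
    ((π.branchSystem t M true).step (π.start t j)).map (i ⊠ (π.resetDevices t M).map m)
      = ((π.branchSystem t M true).step (π.start t j)).map (i ⊠ m) := by
  obtain ⟨d, hd⟩ := π.qkdDown_clear t hj hj0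
  exact attachStep_absorb_inner (up := π.branchUp t true (π.start t j)) hd
    (Rini_step_clear M (π.start t j)) i m

/-- The output when no instance is running. -/
def idleOut (Q C : Type) : Channel (Unit × EveIn Q) (KeyOut × EveOut Q C) :=
  Channel.reset _ (Channel.value ((none, none), (none, (none, none))))

/-- The converter sends a fixed message and ignores the answer; if the inner system then shows the
adversary something fixed, all outputs are fixed and every input contributes only its trace. -/
theorem attachStep_idle {n J h o K κ r : Type} {down : Channel (n × l) (h × l)}
    {Φ : Channel ((h × J) × r) ((o × K) × r)} {up : Channel (o × l) (κ × l)} {a : TC h} {b : TC κ}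
    {c : TC K}
    (hd : ∀ u m, down.map (u ⊠ m) = TC.trace u • (a ⊠ m))
    (hu : ∀ y m, up.map (y ⊠ m) = TC.trace y • (b ⊠ m))
    (hΦ : ∀ e s, (Channel.discardSnd K r).map ((Channel.discardFst o (K × r)).map
      ((Channel.assoc o K r).map (Φ.map ((a ⊠ e) ⊠ s)))) = (TC.trace e * TC.trace s) • c)
    (u : TC n) (e : TC J) (m : TC l) (s : TC r) :
    (Channel.discardSnd (κ × K) (l × r)).map ((attachStep down Φ up).map ((u ⊠ e) ⊠ (m ⊠ s)))
      = (TC.trace u * TC.trace e * (TC.trace m * TC.trace s)) • (b ⊠ c) := by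
  -- After the inner step, only the adversary's share of the output survives, next to the fixed
  -- output of `up`.
  have h1 : ∀ y : TC ((o × K) × r), (Channel.discardSnd (κ × K) (l × r)).map
      ((Channel.interchange κ l K r).map ((up.ampl (K × r)).map
        ((Channel.interchange o K l r).map ((Channel.leftComm l (o × K) r).map (m ⊠ y)))))
      = TC.trace m • (b ⊠ (Channel.discardSnd K r).map ((Channel.discardFst o (K × r)).map
        ((Channel.assoc o K r).map y))) := by
    refine BL.ext_tmul fun y s => ?_
    revert y
    refine BL.ext_tmul fun y k => ?_
    simp [hu, smul_smul]
    congr 1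
    ring
  simp only [attachStep, Channel.andThen_map, Channel.interchange_tmul, Channel.ampl_tmul, hd,
    TC.smul_tmul, map_smul, Channel.leftComm_tmul, Channel.onSnd_tmul, h1, hΦ, TC.tmul_smul,
    smul_smul]
  congr 1
  ring

/-- Used after the last instance, where no clearing follows: the device memories may still depend on
earlier keys, but nothing reads them. -/
theorem step_idle {τ : ℕ} (hτ : running t τ = none) : ∀ (i : TC (Unit × EveIn Q))
    (m : TC (π.branchSystem t M true).Mem),
    (Channel.discardSnd (KeyOut × EveOut Q C) (π.branchSystem t M true).Mem).map
      (((π.branchSystem t M true).step τ).map (i ⊠ m))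
      = TC.trace m • (idleOut Q C).map i := by
  intro i
  change ∀ m : TC (π.Local × (Rini C M).Mem), (Channel.discardSnd (KeyOut × EveOut Q C)
    (π.Local × (Rini C M).Mem)).map ((attachStep (π.branchDown t true τ) ((Rini C M).step τ)
      (π.branchUp t true τ)).map (i ⊠ m)) = TC.trace m • (idleOut Q C).map i
  refine BL.ext_tmul fun m s => ?_
  revert i
  refine BL.ext_tmul fun u e => ?_
  rw [attachStep_idle (a := TC.basis (((false, none), (none, none)), (((false, none), none), none)))
    (b := TC.basis (none, none)) (c := TC.basis (none, (none, none)))]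
  · simp only [idleOut, Channel.reset_map, TC.trace_tmul, Channel.value_map_one, smul_smul]
    rw [← TC.basis_prod]
    congr 1
    ring
  · intro u m
    simp only [branchDown, cond_true, qkdDown, hτ, idleIn, Channel.andThen_map,
      Channel.discardFst_tmul, map_smul, Channel.adjoin_map, Channel.value_map_one]
  · intro y m
    simp only [branchUp, cond_true, qkdUp, hτ, noKey, Channel.andThen_map,
      Channel.discardFst_tmul, map_smul, Channel.adjoin_map, Channel.value_map_one]
  · intro e s
    exact RiniStep_idle (C := C) (Φ := M.prep.system.step τ) (Ψ := M.meas.system.step τ)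
      (M.prep.step_idle τ) (M.meas.step_idle τ) e s

/-- After the end of an instance, what the attacker holds in the future depends only on what he
holds at this moment. -/
theorem exists_rounds_discard (ht : StrictMono t) (hπ : ∀ j, π.certTicks ≤ t j)
    (A : Strategy (Unit × EveIn Q) (KeyOut × EveOut Q C)) (j : Fin N) (k : ℕ) :
    ∃ Λ : Channel A.Mem A.Mem, ∀ x,
      (Channel.discardSnd A.Mem (π.branchSystem t M true).Mem).map
        ((A.rounds (π.branchSystem t M true) (t j + 1) k).map x)
      = Λ.map ((Channel.discardSnd A.Mem (π.branchSystem t M true).Mem).map x) := by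
  by_cases hj : j.val + 1 < N
  -- Another instance follows, and its first tick is the next one. If the interaction stops before
  -- that tick, nothing is to be shown.
  · cases k with
    | zero => exact ⟨Channel.id _, fun x => rfl⟩
    | succ k =>
      have hs : π.start t ⟨j.val + 1, hj⟩ = t j + 1 := by simp [start]
      have hr : running t (π.start t ⟨j.val + 1, hj⟩) = some ⟨j.val + 1, hj⟩ :=
        π.running_of_start_le t ht le_rfl (π.start_le t ht hπ _)
      -- The two resets together discard everything but the attacker's memory and prepare a fixed
      -- state.
      have e : ∀ x : TC (A.Mem × (π.Local × (Rini C M).Mem)),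
          (((Channel.reset π.Local π.fresh).ampl (Rini C M).Mem).onSnd A.Mem).map
            ((((Channel.reset (Rini C M).Mem (Rini C M).init).onSnd π.Local).onSnd A.Mem).map x)
          = ((Channel.adjoin A.Mem ((Channel.adjoin (Rini C M).Mem π.fresh).comp
              (Rini C M).init)).andThen (Channel.swap _ _)).map
              ((Channel.discardSnd A.Mem (π.Local × (Rini C M).Mem)).map x) := by
        refine BL.ext_tmul fun a y => ?_
        revert y
        refine BL.ext_tmul fun l s => ?_
        have : ((Channel.adjoin (Rini C M).Mem π.fresh).comp (Rini C M).init).map TC.one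
            = π.fresh.map TC.one ⊠ (Rini C M).init.map TC.one := by
          change ((Rini C M).init.andThen (Channel.adjoin (Rini C M).Mem π.fresh)).map TC.one = _
          simp
        simp [this, smul_smul, mul_comm]
      refine ⟨((Channel.adjoin A.Mem ((Channel.adjoin (Rini C M).Mem π.fresh).comp
              (Rini C M).init)).andThen (Channel.swap _ _)).andThen <|
        (A.rounds (π.branchSystem t M true) (t j + 1) (k + 1)).andThen
          (Channel.discardSnd A.Mem (π.branchSystem t M true).Mem), fun x => ?_⟩
      -- The following instance is never the first one, so it does clear the devices; both resets
      -- can thus be inserted before its first tick without effect.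
      have h1 := A.rounds_absorb (e := π.resetDevices t M) (t j + 1) k
        (hs ▸ π.step_resetDevices t M hr (by simp)) x
      have h2 := A.rounds_absorb (e := π.resetLocal t M) (t j + 1) k
        (hs ▸ π.step_resetLocal t M hr) (((π.resetDevices t M).onSnd A.Mem).map x)
      rw [← h1, ← h2]
      exact congrArg (fun y => (Channel.discardSnd A.Mem (π.branchSystem t M true).Mem).map
        ((A.rounds (π.branchSystem t M true) (t j + 1) (k + 1)).map y)) (e x)
  · refine A.exists_rounds_discard (t j + 1) k fun τ h1 _ => ⟨idleOut Q C, π.step_idle t M ?_⟩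
    refine running_eq_none t fun i => ?_
    have : t i ≤ t j := ht.monotone (Fin.le_def.2 (by omega))
    omega

/-- The tick at which instance `m` starts, or, for `m = N`, the first one after all instances. -/
def nextStart (m : ℕ) : ℕ := if h : 0 < m ∧ m ≤ N then t ⟨m - 1, by omega⟩ + 1 else π.certTicks

theorem nextStart_zero : π.nextStart t 0 = π.certTicks := by simp [nextStart]

theorem nextStart_succ (j : Fin N) : π.nextStart t (j.val + 1) = t j + 1 := by
  simp [nextStart, j.isLt]

theorem nextStart_val (j : Fin N) : π.nextStart t j.val = π.start t j := by
  unfold nextStart start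
  by_cases h : j.val = 0
  · simp [h]
  · rw [dif_pos ⟨by omega, by omega⟩, dif_neg h]

theorem lt_nextStart (ht : StrictMono t) {i : Fin N} {m : ℕ} (hm : m ≤ N) (hi : i.val < m) :
    t i < π.nextStart t m := by
  rw [nextStart, dif_pos ⟨by omega, hm⟩, Nat.lt_succ_iff]
  exact ht.monotone (Fin.le_def.2 (by simp; omega))

/-- The security of one instance, in terms of the joint state at its end. -/
theorem abs_sub_le_of_secureInstance {𝒜 : Set (Strategy (Unit × EveIn Q) (KeyOut × EveOut Q C))}
    {A : Strategy (Unit × EveIn Q) (KeyOut × EveOut Q C)} (hA : A ∈ 𝒜) {j : Fin N} {ε : ℝ}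
    (hε : 0 ≤ ε) (h : SecureInstance π t M 𝒜 j ε) (ht : StrictMono t)
    (hπ : ∀ j, π.certTicks ≤ t j) (Γ : Channel ((KeyOut × EveOut Q C) × A.Mem) Bool)
    {x : TC (A.Mem × (π.branchSystem t M true).Mem)} (hx : x.1.PosSemidef)
    {z : TC ((KeyOut × EveOut Q C) × A.Mem)}
    (hz : z = (Channel.discardSnd _ (π.branchSystem t M true).Mem).map
      ((A.release (π.branchSystem t M true) (t j)).map
      ((A.rounds (π.branchSystem t M true) (π.start t j) (t j - π.start t j)).map x))) :
    |Γ.probTrue z - Γ.probTrue (((replaceKeys.ampl (EveOut Q C)).ampl A.Mem).map z)|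
      ≤ ε * (TC.trace x).re := by
  have hr : running t (π.start t j) = some j :=
    π.running_of_start_le t ht le_rfl (π.start_le t ht hπ _)
  -- Criterion 2 concerns only the attacker and the devices, so the local memories are dropped; the
  -- instance starts with fresh ones anyway.
  let x' : TC (A.Mem × (Rini C M).Mem) :=
    ((Channel.discardFst π.Local (Rini C M).Mem).onSnd A.Mem).map x
  have hx' : x'.1.PosSemidef := Channel.map_posSemidef _ hx
  have e1 : ∀ x : TC (A.Mem × (π.Local × (Rini C M).Mem)),
      ((Channel.adjoin (Rini C M).Mem π.fresh).onSnd A.Mem).map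
        (((Channel.discardFst π.Local (Rini C M).Mem).onSnd A.Mem).map x)
      = (((Channel.reset π.Local π.fresh).ampl (Rini C M).Mem).onSnd A.Mem).map x := by
    refine BL.ext_tmul fun a y => ?_
    revert y
    exact BL.ext_tmul fun l s => by simp
  have e2 : (A.release (π.branchSystem t M true) (t j)).map
      ((A.rounds (π.branchSystem t M true) (π.start t j) (t j - π.start t j)).map
        (((π.resetLocal t M).onSnd A.Mem).map x))
      = (A.release (π.branchSystem t M true) (t j)).map
      ((A.rounds (π.branchSystem t M true) (π.start t j) (t j - π.start t j)).map x) := by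
    -- If the instance lasts a single tick, no complete round precedes the release of the keys, and
    -- the release itself absorbs the reset.
    obtain h0 | h0 := (π.start_le t ht hπ j).eq_or_lt
    · rw [h0, Nat.sub_self]
      exact A.releaseWith_absorb (t j) (h0 ▸ π.step_resetLocal t M hr) x
    · obtain ⟨k, hk⟩ := Nat.exists_eq_add_of_lt h0
      have : t j - π.start t j = k + 1 := by omega
      rw [this, A.rounds_absorb (e := π.resetLocal t M) _ _ (π.step_resetLocal t M hr)]
  have e3 : (instanceChannel π t M A j).map x'
      = (Channel.assoc KeyOut (EveOut Q C) A.Mem).map z := by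
    rw [hz, ← e2]
    exact congrArg (fun y => (Channel.assoc KeyOut (EveOut Q C) A.Mem).map
      ((Channel.discardSnd _ (π.branchSystem t M true).Mem).map
        ((A.release (π.branchSystem t M true) (t j)).map
          ((A.rounds (π.branchSystem t M true) (π.start t j) (t j - π.start t j)).map y)))) (e1 x)
  have e4 : ∀ z : TC ((KeyOut × EveOut Q C) × A.Mem),
      (Channel.unassoc KeyOut (EveOut Q C) A.Mem).map
        ((Channel.assoc KeyOut (EveOut Q C) A.Mem).map z) = z := by
    refine BL.ext_tmul fun y a => ?_
    revert y
    exact BL.ext_tmul fun κ k => by simp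
  have e5 : ∀ z : TC ((KeyOut × EveOut Q C) × A.Mem),
      (Channel.unassoc KeyOut (EveOut Q C) A.Mem).map ((replaceKeys.ampl (EveOut Q C × A.Mem)).map
        ((Channel.assoc KeyOut (EveOut Q C) A.Mem).map z))
        = ((replaceKeys.ampl (EveOut Q C)).ampl A.Mem).map z := by
    refine BL.ext_tmul fun y a => ?_
    revert y
    exact BL.ext_tmul fun κ k => by simp
  have key := Channel.abs_probTrue_sub_le_of_state (instanceChannel π t M A j)
    ((instanceChannel π t M A j).andThen (replaceKeys.ampl (EveOut Q C × A.Mem)))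
    ((Channel.unassoc KeyOut (EveOut Q C) A.Mem).andThen Γ) hε (h A hA) hx'
  have etr : TC.trace x' = TC.trace x := Channel.trace_map _ _
  rw [Channel.andThen_map, e3, etr] at key
  simpa only [Channel.probTrue, Channel.andThen_map, e4, e5] using key

/-- The instances from the `m`-th one on. -/
theorem abs_value_sub_le {𝒜 : Set (Strategy (Unit × EveIn Q) (KeyOut × EveOut Q C))}
    {ε : Fin N → ℝ} (hε : ∀ j, 0 ≤ ε j) (h : ∀ j, SecureInstance π t M 𝒜 j (ε j))
    (ht : StrictMono t) (hπ : ∀ j, π.certTicks ≤ t j)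
    (D : Distinguisher (Unit × EveIn Q) (KeyOut × EveOut Q C)) (hD : D.toStrategy ∈ 𝒜) (d : ℕ) :
    ∀ m, m + d = N → ∀ (k : ℕ) (x : TC (D.Mem × (π.branchSystem t M true).Mem)),
      x.1.PosSemidef →
      |D.value (M := (π.branchSystem t M true).Mem)
          ((D.rounds (π.branchSystem t M true) (π.nextStart t m) k).map x)
        - D.value (M := (π.branchSystem t M true).Mem)
          ((D.rounds ((π.branchSystem t M true).post (idealKeys t)) (π.nextStart t m) k).map x)|
      ≤ (∑ i with m ≤ i.val, ε i) * (TC.trace x).re := by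
  have hnn : ∀ m (x : TC (D.Mem × (π.branchSystem t M true).Mem)), x.1.PosSemidef →
      0 ≤ (∑ i : Fin N with m ≤ i.val, ε i) * (TC.trace x).re := fun m x hx =>
    mul_nonneg (Finset.sum_nonneg fun i _ => hε i) (TC.trace_re_nonneg hx)
  induction d with
  | zero =>
    intro m hm k x hx
    -- All release times have passed, so replacing keys has no effect any more.
    rw [D.rounds_post (π.branchSystem t M true) (idealKeys t) _ k fun τ h1 _ =>
      π.branchSystem_true_post t M fun i hi =>
        absurd (π.lt_nextStart t ht (m := m) (by omega) (i := i) (by omega)) (by omega),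
      sub_self, abs_zero]
    exact hnn m x hx
  | succ d ih =>
    intro m hm k x hx
    obtain ⟨j, rfl⟩ : ∃ j : Fin N, m = j.val := ⟨⟨m, by omega⟩, rfl⟩
    -- The last of these `k` ticks is still earlier than `t j`, and no other release time lies in
    -- this range.
    have hsame : ∀ k, π.nextStart t j.val + k ≤ t j → ∀ x,
        (D.rounds ((π.branchSystem t M true).post (idealKeys t)) (π.nextStart t j.val) k).map x
          = (D.rounds (π.branchSystem t M true) (π.nextStart t j.val) k).map x := fun k hk x =>
      D.rounds_post _ _ _ k (fun τ h1 h2 => π.branchSystem_true_post t M fun i hi => by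
        obtain hij | hij := lt_or_ge i j
        · have := π.lt_nextStart t ht (m := j.val) (by omega) (i := i) hij
          omega
        · have := ht.monotone hij
          omega) x
    obtain hk | hk := le_or_gt (π.nextStart t j.val + k) (t j)
    · have e := congrArg (D.value (M := (π.branchSystem t M true).Mem)) (hsame k hk x)
      refine (congrArg (fun r => |_ - r|) e).le.trans ?_
      rw [sub_self, abs_zero]
      exact hnn _ x hx
    · have hle : π.nextStart t j.val ≤ t j := π.nextStart_val t j ▸ π.start_le t ht hπ j
      -- The ticks are divided into `k₁` before the release, the tick `t j` itself, and `k₂` after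
      -- it.
      obtain ⟨k₁, hk₁⟩ := Nat.exists_eq_add_of_le hle
      obtain ⟨k₂, rfl⟩ : ∃ k₂, k = k₁ + (k₂ + 1) := ⟨k - k₁ - 1, by omega⟩
      set y := (D.rounds (π.branchSystem t M true) (π.nextStart t j.val) k₁).map x with hy
      have hypos : y.1.PosSemidef := Channel.map_posSemidef _ hx
      set z := (D.release (π.branchSystem t M true) (t j)).map y with hzdef
      -- The hybrid: the keys of instance `j` are replaced at the moment of their release, and `w'`
      -- is the resulting joint state after the tick.
      set z' := ((replaceKeys.ampl (EveOut Q C)).ampl D.Mem).ampl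
        (π.branchSystem t M true).Mem |>.map z with hz'def
      set w' := ((D.prog.recv (t j)).ampl (π.branchSystem t M true).Mem).map z' with hw'
      have hw'pos : w'.1.PosSemidef :=
        Channel.map_posSemidef _ (Channel.map_posSemidef _ (Channel.map_posSemidef _ hypos))
      have htr : TC.trace w' = TC.trace x := by
        rw [hw', Channel.trace_map, hz'def, Channel.trace_map, hzdef, Channel.trace_map, hy,
          Channel.trace_map]
      have h1 : (D.rounds (π.branchSystem t M true) (π.nextStart t j.val) (k₁ + (k₂ + 1))).map x
          = (D.rounds (π.branchSystem t M true) (t j + 1) k₂).map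
            (((D.prog.recv (t j)).ampl (π.branchSystem t M true).Mem).map z) := by
        rw [Strategy.rounds_add, Strategy.rounds_succ_left, ← hk₁]
        rfl
      have hrun : running t (t j) = some j :=
        π.running_of_start_le t ht (π.start_le t ht hπ j) le_rfl
      have hz' : (D.release ((π.branchSystem t M true).post (idealKeys t)) (t j)).map y = z' := by
        have e1 := D.releaseWith_congr (t j)
          (Φ := ((π.branchSystem t M true).step (t j)).andThen
            ((replaceKeys.ampl (EveOut Q C)).ampl (π.branchSystem t M true).Mem))
          (Φ' := ((π.branchSystem t M true).step (t j)).andThen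
            (((idealKeys t (t j)).ampl (EveOut Q C)).ampl (π.branchSystem t M true).Mem))
          (π.branchSystem_true_post_replaceKeys t M hrun) y
        exact e1.trans (D.releaseWith_andThen (t j) _ _ y)
      have h2 : (D.rounds ((π.branchSystem t M true).post (idealKeys t)) (π.nextStart t j.val)
          (k₁ + (k₂ + 1))).map x
          = (D.rounds ((π.branchSystem t M true).post (idealKeys t)) (t j + 1) k₂).map w' := by
        have e : ∀ v, (D.rounds ((π.branchSystem t M true).post (idealKeys t))
            (π.nextStart t j.val) (k₁ + (k₂ + 1))).map v
            = (D.rounds ((π.branchSystem t M true).post (idealKeys t)) (t j + 1) k₂).map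
              (((D.prog.recv (t j)).ampl ((π.branchSystem t M true).post (idealKeys t)).Mem).map
                ((D.release ((π.branchSystem t M true).post (idealKeys t)) (t j)).map
                  ((D.rounds ((π.branchSystem t M true).post (idealKeys t))
                    (π.nextStart t j.val) k₁).map v))) := fun v => by
          rw [Strategy.rounds_add, Strategy.rounds_succ_left, ← hk₁]
          rfl
        refine (e x).trans (congrArg (fun v => (D.rounds ((π.branchSystem t M true).post
          (idealKeys t)) (t j + 1) k₂).map (((D.prog.recv (t j)).ampl
            ((π.branchSystem t M true).post (idealKeys t)).Mem).map v)) ?_)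
        exact (congrArg (D.release ((π.branchSystem t M true).post (idealKeys t)) (t j)).map
          (hsame k₁ hk₁.ge x)).trans hz'
      -- The rest of the interaction with the real branch becomes one two-outcome test on what the
      -- attacker holds at time `t j`, to which the security of instance `j` applies.
      obtain ⟨Λ, hΛ⟩ := π.exists_rounds_discard t M ht hπ D.toStrategy j k₂
      have hval : ∀ v, D.value ((D.rounds (π.branchSystem t M true) (t j + 1) k₂).map
          (((D.prog.recv (t j)).ampl (π.branchSystem t M true).Mem).map v))
          = (((D.prog.recv (t j)).andThen Λ).andThen D.guess).probTrue
            ((Channel.discardSnd _ (π.branchSystem t M true).Mem).map v) := fun v => by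
        simp only [Distinguisher.value, Channel.probTrue, Channel.andThen_map, hΛ,
          Strategy.discardSnd_ampl]
      have hsec := π.abs_sub_le_of_secureInstance t M hD (hε j) (h j) ht hπ
        (((D.prog.recv (t j)).andThen Λ).andThen D.guess) hx
        (z := (Channel.discardSnd _ (π.branchSystem t M true).Mem).map z) (by
          have : t j - π.start t j = k₁ := by rw [← nextStart_val]; omega
          rw [this, ← nextStart_val])
      have hsec' : |D.value ((D.rounds (π.branchSystem t M true) (t j + 1) k₂).map
          (((D.prog.recv (t j)).ampl (π.branchSystem t M true).Mem).map z))
          - D.value ((D.rounds (π.branchSystem t M true) (t j + 1) k₂).map w')|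
          ≤ ε j * (TC.trace x).re := by
        rw [hw', hval, hval, hz'def, Strategy.discardSnd_ampl]
        exact hsec
      -- From the hybrid state on, the real and the overwritten branch differ only through later
      -- instances. The hybrid has the same trace as `x`, so the weight of the branch is unchanged.
      have hih := ih (j.val + 1) (by omega) k₂ w' hw'pos
      rw [nextStart_succ, htr] at hih
      have hsum : ∑ i : Fin N with j.val ≤ i.val, ε i
          = ε j + ∑ i : Fin N with j.val + 1 ≤ i.val, ε i := by
        rw [← Finset.sum_insert (by simp)]
        refine Finset.sum_congr ?_ fun _ _ => rfl
        ext i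
        simp only [Finset.mem_filter, Finset.mem_univ, true_and, Finset.mem_insert, Fin.ext_iff]
        omega
      rw [h1, h2, hsum, add_mul]
      -- The intermediate point is the real branch continued from the hybrid state.
      exact (abs_sub_le _ _ _).trans (add_le_add hsec' hih)

end Protocol

theorem stateAfter_posSemidef {I O : Type} (A : Strategy I O) (S : System I O) (k : ℕ) :
    ((A.stateAfter S k).map TC.one).1.PosSemidef := Channel.map_posSemidef _ TC.one_posSemidef

end AC

end

theorem mainTheorem3 {X Y Z Q C : Type} {N Nparam : ℕ} {𝒰 : Type*} {P : Type*}
    (model : 𝒰 → AC.DeviceModel X Y Z Q) (μ : 𝒰 → Fin Nparam → P) (S : Set (Fin Nparam → P))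
    (t : Fin N → ℕ) (ht : StrictMono t)
    (π : AC.Protocol N X Y Z Q C) (hπ : ∀ j, π.certTicks ≤ t j)
    (𝒜 : Set (AC.Strategy (Unit × AC.EveIn Q) (AC.KeyOut × AC.EveOut Q C)))
    (𝒟 : Set (AC.Distinguisher (Unit × AC.EveIn Q) (AC.KeyOut × AC.EveOut Q C)))
    (h𝒟 : ∀ D ∈ 𝒟, D.toStrategy ∈ 𝒜)
    (εcert : ℝ) (εQKD : Fin N → ℝ) (hcert : 0 ≤ εcert) (hQKD : ∀ j, 0 ≤ εQKD j)
    (criterion1 : ∀ M, μ M ∉ S → ∀ A ∈ 𝒜, AC.approvalProb π t (model M) A ≤ εcert)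
    (criterion2 : ∀ M, μ M ∈ S → ∀ j, AC.SecureInstance π t (model M) 𝒜 j (εQKD j)) (M : 𝒰) :
    AC.Constructs 𝒟 (π.converter t) (AC.Rini C (model M)) (AC.Rideal t)
      (εcert + ∑ j, εQKD j) := by
  -- The message with no signal and no classical texts is an arbitrary filling of the simulator's
  -- buffer.
  refine ⟨AC.simulator (π.realSystem t (model M)) (none, (none, none)), ?_⟩
  refine iSup₂_le fun D hD => ENNReal.ofReal_le_ofReal ?_
  rw [AC.simulator_prob]
  have hsum : 0 ≤ ∑ j, εQKD j := Finset.sum_nonneg fun j _ => hQKD j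
  refine π.abs_prob_sub_post t (model M) hπ D (add_nonneg hcert hsum) fun k => ?_
  have hpos := π.branchAll_posSemidef t (model M) true
    (AC.stateAfter_posSemidef D.toStrategy (π.realSystem t (model M)) π.certTicks)
  have htr := π.approvalProb_eq t (model M) D.toStrategy
  by_cases hM : μ M ∈ S
  · have h := π.abs_value_sub_le t (model M) hQKD (criterion2 M hM) ht hπ D (h𝒟 D hD) N 0
      (zero_add N) k _ hpos
    rw [π.nextStart_zero] at h
    refine h.trans ?_
    -- The approving branch is part of a normalised state, so its trace is at most one and the sum
    -- of the instance errors needs no further factor.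
    have h1 := AC.BL.compress_re_le (Prod.mk_right_injective true)
      (AC.Channel.map_posSemidef π.decideAll
        (AC.stateAfter_posSemidef D.toStrategy (π.realSystem t (model M)) π.certTicks))
    have h2 : (AC.TC.trace (π.branchAll t (model M) true
        ((D.stateAfter (π.realSystem t (model M)) π.certTicks).map AC.TC.one))).re ≤ 1 := by
      refine h1.trans ?_
      refine (congrArg Complex.re ((AC.Channel.trace_map π.decideAll _).trans
        (AC.Channel.trace_map (D.stateAfter (π.realSystem t (model M)) π.certTicks) _))).le.trans ?_
      simp
    simp only [zero_le, Finset.filter_true]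
    exact (mul_le_of_le_one_right hsum h2).trans (le_add_of_nonneg_left hcert)
  -- For a model outside the set nothing is known about the keys, but the approving branch
  -- contributes at most its trace, which criterion 1 bounds.
  · have h := (AC.Channel.abs_probTrue_sub_le_trace
      ((D.rounds (π.branchSystem t (model M) true) π.certTicks k).andThen
        ((AC.Channel.discardSnd D.Mem (π.branchSystem t (model M) true).Mem).andThen D.guess))
      ((D.rounds ((π.branchSystem t (model M) true).post (AC.idealKeys t)) π.certTicks k).andThen
        ((AC.Channel.discardSnd D.Mem (π.branchSystem t (model M) true).Mem).andThen D.guess))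
      hpos).trans (htr.symm.le.trans (criterion1 M hM _ (h𝒟 D hD)))
    exact h.trans (le_add_of_nonneg_right hsum)
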